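/- Let $H$ be a $d$-sparse Hamiltonian on $n$ qubits, i.e. a Hermitian $2^n\times 2^n$ matrix with at most $d$ nonzero entries in each row, and let $\|H\|_{\max}$ be its largest entry in absolute value. $H$ is accessed through two oracles: $O_H|j,k,z\rangle=|j,k,z\oplus H_{jk}\rangle$, where $H_{jk}$ is written as a bit string, and $O_F|j,\ell\rangle=|j,f(j,\ell)\rangle$, where the $f(j,\ell)$ with $\ell\in[d]$ are distinct column indices that include those of all nonzero entries of row $j$, and $\ell\mapsto f(j,\ell)$ is extended to a permutation of $[2^n]$. The bit strings are binary fixed-point numbers of any fixed length that represent the entries of $H$ exactly, or only up to an error of at most $\epsilon/(C\,d\,t)$. Let $t>0$ and $\epsilon>0$, and put $\tau:=d\,\|H\|_{\max}\,t$. For every $\tau_0>0$ there is a constant $C>0$, depending on $\tau_0$ only, such that whenever $\tau\ge\tau_0$ and $\tau/\epsilon>e$, the evolution $\rho\mapsto e^{-iHt}\rho\,e^{iHt}$ can be simulated to within $\epsilon$ in diamond norm by a quantum circuit that uses at most $$C\,\tau\,\frac{\log(\tau/\epsilon)}{\log\log(\tau/\epsilon)}$$ queries to $O_H$, $O_F$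 and $O_F^{-1}$, and at most $$C\,\tau\,\bigl[n+\log^{5/2}(\tau/\epsilon)\bigr]\,\frac{\log(\tau/\epsilon)}{\log\log(\tau/\epsilon)}$$ additional 2-qubit gates. The circuit starts with its ancilla qubits in $|0\rangle$ and discards them at the end; it depends only on $n$, $d$, $\|H\|_{\max}$, $t$, $\epsilon$, $\tau_0$ and the format of the bit strings, and otherwise uses $H$ only through the oracle queries. -/

import Mathlib

open scoped Matrix ENNReal

noncomputable section

namespace SparseSim

/-! ### Norms -/

/-- The trace norm (Schatten 1-norm): the sum of the singular values of `X`, i.e. of the square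
roots of the eigenvalues of `Xᴴ * X`, with multiplicity. -/
def traceNorm {A : Type*} [Fintype A] [DecidableEq A] (X : Matrix A A ℂ) : ℝ :=
  ∑ i, √((Matrix.isHermitian_conjTranspose_mul_self X).eigenvalues i)

/-- The map `Φ ⊗ id` acting on matrices over `A × R`. -/
def extendMap {A R : Type*} (Φ : Matrix A A ℂ →ₗ[ℂ] Matrix A A ℂ)
    (X : Matrix (A × R) (A × R) ℂ) : Matrix (A × R) (A × R) ℂ :=
  Matrix.of fun x y => Φ (Matrix.of fun a b => X (a, x.2) (b, y.2)) x.1 y.1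

/-- The diamond norm: the supremum of `‖(Φ ⊗ id) X‖₁` over all finite-dimensional reference
systems and all operators `X` with `‖X‖₁ ≤ 1`. It takes values in `[0, ∞]`, so that the supremum
is always meaningful. -/
def diamondNorm {A : Type*} [Fintype A] [DecidableEq A]
    (Φ : Matrix A A ℂ →ₗ[ℂ] Matrix A A ℂ) : ℝ≥0∞ :=
  ⨆ (r : ℕ) (X : Matrix (A × Fin r) (A × Fin r) ℂ) (_ : traceNorm X ≤ 1),
    ENNReal.ofReal (traceNorm (extendMap Φ X))

/-- The largest absolute value of an entry. -/
def maxNorm {A : Type*} (H : Matrix A A ℂ) : ℝ := ⨆ x : A × A, ‖H x.1 x.2‖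

/-- At most `d` nonzero entries in every row. -/
def IsSparse {A : Type*} (d : ℕ) (H : Matrix A A ℂ) : Prop :=
  ∀ j, {k | H j k ≠ 0}.encard ≤ d

/-! ### Quantum operations -/

/-- `ρ ↦ K ρ Kᴴ`. -/
def conjMap {A : Type*} [Fintype A] (K : Matrix A A ℂ) : Matrix A A ℂ →ₗ[ℂ] Matrix A A ℂ where
  toFun ρ := K * ρ * Kᴴ
  map_add' ρ σ := by simp [Matrix.mul_add, Matrix.add_mul]
  map_smul' c ρ := by simp

/-- The exact evolution `ρ ↦ e^{-iHt} ρ (e^{-iHt})ᴴ`. -/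
def evolution {A : Type*} [Fintype A] [DecidableEq A] (H : Matrix A A ℂ) (t : ℝ) :
    Matrix A A ℂ →ₗ[ℂ] Matrix A A ℂ :=
  conjMap (NormedSpace.exp ((-(Complex.I * (t : ℂ))) • H))

/-- The channel induced on the qubits `S` by an operator `U` on the qubits `S ⊕ B`: append the
qubits `B` in the state `|0…0⟩`, apply `U`, and trace out the qubits `B`. The Kraus operators are
`⟨z| U |0…0⟩`, where `z` runs over the basis states of `B`. -/
def inducedChannel {S B : Type*} [Fintype S] [Fintype B] [DecidableEq S] [DecidableEq B]
    (U : Matrix (S ⊕ B → Bool) (S ⊕ B → Bool) ℂ) :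
    Matrix (S → Bool) (S → Bool) ℂ →ₗ[ℂ] Matrix (S → Bool) (S → Bool) ℂ :=
  ∑ z : B → Bool,
    conjMap (Matrix.of fun x y => U (Sum.elim x z) (Sum.elim y (fun _ => false)))

/-- The operator `M ⊗ 1` on the qubits `Q`, where `M` acts on the qubits selected by `r`. -/
def onRegister {R Q : Type*} [Fintype R] [Fintype Q] [DecidableEq Q] (r : R ↪ Q)
    (M : Matrix (R → Bool) (R → Bool) ℂ) : Matrix (Q → Bool) (Q → Bool) ℂ :=
  Matrix.of fun x y => if ∀ q, (∀ i, r i ≠ q) → x q = y q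
    then M (x ∘ r) (y ∘ r) else 0

/-! ### Sparse Hamiltonian oracles -/

/-- The integer in `[0, 2 ^ n)` encoded by `n` bits. -/
def bitsVal {n : ℕ} (x : Fin n → Bool) : ℕ := ∑ i, if x i then 2 ^ (i : ℕ) else 0

/-- The integer in `[-2 ^ p, 2 ^ p)` encoded by `p + 1` bits in two's complement. -/
def signedVal {p : ℕ} (x : Fin (p + 1) → Bool) : ℤ :=
  (∑ i : Fin p, if x i.castSucc then 2 ^ (i : ℕ) else 0) - if x (Fin.last p) then 2 ^ p else 0

/-- The bit positions of a string that represents a matrix entry: `p + 1` bits for the real part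
and `p + 1` bits for the imaginary part. -/
abbrev EntryBits (p : ℕ) : Type := Fin (p + 1) ⊕ Fin (p + 1)

/-- The complex number represented in fixed-point binary, with `2 ^ s` the weight of the least
significant bit. -/
def entryVal {p : ℕ} (s : ℤ) (z : EntryBits p → Bool) : ℂ :=
  (2 : ℂ) ^ s * ((signedVal (z ∘ Sum.inl) : ℂ) + (signedVal (z ∘ Sum.inr) : ℂ) * Complex.I)

/-- The data that the two oracles hold. Row and column indices are `n`-bit strings. `entry j k` is
the string that represents the entry in row `j` and column `k`; `col j` sends (the binary form of)
`l` to the column index of the `l`-th listed element of row `j`, and is invertible since the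
column indices are computed in place. -/
structure OracleData (n p : ℕ) where
  entry : (Fin n → Bool) → (Fin n → Bool) → (EntryBits p → Bool)
  col : (Fin n → Bool) → Equiv.Perm (Fin n → Bool)

/-- The data describe the `d`-sparse matrix `H`: the first `d` listed positions of every row
(numbered from `0`) contain all its nonzero entries, and every string represents its entry of `H`
in fixed-point binary up to an error of at most `η`. -/
def OracleData.Describes {n p : ℕ} (O : OracleData n p) (d : ℕ) (s : ℤ) (η : ℝ)
    (H : Matrix (Fin n → Bool) (Fin n → Bool) ℂ) : Prop :=
  (∀ j k, H j k ≠ 0 → ∃ l, bitsVal l < d ∧ O.col j l = k) ∧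
  (∀ j k, ‖entryVal s (O.entry j k) - H j k‖ ≤ η)

/-- The registers of an entry query `|j, k, z⟩`. -/
abbrev EntryReg (n p : ℕ) : Type := Fin n ⊕ (Fin n ⊕ EntryBits p)

/-- The registers of a column query `|j, l⟩`. -/
abbrev ColReg (n : ℕ) : Type := Fin n ⊕ Fin n

/-- `(j, k, z) ↦ (j, k, z ⊕ H_jk)`. -/
def OracleData.entryStep {n p : ℕ} (O : OracleData n p) (y : EntryReg n p → Bool) :
    EntryReg n p → Bool :=
  let j : Fin n → Bool := fun i => y (Sum.inl i)
  let k : Fin n → Bool := fun i => y (Sum.inr (Sum.inl i))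
  let z : EntryBits p → Bool := fun i => y (Sum.inr (Sum.inr i))
  Sum.elim j (Sum.elim k (fun i => xor (z i) (O.entry j k i)))

/-- `(j, l) ↦ (j, f(j, l))`. -/
def OracleData.colStep {n p : ℕ} (O : OracleData n p) (y : ColReg n → Bool) : ColReg n → Bool :=
  let j : Fin n → Bool := fun i => y (Sum.inl i)
  let l : Fin n → Bool := fun i => y (Sum.inr i)
  Sum.elim j (O.col j l)

/-- The unitary `O_H`. -/
def OracleData.opH {n p : ℕ} (O : OracleData n p) :
    Matrix (EntryReg n p → Bool) (EntryReg n p → Bool) ℂ :=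
  Matrix.of fun x y => if x = O.entryStep y then 1 else 0

/-- The unitary `O_F`. -/
def OracleData.opF {n p : ℕ} (O : OracleData n p) :
    Matrix (ColReg n → Bool) (ColReg n → Bool) ℂ :=
  Matrix.of fun x y => if x = O.colStep y then 1 else 0

/-! ### Circuits -/

/-- The elementary operations on the qubits `Q`: an arbitrary unitary on two qubits, a query to
`O_H` (which is its own inverse), to `O_F` or to the inverse of `O_F`, each applied to chosen
distinct qubits. -/
inductive Gate (n p : ℕ) (Q : Type) : Type
  | two (r : Fin 2 ↪ Q) (u : Matrix.unitaryGroup (Fin 2 → Bool) ℂ)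
  | queryH (r : EntryReg n p ↪ Q)
  | queryF (r : ColReg n ↪ Q)
  | queryFInv (r : ColReg n ↪ Q)

/-- Whether the operation is a query (otherwise it is a 2-qubit gate). -/
def Gate.isQuery {n p : ℕ} {Q : Type} : Gate n p Q → Bool
  | .two _ _ => false
  | .queryH _ => true
  | .queryF _ => true
  | .queryFInv _ => true

/-- The unitary that an operation performs when the oracles hold the data `O`. -/
def Gate.op {n p : ℕ} {Q : Type} [Fintype Q] [DecidableEq Q] (O : OracleData n p) :
    Gate n p Q → Matrix (Q → Bool) (Q → Bool) ℂ
  | .two r u => onRegister r u.val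
  | .queryH r => onRegister r O.opH
  | .queryF r => onRegister r O.opF
  | .queryFInv r => onRegister r O.opFᴴ

/-- A circuit: a finite sequence of operations, the first one being performed first. It does not
depend on the oracle data. -/
abbrev Circuit (n p : ℕ) (Q : Type) : Type := List (Gate n p Q)

/-- The unitary that a circuit performs when the oracles hold the data `O`. -/
def Circuit.op {n p : ℕ} {Q : Type} [Fintype Q] [DecidableEq Q] (O : OracleData n p) :
    Circuit n p Q → Matrix (Q → Bool) (Q → Bool) ℂ
  | [] => 1
  | g :: c => Circuit.op O c * g.op O

/-- The number of queries. -/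
def Circuit.queryCount {n p : ℕ} {Q : Type} (c : Circuit n p Q) : ℕ :=
  c.countP (fun g => g.isQuery)

/-- The number of 2-qubit gates. -/
def Circuit.gateCount {n p : ℕ} {Q : Type} (c : Circuit n p Q) : ℕ :=
  c.countP (fun g => !g.isQuery)

end SparseSim

end

/-!
The simulation combines block encodings, truncated Taylor series and oblivious amplitude
amplification.

A *block encoding* of a matrix `A` on the qubits `S` is a circuit on `S` and ancillas whose unitary
has `A` as its corner with respect to the ancilla state `|0…0⟩`. Block encodings are closed under
products and convex combinations at additive cost (`Enc.mul`, `Enc.convex`), provided that their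
unitaries can be applied under the control of a qubit; this is why controlled implementability
(`CImpl`) is carried along throughout.

The Hamiltonian is encoded as follows. Two column queries prepare and unprepare, for every row, the
uniform superposition of the `2 ^ ⌈log₂ d⌉` first listed columns, an exchange of the row and column
registers transposes the position, and in between an entry query provides the bits of the matrix
entry (`listed_eq`). The diagonal matrix that multiplies by the entry is itself a convex
combination, along the binary expansion, of projections onto single qubits (`enc_entryVal`). The
entry bits are needed only from the leading bit of numbers of size `2 ‖H‖_max` downwards, to
relative accuracy `ε / τ`; hence a window of `O(log (τ / ε))` bits suffices, whatever the format of
the strings (`signedVal_window`, `exists_leading_bit`). The result is a block encoding of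
`H / (32 d ‖H‖_max)` with six queries and `O(n + log (τ / ε))` gates (`exists_enc_hamiltonian`).

The time is divided into `O(τ)` segments. In each of them the scaled Hamiltonian has norm at most
`1 / 2`, so that Horner's scheme for the Taylor polynomial `T` of degree `K` of the exponential is a
chain of convex combinations and products, which yields a block encoding of `T / 2`
(`enc_hornerExp`). As `T` is close to a unitary, a single round of oblivious amplitude amplification
removes the factor `1 / 2` (`amplify_eq`, `exists_amplified`). Errors in operator norm add up over
the segments (`norm_pow_mul_initMat_sub_le`), and the diamond distance is at most twice the operator
norm distance of the dilations (`diamondNorm_sub_le`), by the duality of the trace norm and the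
operator norm.

Finally, `(K + 1)!` exceeds any fixed power of `τ / ε` once `K` is a suitable multiple of
`log (τ / ε) / log log (τ / ε)` (`exp_mul_le_factorial`), which gives the bounds on the numbers of
queries and gates.
-/
open scoped Matrix ENNReal
noncomputable section
namespace SparseSim
set_option linter.unusedSectionVars false

/-! ### Operators on registers -/

/-- Operators on the qubits `Q`, as matrices in the computational basis. -/
abbrev Op (Q : Type) : Type := Matrix (Q → Bool) (Q → Bool) ℂ

section Registers

variable {Q R S : Type} [Fintype Q] [DecidableEq Q] [Fintype R] [DecidableEq R]
  [Fintype S] [DecidableEq S]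

theorem extend_comp_of_eq_off (r : R ↪ Q) (x y : Q → Bool)
    (h : ∀ q, (∀ i, r i ≠ q) → x q = y q) : Function.extend r (y ∘ r) x = y := by
  funext q
  by_cases hq : ∃ i, r i = q
  · obtain ⟨i, rfl⟩ := hq
    simp [r.injective.extend_apply]
  · rw [Function.extend_apply' _ _ _ hq]
    exact h q (by simpa using hq)

theorem extend_apply_off (r : R ↪ Q) (w : R → Bool) (x : Q → Bool) (q : Q)
    (h : ∀ i, r i ≠ q) : Function.extend r w x q = x q :=
  Function.extend_apply' _ _ _ (by simpa using h)

theorem onRegister_mul_apply {T : Type*} (r : R ↪ Q) (M : Op R)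
    (N : Matrix (Q → Bool) T ℂ) (x : Q → Bool) (y : T) :
    (onRegister r M * N) x y = ∑ w, M (x ∘ r) w * N (Function.extend r w x) y := by
  rw [Matrix.mul_apply]
  symm
  refine Fintype.sum_of_injective (fun w => Function.extend r w x) ?_ _ _ ?_ ?_
  · exact Function.extend_injective r.injective _
  · intro z hz
    rw [onRegister, Matrix.of_apply, if_neg, zero_mul]
    intro h
    exact hz ⟨z ∘ r, extend_comp_of_eq_off r x z h⟩
  · intro w
    rw [onRegister, Matrix.of_apply, if_pos, Function.extend_comp r.injective]
    intro q hq
    exact (extend_apply_off r w x q hq).symm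

theorem onRegister_mul (r : R ↪ Q) (M N : Op R) :
    onRegister r (M * N) = onRegister r M * onRegister r N := by
  ext x y
  rw [onRegister_mul_apply]
  simp only [onRegister, Matrix.of_apply, Matrix.mul_apply, Function.extend_comp r.injective]
  have key : ∀ w : R → Bool, (∀ q, (∀ i, r i ≠ q) → Function.extend r w x q = y q) ↔
      (∀ q, (∀ i, r i ≠ q) → x q = y q) := fun w =>
    forall_congr' fun q => forall_congr' fun hq => by rw [extend_apply_off r w x q hq]
  simp only [key]
  split_ifs <;> simp

theorem onRegister_trans (r : R ↪ S) (e : S ↪ Q) (M : Op R) :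
    onRegister e (onRegister r M) = onRegister (r.trans e) M := by
  ext x y
  simp only [onRegister, Matrix.of_apply, Function.comp_apply, Function.Embedding.trans_apply,
    ← ite_and]
  refine if_congr ⟨fun ⟨h1, h2⟩ q hq => ?_, fun h => ⟨fun q hq => ?_, fun s hs => ?_⟩⟩ rfl rfl
  · by_cases hs : ∃ s, e s = q
    · obtain ⟨s, rfl⟩ := hs
      exact h2 s fun i hi => hq i (by rw [hi])
    · exact h1 q (by simpa using hs)
  · exact h q fun i => hq _
  · exact h (e s) fun i hi => hs i (e.injective hi)

theorem onRegister_conjTranspose (r : R ↪ Q) (M : Op R) :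
    onRegister r Mᴴ = (onRegister r M)ᴴ := by
  ext x y
  simp only [onRegister, Matrix.of_apply, Matrix.conjTranspose_apply, eq_comm]
  split_ifs <;> simp

theorem onRegister_one (r : R ↪ Q) : onRegister r (1 : Op R) = 1 := by
  ext x y
  simp only [onRegister, Matrix.of_apply, Matrix.one_apply, ← ite_and]
  refine if_congr ⟨fun ⟨h1, h2⟩ => ?_, fun h => by simp [h]⟩ rfl rfl
  rw [← extend_comp_of_eq_off r x y h1, ← h2]
  symm
  exact extend_comp_of_eq_off r x x fun _ _ => rfl

theorem onRegister_equiv (e : R ≃ Q) (M : Op R) :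
    onRegister e.toEmbedding M = Matrix.of fun x y => M (x ∘ e) (y ∘ e) := by
  ext x y
  simp only [onRegister, Matrix.of_apply]
  rw [if_pos]
  · rfl
  · intro q hq
    exact absurd (e.apply_symm_apply q) (hq _)

theorem onRegister_smul (r : R ↪ Q) (a : ℂ) (M : Op R) :
    onRegister r (a • M) = a • onRegister r M := by
  ext x y
  simp only [onRegister, Matrix.of_apply, Matrix.smul_apply]
  split_ifs <;> simp

/-- The isometry that appends the qubits of `Q` outside the range of `e`, in the state `|0…0⟩`. -/
def initMat (e : S ↪ Q) : Matrix (Q → Bool) (S → Bool) ℂ :=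
  Matrix.of fun x y => if x = Function.extend e y (fun _ => false) then 1 else 0

theorem mul_initMat_apply {T : Type*} (e : S ↪ Q) (M : Matrix T (Q → Bool) ℂ) (x : T)
    (y : S → Bool) : (M * initMat e) x y = M x (Function.extend e y fun _ => false) := by
  simp [Matrix.mul_apply, initMat]

theorem initMat_conjTranspose_mul_apply {T : Type*} (e : S ↪ Q) (M : Matrix (Q → Bool) T ℂ)
    (y : S → Bool) (x : T) :
    ((initMat e)ᴴ * M) y x = M (Function.extend e y fun _ => false) x := by
  simp [Matrix.mul_apply, initMat, Matrix.conjTranspose_apply, apply_ite]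

theorem initMat_isometry (e : S ↪ Q) : (initMat e)ᴴ * initMat e = 1 := by
  ext x y
  rw [initMat_conjTranspose_mul_apply, initMat, Matrix.of_apply, Matrix.one_apply]
  simp [(Function.extend_injective e.injective (fun _ => false)).eq_iff]

theorem initMat_trans (f : R ↪ S) (e : S ↪ Q) : initMat e * initMat f = initMat (f.trans e) := by
  ext x y
  rw [mul_initMat_apply]
  simp only [initMat, Matrix.of_apply]
  congr 2
  funext q
  by_cases hs : ∃ s, e s = q
  · obtain ⟨s, rfl⟩ := hs
    rw [e.injective.extend_apply]
    by_cases hr : ∃ i, f i = s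
    · obtain ⟨i, rfl⟩ := hr
      rw [f.injective.extend_apply]
      exact ((f.trans e).injective.extend_apply y _ i).symm
    · rw [Function.extend_apply' _ _ _ hr, Function.extend_apply']
      rintro ⟨i, hi⟩
      exact hr ⟨i, e.injective hi⟩
  · rw [Function.extend_apply' _ _ _ hs, Function.extend_apply']
    rintro ⟨i, hi⟩
    exact hs ⟨f i, hi⟩

theorem initMat_mul_apply {T : Type*} (e : S ↪ Q) (M : Matrix (S → Bool) T ℂ) (x : Q → Bool)
    (y : T) : (initMat e * M) x y =
      if ∀ q, (∀ i, e i ≠ q) → x q = false then M (x ∘ e) y else 0 := by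
  simp only [Matrix.mul_apply, initMat, Matrix.of_apply, ite_mul, one_mul, zero_mul]
  split_ifs with h
  · have : x = Function.extend e (x ∘ e) fun _ => false :=
      (extend_comp_of_eq_off e _ x fun q hq => (h q hq).symm).symm
    rw [Finset.sum_eq_single (x ∘ e)]
    · rw [if_pos this]
    · intro w _ hw
      rw [if_neg]
      intro hx
      apply hw
      rw [hx, Function.extend_comp e.injective]
    · simp
  · refine Finset.sum_eq_zero fun w _ => if_neg ?_
    rintro rfl
    exact h fun q hq => by rw [extend_apply_off e _ _ q hq]

theorem onRegister_mul_initMat (e : S ↪ Q) (U : Op S) :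
    onRegister e U * initMat e = initMat e * U := by
  ext x y
  rw [mul_initMat_apply, initMat_mul_apply, onRegister, Matrix.of_apply,
    Function.extend_comp e.injective]
  refine if_congr (forall_congr' fun q => forall_congr' fun hq => ?_) rfl rfl
  rw [extend_apply_off e _ _ q hq]

theorem extend_inl (y : S → Bool) (z : Q → Bool) (w : S ⊕ Q → Bool)
    (hw : w ∘ Sum.inr = z) :
    Function.extend (Function.Embedding.inl : S ↪ S ⊕ Q) y w = Sum.elim y z := by
  funext q
  rcases q with q | q
  · exact Function.Embedding.inl.injective.extend_apply _ _ _
  · rw [extend_apply_off _ _ _ _ (by simp), Sum.elim_inr, ← hw]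
    rfl

/-- The block of `U` in which the qubits outside the range of `e` start and end in `|0…0⟩`. -/
def corner (e : S ↪ Q) (U : Op Q) : Op S := (initMat e)ᴴ * U * initMat e

theorem corner_apply (e : S ↪ Q) (U : Op Q) (x y : S → Bool) :
    corner e U x y =
      U (Function.extend e x fun _ => false) (Function.extend e y fun _ => false) := by
  rw [corner, mul_initMat_apply, initMat_conjTranspose_mul_apply]

end Registers

/-! ### Circuits: composition, inversion, relabelling -/

section Circuits

variable {n p : ℕ} {Q Q' : Type} [Fintype Q] [DecidableEq Q] [Fintype Q'] [DecidableEq Q']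

theorem isUnitary_iff {A : Type*} [Fintype A] [DecidableEq A] {U : Matrix A A ℂ} :
    U ∈ Matrix.unitaryGroup A ℂ ↔ Uᴴ * U = 1 := Matrix.mem_unitaryGroup_iff'

theorem unitary_mul_conjTranspose {A : Type*} [Fintype A] [DecidableEq A] {U : Matrix A A ℂ}
    (h : Uᴴ * U = 1) : U * Uᴴ = 1 := mul_eq_one_comm.mp h

theorem onRegister_unitary (r : Q ↪ Q') {U : Op Q} (h : Uᴴ * U = 1) :
    (onRegister r U)ᴴ * onRegister r U = 1 := by
  rw [← onRegister_conjTranspose, ← onRegister_mul, h, onRegister_one]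

theorem mul_unitary {A : Type*} [Fintype A] [DecidableEq A] {U V : Matrix A A ℂ}
    (hU : Uᴴ * U = 1) (hV : Vᴴ * V = 1) : (U * V)ᴴ * (U * V) = 1 := by
  rw [Matrix.conjTranspose_mul, Matrix.mul_assoc, ← Matrix.mul_assoc Uᴴ, hU, Matrix.one_mul, hV]

/-- The matrix of the map `σ` on basis states. -/
def mapMat {A : Type*} [DecidableEq A] (σ : A → A) : Matrix A A ℂ :=
  Matrix.of fun x y => if x = σ y then 1 else 0

theorem mapMat_unitary {A : Type*} [Fintype A] [DecidableEq A] {σ : A → A}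
    (h : Function.Injective σ) : (mapMat σ)ᴴ * mapMat σ = 1 := by
  ext x y
  simp [Matrix.mul_apply, mapMat, Matrix.conjTranspose_apply, apply_ite, Matrix.one_apply, h.eq_iff, eq_comm]

theorem entryStep_involutive (O : OracleData n p) : Function.Involutive O.entryStep := by
  intro y
  funext q
  rcases q with q | q | q <;> simp [OracleData.entryStep]

theorem colStep_injective (O : OracleData n p) : Function.Injective O.colStep := by
  intro y z h
  have h1 : ∀ i, y (Sum.inl i) = z (Sum.inl i) := fun i => congrFun h (Sum.inl i)
  have h2 : ∀ i, O.colStep y (Sum.inr i) = O.colStep z (Sum.inr i) := fun i =>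
    congrFun h (Sum.inr i)
  have h1' : (fun i => y (Sum.inl i)) = fun i => z (Sum.inl i) := funext h1
  have h2' : (fun i => y (Sum.inr i)) = fun i => z (Sum.inr i) := by
    apply (O.col fun i => y (Sum.inl i)).injective
    funext i
    have := h2 i
    simp only [OracleData.colStep, Sum.elim_inr] at this
    rw [this, h1']
  funext q
  rcases q with q | q
  · exact h1 q
  · exact congrFun h2' q

theorem Gate.op_unitary (O : OracleData n p) (g : Gate n p Q) : (g.op O)ᴴ * g.op O = 1 := by
  cases g with
  | two r u => exact onRegister_unitary r (isUnitary_iff.mp u.2)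
  | queryH r => exact onRegister_unitary r (mapMat_unitary (entryStep_involutive O).injective)
  | queryF r => exact onRegister_unitary r (mapMat_unitary (colStep_injective O))
  | queryFInv r =>
    refine onRegister_unitary r ?_
    rw [Matrix.conjTranspose_conjTranspose]
    exact unitary_mul_conjTranspose (mapMat_unitary (colStep_injective O))

theorem Circuit.op_unitary (O : OracleData n p) (c : Circuit n p Q) :
    (Circuit.op O c)ᴴ * Circuit.op O c = 1 := by
  induction c with
  | nil => simp [Circuit.op]
  | cons g c ih => exact mul_unitary ih (g.op_unitary O)

theorem Circuit.op_append (O : OracleData n p) (c c' : Circuit n p Q) :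
    Circuit.op O (c ++ c') = Circuit.op O c' * Circuit.op O c := by
  induction c with
  | nil => simp [Circuit.op]
  | cons g c ih =>
    rw [List.cons_append, Circuit.op, ih, Circuit.op, Matrix.mul_assoc]

/-- The same operation with the qubits relabelled by `e`. -/
def Gate.relabel (e : Q ↪ Q') : Gate n p Q → Gate n p Q'
  | .two r u => .two (r.trans e) u
  | .queryH r => .queryH (r.trans e)
  | .queryF r => .queryF (r.trans e)
  | .queryFInv r => .queryFInv (r.trans e)

theorem Gate.relabel_op (O : OracleData n p) (e : Q ↪ Q') (g : Gate n p Q) :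
    (g.relabel e).op O = onRegister e (g.op O) := by
  cases g <;> simp only [Gate.op, Gate.relabel, onRegister_trans]

theorem Gate.relabel_isQuery (e : Q ↪ Q') (g : Gate n p Q) :
    (g.relabel e).isQuery = g.isQuery := by cases g <;> rfl

/-- The same circuit with the qubits relabelled by `e`. -/
def Circuit.relabel (e : Q ↪ Q') (c : Circuit n p Q) : Circuit n p Q' :=
  List.map (Gate.relabel e) c

theorem Circuit.relabel_op (O : OracleData n p) (e : Q ↪ Q') (c : Circuit n p Q) :
    Circuit.op O (Circuit.relabel e c) = onRegister e (Circuit.op O c) := by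
  induction c with
  | nil => simp [Circuit.op, Circuit.relabel, onRegister_one]
  | cons g c ih =>
    simp only [Circuit.relabel, List.map_cons, Circuit.op] at ih ⊢
    rw [ih, Gate.relabel_op, ← onRegister_mul]

theorem Circuit.relabel_queryCount (e : Q ↪ Q') (c : Circuit n p Q) :
    Circuit.queryCount (Circuit.relabel e c) = Circuit.queryCount c := by
  simp [Circuit.queryCount, Circuit.relabel, List.countP_map, Function.comp_def,
    Gate.relabel_isQuery]

theorem Circuit.relabel_gateCount (e : Q ↪ Q') (c : Circuit n p Q) :
    Circuit.gateCount (Circuit.relabel e c) = Circuit.gateCount c := by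
  simp [Circuit.gateCount, Circuit.relabel, List.countP_map, Function.comp_def,
    Gate.relabel_isQuery]

/-- The inverse of an operation. -/
def Gate.inverse : Gate n p Q → Gate n p Q
  | .two r u => .two r (star u)
  | .queryH r => .queryH r
  | .queryF r => .queryFInv r
  | .queryFInv r => .queryF r

theorem opH_conjTranspose (O : OracleData n p) : O.opHᴴ = O.opH := by
  ext x y
  simp only [OracleData.opH, Matrix.conjTranspose_apply, Matrix.of_apply]
  have : y = O.entryStep x ↔ x = O.entryStep y :=
    ⟨fun h => by rw [h, entryStep_involutive O x], fun h => by rw [h, entryStep_involutive O y]⟩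
  simp [this, apply_ite]

theorem Gate.inverse_op (O : OracleData n p) (g : Gate n p Q) :
    g.inverse.op O = (g.op O)ᴴ := by
  cases g <;>
    simp [Gate.op, Gate.inverse, ← onRegister_conjTranspose, Matrix.star_eq_conjTranspose,
      opH_conjTranspose]

theorem Gate.inverse_isQuery (g : Gate n p Q) : g.inverse.isQuery = g.isQuery := by
  cases g <;> rfl

/-- The inverse circuit. -/
def Circuit.inverse (c : Circuit n p Q) : Circuit n p Q := (List.map Gate.inverse c).reverse

theorem Circuit.inverse_op (O : OracleData n p) (c : Circuit n p Q) :
    Circuit.op O (Circuit.inverse c) = (Circuit.op O c)ᴴ := by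
  induction c with
  | nil => simp [Circuit.op, Circuit.inverse]
  | cons g c ih =>
    simp only [Circuit.inverse, List.map_cons, List.reverse_cons, Circuit.op_append] at ih ⊢
    rw [ih]
    simp [Circuit.op, Gate.inverse_op]

theorem Circuit.inverse_queryCount (c : Circuit n p Q) :
    Circuit.queryCount (Circuit.inverse c) = Circuit.queryCount c := by
  simp [Circuit.queryCount, Circuit.inverse, List.countP_map, Function.comp_def,
    Gate.inverse_isQuery, List.countP_reverse]

theorem Circuit.inverse_gateCount (c : Circuit n p Q) :
    Circuit.gateCount (Circuit.inverse c) = Circuit.gateCount c := by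
  simp [Circuit.gateCount, Circuit.inverse, List.countP_map, Function.comp_def,
    Gate.inverse_isQuery, List.countP_reverse]

end Circuits

/-! ### Implementability by circuits with clean ancillas -/

section Impl

variable {n p : ℕ} {Q Q' : Type} [Fintype Q] [DecidableEq Q] [Fintype Q'] [DecidableEq Q']

/-- The operator `U O` on the qubits `Q`, which may depend on the oracle data `O`, is performed by
an oracle circuit with at most `q` queries and `g` gates. The circuit may use further qubits `Z`,
which start in `|0…0⟩` and are returned to `|0…0⟩` exactly; their number is not restricted. -/
def Impl (q g : ℕ) (U : OracleData n p → Op Q) : Prop :=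
  ∃ (Z : Type) (_ : Fintype Z) (_ : DecidableEq Z) (c : Circuit n p (Q ⊕ Z)),
    Circuit.queryCount c ≤ q ∧ Circuit.gateCount c ≤ g ∧
      ∀ O, Circuit.op O c * initMat (Function.Embedding.inl : Q ↪ Q ⊕ Z) =
        initMat (Function.Embedding.inl : Q ↪ Q ⊕ Z) * U O

theorem exists_equiv_sum (e : Q ↪ Q') : ∃ (Z : Type) (_ : Fintype Z) (_ : DecidableEq Z)
    (f : Q' ≃ Q ⊕ Z), e.trans f.toEmbedding = Function.Embedding.inl := by
  classical
  let f : Q' ≃ Q ⊕ {x : Q' // x ∉ Set.range e} :=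
    (Equiv.Set.sumCompl (Set.range e)).symm.trans
      (Equiv.sumCongr (Equiv.ofInjective e e.injective).symm (Equiv.refl _))
  refine ⟨{x : Q' // x ∉ Set.range e}, inferInstance, inferInstance, f, ?_⟩
  ext x
  simp only [Function.Embedding.trans_apply, Equiv.coe_toEmbedding, f, Equiv.trans_apply]
  rw [Equiv.Set.sumCompl_symm_apply_of_mem (Set.mem_range_self x)]
  simp only [Equiv.sumCongr_apply, Sum.map_inl]
  congr 1
  exact Equiv.ofInjective_symm_apply e.injective x

theorem Impl.of_embedding {q g : ℕ} {U : OracleData n p → Op Q} (e : Q ↪ Q')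
    (c : Circuit n p Q') (hq : Circuit.queryCount c ≤ q) (hg : Circuit.gateCount c ≤ g)
    (h : ∀ O, Circuit.op O c * initMat e = initMat e * U O) : Impl q g U := by
  obtain ⟨Z, i1, i2, f, hf⟩ := exists_equiv_sum e
  refine ⟨Z, i1, i2, Circuit.relabel f.toEmbedding c, ?_, ?_, fun O => ?_⟩
  · rwa [Circuit.relabel_queryCount]
  · rwa [Circuit.relabel_gateCount]
  · rw [Circuit.relabel_op, ← hf, ← initMat_trans, ← Matrix.mul_assoc, onRegister_mul_initMat,
      Matrix.mul_assoc, h, Matrix.mul_assoc]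

theorem Impl.mono {q g q' g' : ℕ} {U : OracleData n p → Op Q} (h : Impl q g U) (hq : q ≤ q')
    (hg : g ≤ g') : Impl q' g' U := by
  obtain ⟨Z, i1, i2, c, h1, h2, h3⟩ := h
  exact ⟨Z, i1, i2, c, h1.trans hq, h2.trans hg, h3⟩

theorem Impl.unitary {q g : ℕ} {U : OracleData n p → Op Q} (h : Impl q g U) (O : OracleData n p) :
    (U O)ᴴ * U O = 1 := by
  obtain ⟨Z, i1, i2, c, h1, h2, h3⟩ := h
  have := congrArg (fun M => Mᴴ * M) (h3 O)
  simp only [Matrix.conjTranspose_mul] at this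
  rw [Matrix.mul_assoc, ← Matrix.mul_assoc _ (Circuit.op O c), Circuit.op_unitary, Matrix.one_mul,
    initMat_isometry, Matrix.mul_assoc, ← Matrix.mul_assoc _ (initMat _), initMat_isometry,
    Matrix.one_mul] at this
  exact this.symm

/-- Further qubits that are returned to `|0…0⟩` can be counted among the clean ancillas. -/
theorem Impl.clean {q g : ℕ} {U : OracleData n p → Op Q} {V : OracleData n p → Op Q'}
    (e : Q ↪ Q') (hV : Impl q g V) (h : ∀ O, V O * initMat e = initMat e * U O) : Impl q g U := by
  obtain ⟨Z, i1, i2, c, h1, h2, h3⟩ := hV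
  refine Impl.of_embedding (e.trans Function.Embedding.inl) c h1 h2 fun O => ?_
  rw [← initMat_trans, ← Matrix.mul_assoc, h3, Matrix.mul_assoc, h, Matrix.mul_assoc]

theorem Impl.map {q g : ℕ} {U : OracleData n p → Op Q} (h : Impl q g U) (e : Q ↪ Q') :
    Impl q g fun O => onRegister e (U O) := by
  obtain ⟨Z, i1, i2, c, h1, h2, h3⟩ := h
  refine ⟨Z, i1, i2, Circuit.relabel (e.sumMap (Function.Embedding.refl Z)) c, ?_, ?_, fun O => ?_⟩
  · rwa [Circuit.relabel_queryCount]
  · rwa [Circuit.relabel_gateCount]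
  · rw [Circuit.relabel_op]
    ext x y
    rw [mul_initMat_apply, initMat_mul_apply]
    simp only [onRegister, Matrix.of_apply]
    have key := fun u v => congrFun (congrFun (h3 O) u) v
    simp only [mul_initMat_apply, initMat_mul_apply] at key
    have h5 : Function.extend (Function.Embedding.inl : Q' ↪ Q' ⊕ Z) y (fun _ => false) ∘
        (e.sumMap (Function.Embedding.refl Z)) =
        Function.extend (Function.Embedding.inl : Q ↪ Q ⊕ Z) (y ∘ e) fun _ => false := by
      rw [extend_inl _ (fun _ => false) _ rfl, extend_inl _ (fun _ => false) _ rfl]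
      funext q
      rcases q with q | q <;> simp
    rw [h5, key, ← ite_and, ← ite_and]
    refine if_congr ?_ rfl rfl
    rw [extend_inl _ (fun _ => false) _ rfl]
    simp only [Sum.forall, Function.Embedding.coe_sumMap]
    simp [Function.Embedding.inl]
    tauto

theorem Impl.mul {q g q' g' : ℕ} {U V : OracleData n p → Op Q} (hU : Impl q g U)
    (hV : Impl q' g' V) : Impl (q + q') (g + g') fun O => U O * V O := by
  obtain ⟨Z, i1, i2, c, h1, h2, h3⟩ := hU
  obtain ⟨Z', i1', i2', c', h1', h2', h3'⟩ := hV
  let e : Q ⊕ Z ↪ Q ⊕ (Z ⊕ Z') := (Function.Embedding.refl Q).sumMap Function.Embedding.inl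
  let e' : Q ⊕ Z' ↪ Q ⊕ (Z ⊕ Z') := (Function.Embedding.refl Q).sumMap Function.Embedding.inr
  have he : Function.Embedding.inl.trans e = Function.Embedding.inl := rfl
  have he' : Function.Embedding.inl.trans e' = Function.Embedding.inl := rfl
  refine ⟨Z ⊕ Z', inferInstance, inferInstance,
    Circuit.relabel e' c' ++ Circuit.relabel e c, ?_, ?_, fun O => ?_⟩
  · rw [Circuit.queryCount, List.countP_append, add_comm]
    exact Nat.add_le_add ((Circuit.relabel_queryCount e c).le.trans h1)
      ((Circuit.relabel_queryCount e' c').le.trans h1')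
  · rw [Circuit.gateCount, List.countP_append, add_comm]
    exact Nat.add_le_add ((Circuit.relabel_gateCount e c).le.trans h2)
      ((Circuit.relabel_gateCount e' c').le.trans h2')
  · rw [Circuit.op_append, Circuit.relabel_op, Circuit.relabel_op]
    conv_lhs => rw [← he', ← initMat_trans]
    rw [Matrix.mul_assoc, ← Matrix.mul_assoc _ (initMat e'), onRegister_mul_initMat,
      Matrix.mul_assoc, h3', ← Matrix.mul_assoc (initMat e'), initMat_trans, he', ← he,
      ← initMat_trans, ← Matrix.mul_assoc, ← Matrix.mul_assoc, onRegister_mul_initMat,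
      Matrix.mul_assoc (initMat e), h3, ← Matrix.mul_assoc, Matrix.mul_assoc]

theorem Impl.inv {q g : ℕ} {U : OracleData n p → Op Q} (h : Impl q g U) :
    Impl q g fun O => (U O)ᴴ := by
  have hu := h.unitary
  obtain ⟨Z, i1, i2, c, h1, h2, h3⟩ := h
  refine ⟨Z, i1, i2, Circuit.inverse c, ?_, ?_, fun O => ?_⟩
  · rwa [Circuit.inverse_queryCount]
  · rwa [Circuit.inverse_gateCount]
  · have h4 : initMat (Function.Embedding.inl : Q ↪ Q ⊕ Z) =
        Circuit.op O c * initMat (Function.Embedding.inl : Q ↪ Q ⊕ Z) * (U O)ᴴ := by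
      rw [h3, Matrix.mul_assoc, unitary_mul_conjTranspose (hu O), Matrix.mul_one]
    rw [Circuit.inverse_op]
    conv_lhs => rw [h4]
    rw [Matrix.mul_assoc, ← Matrix.mul_assoc, Circuit.op_unitary, Matrix.one_mul]

end Impl

/-! ### Elementary gates and controlled operators -/

section Ctrl

variable {n p : ℕ} {Q Q' R : Type} [Fintype Q] [DecidableEq Q] [Fintype Q'] [DecidableEq Q']
  [Fintype R] [DecidableEq R]

theorem initMat_refl : initMat (Function.Embedding.refl Q) = 1 := by
  ext x y
  rw [initMat, Matrix.of_apply, Matrix.one_apply]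
  congr 2
  funext q
  exact (Function.Embedding.refl Q).injective.extend_apply y _ q

theorem onRegister_refl (M : Op Q) : onRegister (Function.Embedding.refl Q) M = M := by
  rw [← Matrix.mul_one (onRegister _ M), ← initMat_refl, onRegister_mul_initMat, initMat_refl,
    Matrix.one_mul]

theorem Impl.of_circuit {q g : ℕ} {U : OracleData n p → Op Q} (c : Circuit n p Q)
    (hq : Circuit.queryCount c ≤ q) (hg : Circuit.gateCount c ≤ g)
    (h : ∀ O, Circuit.op O c = U O) : Impl q g U :=
  Impl.of_embedding (Function.Embedding.refl Q) c hq hg fun O => by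
    rw [initMat_refl, h, Matrix.mul_one, Matrix.one_mul]

theorem Impl.one : Impl (n := n) (p := p) 0 0 fun _ => (1 : Op Q) :=
  Impl.of_circuit [] le_rfl le_rfl fun _ => rfl

theorem Impl.two_qubit (h : Fintype.card R = 2) {M : Op R} (hM : Mᴴ * M = 1) :
    Impl (n := n) (p := p) 0 1 fun _ => M := by
  let ε : Fin 2 ≃ R := (Fintype.equivFinOfCardEq h).symm
  refine Impl.of_circuit [.two ε.toEmbedding
    ⟨onRegister ε.symm.toEmbedding M, isUnitary_iff.mpr (onRegister_unitary _ hM)⟩]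
    (by simp [Circuit.queryCount, Gate.isQuery]) (by simp [Circuit.gateCount, Gate.isQuery])
    fun O => ?_
  simp only [Circuit.op, Gate.op, Matrix.one_mul]
  have h2 : ε.symm.toEmbedding.trans ε.toEmbedding = Function.Embedding.refl R := by
    ext x
    simp
  rw [onRegister_trans, h2, onRegister_refl]

theorem Impl.one_qubit (h : Fintype.card R = 1) {M : Op R} (hM : Mᴴ * M = 1) :
    Impl (n := n) (p := p) 0 1 fun _ => M :=
  (Impl.two_qubit (R := R ⊕ Unit) (by simp [h])
    (onRegister_unitary Function.Embedding.inl hM)).clean Function.Embedding.inl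
    fun _ => onRegister_mul_initMat _ _

/-- Splitting off the qubit `none`. -/
def optionEquiv (Q : Type) : (Option Q → Bool) ≃ (Q → Bool) × Bool where
  toFun x := (x ∘ some, x none)
  invFun z o := o.elim z.2 z.1
  left_inv x := by funext o; cases o <;> rfl
  right_inv z := rfl

/-- The operator `U` on the qubits `Q`, controlled by the additional qubit `none`. -/
def ctrl (U : Op Q) : Op (Option Q) :=
  (Matrix.blockDiagonal fun b : Bool => if b then U else 1).submatrix (optionEquiv Q)
    (optionEquiv Q)

theorem ctrl_apply (U : Op Q) (x y : Option Q → Bool) : ctrl U x y =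
    if x none = y none then if y none then U (x ∘ some) (y ∘ some)
      else if x ∘ some = y ∘ some then 1 else 0 else 0 := by
  rw [ctrl, Matrix.submatrix_apply, Matrix.blockDiagonal_apply]
  change (if x none = y none then (if x none = true then U else 1) (x ∘ some) (y ∘ some) else 0) = _
  by_cases h1 : x none = y none
  · rw [if_pos h1, if_pos h1, h1]
    split_ifs with h2 <;> simp_all [Matrix.one_apply]
  · rw [if_neg h1, if_neg h1]

theorem ctrl_mul (U V : Op Q) : ctrl (U * V) = ctrl U * ctrl V := by
  rw [ctrl, ctrl, ctrl, Matrix.submatrix_mul_equiv, ← Matrix.blockDiagonal_mul]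
  congr 2
  funext b
  cases b <;> simp

theorem ctrl_one : ctrl (1 : Op Q) = 1 := by
  rw [ctrl, ← Matrix.submatrix_one_equiv (optionEquiv Q), ← Matrix.blockDiagonal_one]
  congr 2
  funext b
  cases b <;> rfl

theorem ctrl_conjTranspose (U : Op Q) : ctrl Uᴴ = (ctrl U)ᴴ := by
  rw [ctrl, ctrl, Matrix.conjTranspose_submatrix, Matrix.blockDiagonal_conjTranspose]
  congr 2
  funext b
  cases b <;> simp

theorem onRegister_some (V : Op Q) : onRegister Function.Embedding.some V =
    (Matrix.blockDiagonal fun _ : Bool => V).submatrix (optionEquiv Q) (optionEquiv Q) := by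
  ext x y
  rw [Matrix.submatrix_apply, Matrix.blockDiagonal_apply, onRegister, Matrix.of_apply]
  refine if_congr ⟨fun h => h none (by simp), fun h q hq => ?_⟩ rfl rfl
  cases q with
  | none => exact h
  | some q => exact absurd rfl (hq q)

theorem ctrl_conj (U V : Op Q) (hV : Vᴴ * V = 1) : ctrl (Vᴴ * U * V) =
    (onRegister Function.Embedding.some V)ᴴ * ctrl U * onRegister Function.Embedding.some V := by
  rw [← onRegister_conjTranspose, onRegister_some, onRegister_some, ctrl, ctrl,
    Matrix.submatrix_mul_equiv, Matrix.submatrix_mul_equiv, ← Matrix.blockDiagonal_mul,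
    ← Matrix.blockDiagonal_mul]
  congr 2
  funext b
  cases b <;> simp [hV]

theorem ctrl_unitary {U : Op Q} (hU : Uᴴ * U = 1) : (ctrl U)ᴴ * ctrl U = 1 := by
  rw [← ctrl_conjTranspose, ← ctrl_mul, hU, ctrl_one]

theorem unitary_of_ctrl {U : Op Q} (hU : (ctrl U)ᴴ * ctrl U = 1) : Uᴴ * U = 1 := by
  rw [← ctrl_conjTranspose, ← ctrl_mul] at hU
  ext x y
  have := congrFun (congrFun hU ((optionEquiv Q).symm (x, true))) ((optionEquiv Q).symm (y, true))
  simp only [ctrl_apply, Matrix.one_apply, (optionEquiv Q).symm.injective.eq_iff] at this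
  rw [Matrix.one_apply]
  simpa [optionEquiv, Function.comp_def] using this

theorem ctrl_onRegister (e : Q ↪ Q') (U : Op Q) :
    ctrl (onRegister e U) = onRegister e.optionMap (ctrl U) := by
  ext x y
  have h1 : (∀ q, (∀ i, e.optionMap i ≠ q) → x q = y q) ↔
      ∀ q, (∀ i, e i ≠ q) → x (some q) = y (some q) := by
    refine ⟨fun h q hq => h (some q) fun i hi => ?_, fun h q hq => ?_⟩
    · cases i with
      | none => exact Option.some_ne_none q hi.symm
      | some i => exact hq i (Option.some_injective _ hi)
    · cases q with
      | none => exact absurd rfl (hq none)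
      | some q => exact h q fun i hi => hq (some i) (congrArg some hi)
  have h2 : x ∘ some = y ∘ some ↔ (∀ q, (∀ i, e i ≠ q) → x (some q) = y (some q)) ∧
      (x ∘ e.optionMap) ∘ some = (y ∘ e.optionMap) ∘ some := by
    refine ⟨fun h => ⟨fun q _ => congrFun h q, ?_⟩, fun ⟨h, h'⟩ => ?_⟩
    · funext q
      exact congrFun h (e q)
    · rw [← extend_comp_of_eq_off e (x ∘ some) (y ∘ some) h]
      exact (extend_comp_of_eq_off e (x ∘ some) (x ∘ some) fun _ _ => rfl).symm.trans
        (congrArg (fun w => Function.extend e w (x ∘ some)) h')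
  have h3 : ∀ w : Option Q' → Bool, (w ∘ e.optionMap) none = w none := fun _ => rfl
  simp only [ctrl_apply, onRegister, Matrix.of_apply, h1, h2, h3, Function.comp_apply]
  by_cases h4 : ∀ q, (∀ i, e i ≠ q) → x (some q) = y (some q)
  · simp only [eq_true h4, if_true, true_and]
    rfl
  · simp only [eq_false h4, if_false, false_and, ite_self]

/-- The controlled version of `U O` is performed by an oracle circuit with at most `q` queries and
`g` gates. -/
def CImpl (q g : ℕ) (U : OracleData n p → Op Q) : Prop := Impl q g fun O => ctrl (U O)

theorem CImpl.mono {q g q' g' : ℕ} {U : OracleData n p → Op Q} (h : CImpl q g U) (hq : q ≤ q')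
    (hg : g ≤ g') : CImpl q' g' U := Impl.mono h hq hg

theorem CImpl.unitary {q g : ℕ} {U : OracleData n p → Op Q} (h : CImpl q g U)
    (O : OracleData n p) : (U O)ᴴ * U O = 1 := unitary_of_ctrl (Impl.unitary h O)

theorem CImpl.one : CImpl (n := n) (p := p) 0 0 fun _ => (1 : Op Q) := by
  simpa only [CImpl, ctrl_one] using Impl.one

theorem CImpl.mul {q g q' g' : ℕ} {U V : OracleData n p → Op Q} (hU : CImpl q g U)
    (hV : CImpl q' g' V) : CImpl (q + q') (g + g') fun O => U O * V O := by
  simpa only [CImpl, ctrl_mul] using Impl.mul hU hV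

theorem CImpl.map {q g : ℕ} {U : OracleData n p → Op Q} (h : CImpl q g U) (e : Q ↪ Q') :
    CImpl q g fun O => onRegister e (U O) := by
  simpa only [CImpl, ctrl_onRegister] using Impl.map h e.optionMap

/-- A basis change around a controlled operator need not be controlled itself. -/
theorem CImpl.conj {q g q' g' : ℕ} {U V : OracleData n p → Op Q} (hU : CImpl q g U)
    (hV : Impl q' g' V) : CImpl (q + 2 * q') (g + 2 * g') fun O => (V O)ᴴ * U O * V O := by
  have h := ((hV.inv.map Function.Embedding.some).mul hU).mul (hV.map Function.Embedding.some)
  rw [CImpl, funext fun O => ctrl_conj (U O) (V O) (hV.unitary O)]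
  simp only [onRegister_conjTranspose] at h
  exact h.mono (by omega) (by omega)

/-- The operator on one qubit with matrix `u`. -/
def qubitOp (u : Matrix Bool Bool ℂ) : Op Unit :=
  u.submatrix (Equiv.funUnique Unit Bool) (Equiv.funUnique Unit Bool)

theorem qubitOp_mul (u v : Matrix Bool Bool ℂ) : qubitOp (u * v) = qubitOp u * qubitOp v := by
  rw [qubitOp, qubitOp, qubitOp, Matrix.submatrix_mul_equiv]

theorem qubitOp_conjTranspose (u : Matrix Bool Bool ℂ) : qubitOp uᴴ = (qubitOp u)ᴴ := by
  rw [qubitOp, qubitOp, Matrix.conjTranspose_submatrix]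

theorem qubitOp_unitary {u : Matrix Bool Bool ℂ} (h : uᴴ * u = 1) :
    (qubitOp u)ᴴ * qubitOp u = 1 := by
  rw [← qubitOp_conjTranspose, ← qubitOp_mul, h, qubitOp, Matrix.submatrix_one_equiv]

/-- The embedding that selects a single qubit. -/
def point (q : Q) : Unit ↪ Q := ⟨fun _ => q, fun _ _ _ => rfl⟩

/-- The operator with matrix `u` on the qubit `q`. -/
def onQubit (q : Q) (u : Matrix Bool Bool ℂ) : Op Q := onRegister (point q) (qubitOp u)

theorem onQubit_mul_apply {T : Type*} (q : Q) (u : Matrix Bool Bool ℂ)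
    (N : Matrix (Q → Bool) T ℂ) (x : Q → Bool) (y : T) :
    (onQubit q u * N) x y = ∑ b, u (x q) b * N (Function.update x q b) y := by
  rw [onQubit, onRegister_mul_apply]
  refine Fintype.sum_equiv (Equiv.funUnique Unit Bool) _ _ fun w => ?_
  have : Function.extend (point q) w x = Function.update x q (w ()) := by
    funext i
    by_cases hi : i = q
    · subst hi
      rw [Function.update_self]
      exact (point i).injective.extend_apply w x ()
    · rw [Function.update_of_ne hi]
      exact extend_apply_off _ _ _ _ fun _ h => hi h.symm
  rw [this]
  rfl

theorem onQubit_diagonal (q : Q) (f : Bool → ℂ) :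
    onQubit q (Matrix.diagonal f) = Matrix.diagonal fun x => f (x q) := by
  ext x y
  rw [← Matrix.mul_one (onQubit _ _), onQubit_mul_apply, Finset.sum_eq_single (x q)]
  · rw [Function.update_eq_self, Matrix.diagonal_apply_eq, Matrix.one_apply, Matrix.diagonal_apply]
    split_ifs <;> simp
  · intro b _ hb
    rw [Matrix.diagonal_apply_ne _ hb.symm, zero_mul]
  · simp

theorem cimpl_onQubit (q : Q) {u : Matrix Bool Bool ℂ} (h : uᴴ * u = 1) :
    CImpl (n := n) (p := p) 0 1 fun _ => onQubit q u := by
  refine CImpl.map (U := fun _ => qubitOp u) ?_ (point q)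
  exact Impl.two_qubit (by simp) (ctrl_unitary (qubitOp_unitary h))

theorem diagonal_unitary {A : Type*} [Fintype A] [DecidableEq A] {f : A → ℂ}
    (h : ∀ a, star (f a) * f a = 1) : (Matrix.diagonal f)ᴴ * Matrix.diagonal f = 1 := by
  rw [Matrix.diagonal_conjTranspose, Matrix.diagonal_mul_diagonal, ← Matrix.diagonal_one]
  congr 1
  funext a
  exact h a

/-- The NOT gate. -/
def notGate : Matrix Bool Bool ℂ := mapMat not

/-- The Hadamard gate. -/
def hadamard : Matrix Bool Bool ℂ :=
  Matrix.of fun a b => ((√2 : ℝ) : ℂ)⁻¹ * if a && b then -1 else 1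

theorem notGate_unitary : notGateᴴ * notGate = 1 := mapMat_unitary Bool.not_injective

theorem sqrt_two_inv_sq : ((√2 : ℝ) : ℂ)⁻¹ * ((√2 : ℝ) : ℂ)⁻¹ = 1 / 2 := by
  rw [← mul_inv, ← Complex.ofReal_mul, Real.mul_self_sqrt (by norm_num)]
  norm_num

theorem hadamard_unitary : hadamardᴴ * hadamard = 1 := by
  ext a b
  have := sqrt_two_inv_sq
  cases a <;> cases b <;>
    simp [Matrix.mul_apply, hadamard, this, Complex.conj_ofReal]
  all_goals norm_num

theorem hadamard_conj : hadamardᴴ * (Matrix.diagonal fun b => if b then -1 else 1) * hadamard =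
    notGate := by
  ext a b
  have := sqrt_two_inv_sq
  cases a <;> cases b <;>
    simp [Matrix.mul_apply, hadamard, notGate, mapMat, this, Complex.conj_ofReal] <;> norm_num

theorem mapMat_mul_apply {A T : Type*} [Fintype A] [DecidableEq A] {σ : A → A}
    (h : Function.Involutive σ) (N : Matrix A T ℂ) (x : A) (y : T) :
    (mapMat σ * N) x y = N (σ x) y := by
  have : ∀ z, x = σ z ↔ z = σ x := fun z => ⟨fun hx => by rw [hx, h], fun hz => by rw [hz, h]⟩
  simp [Matrix.mul_apply, mapMat, this]

theorem mul_mapMat_apply {A T : Type*} [Fintype A] [DecidableEq A] (σ : A → A)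
    (N : Matrix T A ℂ) (x : T) (y : A) : (N * mapMat σ) x y = N x (σ y) := by
  simp [Matrix.mul_apply, mapMat]

theorem mapMat_conj_apply {A : Type*} [Fintype A] [DecidableEq A] (σ : A → A)
    (N : Matrix A A ℂ) (x y : A) : ((mapMat σ)ᴴ * N * mapMat σ) x y = N (σ x) (σ y) := by
  rw [mul_mapMat_apply]
  simp [Matrix.mul_apply, mapMat, apply_ite, Matrix.conjTranspose_apply]

theorem mapMat_conj_diagonal {A : Type*} [Fintype A] [DecidableEq A] {σ : A → A}
    (h : Function.Injective σ) (f : A → ℂ) :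
    (mapMat σ)ᴴ * Matrix.diagonal f * mapMat σ = Matrix.diagonal fun x => f (σ x) := by
  ext x y
  rw [mapMat_conj_apply, Matrix.diagonal_apply, Matrix.diagonal_apply]
  simp only [h.eq_iff]

end Ctrl

/-! ### Doubly controlled operators -/

section Toffoli

variable {n p : ℕ} {Q R : Type} [Fintype Q] [DecidableEq Q] [Fintype R] [DecidableEq R]

theorem onRegister_mapMat (r : R ↪ Q) (σ : (R → Bool) → (R → Bool)) :
    onRegister r (mapMat σ) = mapMat fun y => Function.extend r (σ (y ∘ r)) y := by
  ext x y
  simp only [onRegister, mapMat, Matrix.of_apply, ← ite_and]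
  refine if_congr ⟨fun ⟨h1, h2⟩ => ?_, fun h => ?_⟩ rfl rfl
  · rw [← h2]
    exact (extend_comp_of_eq_off r y x fun q hq => (h1 q hq).symm).symm
  · subst h
    exact ⟨fun q hq => extend_apply_off r _ _ q hq, Function.extend_comp r.injective _ _⟩

theorem ctrl_mapMat (σ : (Q → Bool) → (Q → Bool)) :
    ctrl (mapMat σ) = mapMat fun y o => if y none then o.elim true (σ (y ∘ some)) else y o := by
  ext x y
  rw [ctrl_apply]
  simp only [mapMat, Matrix.of_apply]
  by_cases h : y none = true
  · simp only [h, if_true, ← ite_and]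
    refine if_congr ⟨fun ⟨h1, h2⟩ => ?_, fun h => ?_⟩ rfl rfl
    · funext o
      cases o with
      | none => exact h1
      | some q => exact congrFun h2 q
    · subst h
      exact ⟨rfl, rfl⟩
  · simp only [h, ← ite_and, Bool.false_eq_true, if_false]
    refine if_congr ⟨fun ⟨h1, h2⟩ => ?_, fun h => ?_⟩ rfl rfl
    · funext o
      cases o with
      | none => exact h1.trans (by simpa using h)
      | some q => exact congrFun h2 q
    · subst h
      exact ⟨by simpa using h, rfl⟩

theorem ctrl_diagonal (f : (Q → Bool) → ℂ) : ctrl (Matrix.diagonal f) =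
    Matrix.diagonal fun y => if y none then f (y ∘ some) else 1 := by
  ext x y
  rw [ctrl_apply, Matrix.diagonal_apply, Matrix.diagonal_apply]
  by_cases h : x = y
  · subst h
    simp
  · have h' : x none = y none → ¬ x ∘ some = y ∘ some := fun h1 h2 => h <| by
      funext o
      cases o with
      | none => exact h1
      | some q => exact congrFun h2 q
    rw [if_neg h]
    split_ifs with h1 h2 h3 h3
    · exact absurd h3 (h' h1)
    · rfl
    · exact absurd h3 (h' h1)
    · rfl
    · rfl

theorem qubitOp_diagonal (f : Bool → ℂ) :
    qubitOp (Matrix.diagonal f) = Matrix.diagonal fun x => f (x ()) := by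
  rw [qubitOp, Matrix.submatrix_diagonal_equiv]
  rfl

theorem qubitOp_notGate : qubitOp notGate = mapMat fun x i => !x i := by
  ext x y
  simp only [qubitOp, notGate, mapMat, Matrix.submatrix_apply, Matrix.of_apply,
    Equiv.funUnique_apply]
  refine if_congr ⟨fun h => funext fun _ => h, fun h => congrFun h _⟩ rfl rfl

theorem onQubit_notGate (q : Q) :
    onQubit q notGate = mapMat fun y => Function.update y q (!y q) := by
  rw [onQubit, qubitOp_notGate, onRegister_mapMat]
  congr 1
  funext y i
  by_cases hi : i = q
  · subst hi
    rw [Function.update_self]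
    exact (point i).injective.extend_apply _ _ ()
  · rw [Function.update_of_ne hi]
    exact extend_apply_off _ _ _ _ fun _ h => hi h.symm

/-- The controlled NOT gate, with control `none`. -/
def cnot : Op (Option Unit) := ctrl (qubitOp notGate)

theorem cnot_eq : cnot = mapMat fun y o => o.elim (y none) fun _ => xor (y none) (y (some ())) := by
  rw [cnot, qubitOp_notGate, ctrl_mapMat]
  congr 1
  funext y o
  cases h : y none <;> rcases o with _ | _ <;> simp [h]

theorem cnot_unitary : cnotᴴ * cnot = 1 := ctrl_unitary (qubitOp_unitary notGate_unitary)

theorem impl_cnot : Impl (n := n) (p := p) 0 1 fun _ => cnot :=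
  Impl.two_qubit (by simp) cnot_unitary

/-- The Toffoli gate from seven 2-qubit gates. Up to Hadamard gates on the target it is the
doubly controlled sign, and `(-1) ^ (abc) = (i ^ a * i ^ b * (-i) ^ (a ⊕ b)) ^ c`. -/
theorem cimpl_cnot : CImpl (n := n) (p := p) 0 7 fun _ => cnot := by
  have hI : ∀ b : Bool, star (if b then Complex.I else 1) * (if b then Complex.I else 1) = 1 := by
    intro b
    cases b <;> simp
  have hI' : ∀ b : Bool, star (if b then -Complex.I else 1) * (if b then -Complex.I else 1) = 1 := by
    intro b
    cases b <;> simp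
  have hcz := ((cimpl_onQubit (n := n) (p := p) (none : Option Unit)
    (diagonal_unitary hI)).mul (cimpl_onQubit (some ()) (diagonal_unitary hI))).mul
    ((cimpl_onQubit (some ()) (diagonal_unitary hI')).conj impl_cnot)
  have h1 : onQubit (none : Option Unit) (Matrix.diagonal fun b => if b then Complex.I else 1) *
      onQubit (some ()) (Matrix.diagonal fun b => if b then Complex.I else 1) *
      (cnotᴴ * onQubit (some ()) (Matrix.diagonal fun b => if b then -Complex.I else 1) *
        cnot) = ctrl (qubitOp (Matrix.diagonal fun b => if b then -1 else 1)) := by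
    have hinj : Function.Injective fun (y : Option Unit → Bool) (o : Option Unit) =>
        o.elim (y none) fun _ => xor (y none) (y (some ())) := by
      intro y z h
      have h1 : y none = z none := congrFun h none
      have h2 : xor (y none) (y (some ())) = xor (z none) (z (some ())) := congrFun h (some ())
      funext o
      rcases o with _ | _
      · exact h1
      · rw [h1] at h2
        simpa using h2
    rw [onQubit_diagonal, onQubit_diagonal, onQubit_diagonal, cnot_eq, mapMat_conj_diagonal hinj,
      qubitOp_diagonal, ctrl_diagonal, Matrix.diagonal_mul_diagonal, Matrix.diagonal_mul_diagonal]
    congr 1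
    funext y
    cases ha : y none <;> cases hb : y (some ()) <;> simp [hb]
  have h := hcz.conj ((Impl.one_qubit (n := n) (p := p) (R := Unit) (by simp)
    (qubitOp_unitary hadamard_unitary)).map Function.Embedding.some)
  simp only [h1, ← ctrl_conj _ _ (qubitOp_unitary hadamard_unitary), ← qubitOp_conjTranspose,
    ← qubitOp_mul, hadamard_conj] at h
  exact h

/-- A second control qubit: the conjunction of the two control qubits is computed into a clean
ancilla, which then controls the operator. -/
theorem cimpl_ctrl {q g : ℕ} {U : OracleData n p → Op Q} (h : CImpl q g U) :
    CImpl q (g + 14) fun O => ctrl (U O) := by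
  obtain ⟨rT, hT0, hT1, hT2⟩ : ∃ r : Option (Option Unit) ↪ Option (Option Q) ⊕ Unit,
      r none = Sum.inl none ∧ r (some none) = Sum.inl (some none) ∧
        r (some (some ())) = Sum.inr () :=
    ⟨⟨fun o => o.elim (Sum.inl none) fun o => o.elim (Sum.inl (some none)) fun _ => Sum.inr (), by
      intro a b
      rcases a with _ | _ | _ <;> rcases b with _ | _ | _ <;> simp⟩, rfl, rfl, rfl⟩
  obtain ⟨rM, hM0, hM1⟩ : ∃ r : Option Q ↪ Option (Option Q) ⊕ Unit,
      r none = Sum.inr () ∧ ∀ q, r (some q) = Sum.inl (some (some q)) :=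
    ⟨⟨fun o => o.elim (Sum.inr ()) fun q => Sum.inl (some (some q)), by
      intro a b
      rcases a with _ | _ <;> rcases b with _ | _ <;> simp⟩, rfl, fun _ => rfl⟩
  let τ : (Option (Option Q) ⊕ Unit → Bool) → (Option (Option Q) ⊕ Unit → Bool) := fun y =>
    Sum.elim (y ∘ Sum.inl) fun _ => xor (y (Sum.inl none) && y (Sum.inl (some none))) (y (Sum.inr ()))
  have hT : onRegister rT (ctrl cnot) = mapMat τ := by
    rw [cnot_eq, ctrl_mapMat, onRegister_mapMat]
    congr 1
    funext y i
    have e0 := rT.injective.extend_apply (e' := y)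
    rcases i with (_ | _ | i) | i
    · refine (congrArg _ hT0.symm).trans ((e0 _ none).trans ?_)
      cases ha : y (Sum.inl none) <;> simp [τ, hT0, hT1, hT2, ha]
    · refine (congrArg _ hT1.symm).trans ((e0 _ (some none)).trans ?_)
      cases ha : y (Sum.inl none) <;> simp [τ, hT0, hT1, hT2, ha]
    · refine extend_apply_off rT _ _ _ ?_
      intro j
      rcases j with _ | _ | _ <;> simp [hT0, hT1, hT2]
    · refine (congrArg _ hT2.symm).trans ((e0 _ (some (some ()))).trans ?_)
      cases ha : y (Sum.inl none) <;> simp [τ, hT0, hT1, hT2, ha]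
  have hτ : Function.Involutive τ := by
    intro y
    funext i
    rcases i with i | i <;> simp [τ]
  have h2 := ((Impl.map (cimpl_cnot (n := n) (p := p)) rT).mul
    (Impl.map h rM)).mul (Impl.map (cimpl_cnot (n := n) (p := p)) rT)
  refine (h2.clean (U := fun O => ctrl (ctrl (U O))) Function.Embedding.inl fun O => ?_).mono
    (by omega) (by omega)
  simp only [hT]
  ext x y
  rw [initMat_mul_apply, mul_initMat_apply, mul_mapMat_apply, mapMat_mul_apply hτ,
    extend_inl _ (fun _ => false) _ rfl]
  simp only [onRegister, Matrix.of_apply]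
  have hoff : (∀ q, (∀ i, rM i ≠ q) → τ x q = τ (Sum.elim y fun _ => false) q) ↔
      x (Sum.inl none) = y none ∧ x (Sum.inl (some none)) = y (some none) := by
    refine ⟨fun h => ⟨h (Sum.inl none) ?_, h (Sum.inl (some none)) ?_⟩, fun ⟨ha, hb⟩ q hq => ?_⟩
    · intro j
      rcases j with _ | _ <;> simp [hM0, hM1]
    · intro j
      rcases j with _ | _ <;> simp [hM0, hM1]
    · rcases q with (_ | _ | i) | i
      · exact ha
      · exact hb
      · exact absurd (hM1 i) (hq (some i))
      · exact absurd hM0 (hq none)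
  have hin : (∀ q, (∀ i, (Function.Embedding.inl : _ ↪ Option (Option Q) ⊕ Unit) i ≠ q) →
      x q = false) ↔ x (Sum.inr ()) = false := by
    refine ⟨fun h => h _ fun i => by simp, fun h q hq => ?_⟩
    rcases q with q | q
    · exact absurd rfl (hq q)
    · exact h
  have h3 : (τ x ∘ rM) none =
      xor (x (Sum.inl none) && x (Sum.inl (some none))) (x (Sum.inr ())) := by
    simp [τ, hM0]
  have h4 : (τ (Sum.elim y fun _ => false) ∘ rM) none = (y none && y (some none)) := by
    simp [τ, hM0]
  have h5 : (τ x ∘ rM) ∘ some = (x ∘ Sum.inl) ∘ some ∘ some := by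
    funext i
    simp [τ, hM1]
  have h6 : (τ (Sum.elim y fun _ => false) ∘ rM) ∘ some = y ∘ some ∘ some := by
    funext i
    simp [τ, hM1]
  simp only [hoff, hin, ctrl_apply, h3, h4, h5, h6]
  have h7 : x ∘ (Function.Embedding.inl : _ ↪ Option (Option Q) ⊕ Unit) = x ∘ Sum.inl := rfl
  have h8 : (x ∘ Sum.inl) ∘ some = y ∘ some ↔ x (Sum.inl (some none)) = y (some none) ∧
      (x ∘ Sum.inl) ∘ some ∘ some = y ∘ some ∘ some := by
    refine ⟨fun h => ⟨congrFun h none, funext fun i => congrFun h (some i)⟩, fun ⟨ha, hb⟩ => ?_⟩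
    funext o
    rcases o with _ | o
    · exact ha
    · exact congrFun hb o
  have h9 : (x ∘ Sum.inl) none = x (Sum.inl none) := rfl
  have h10 : ((x ∘ Sum.inl) ∘ some) none = x (Sum.inl (some none)) := rfl
  have h11 : (y ∘ some) none = y (some none) := rfl
  have h12 : ((x ∘ Sum.inl) ∘ some) ∘ some = (x ∘ Sum.inl) ∘ some ∘ some := rfl
  have h13 : (y ∘ some) ∘ some = y ∘ some ∘ some := rfl
  simp only [h7, h9, h10, h11, h12, h13, h8]
  cases ha : x (Sum.inl none) <;> cases hb : y none <;>
    cases hc : x (Sum.inl (some none)) <;> cases hd : y (some none) <;>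
    cases he : x (Sum.inr ()) <;> simp

end Toffoli

/-! ### Block encodings -/

section Enc

variable {n p : ℕ} {Q Q' S B B' : Type} [Fintype Q] [DecidableEq Q] [Fintype Q'] [DecidableEq Q']
  [Fintype S] [DecidableEq S] [Fintype B] [DecidableEq B] [Fintype B'] [DecidableEq B']

/-- `A O` is the block, with the qubits `B` starting and ending in `|0…0⟩`, of a unitary whose
controlled version is performed by an oracle circuit with at most `q` queries and `g` gates.
The bound `g` also applies to the number of the qubits `B`, which determines the cost of a
reflection about their state `|0…0⟩`. -/
def Enc (q g : ℕ) (A : OracleData n p → Op S) : Prop :=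
  ∃ (B : Type) (_ : Fintype B) (_ : DecidableEq B) (U : OracleData n p → Op (S ⊕ B)),
    Fintype.card B ≤ g ∧ CImpl q g U ∧
      ∀ O, corner (Function.Embedding.inl : S ↪ S ⊕ B) (U O) = A O

theorem Enc.mono {q g q' g' : ℕ} {A : OracleData n p → Op S} (h : Enc q g A) (hq : q ≤ q')
    (hg : g ≤ g') : Enc q' g' A := by
  obtain ⟨B, i1, i2, U, h1, h2, h3⟩ := h
  exact ⟨B, i1, i2, U, h1.trans hg, h2.mono hq hg, h3⟩

theorem corner_trans (e : S ↪ Q) (f : Q ↪ Q') (U : Op Q') :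
    corner (e.trans f) U = corner e (corner f U) := by
  simp only [corner, ← initMat_trans, Matrix.conjTranspose_mul, Matrix.mul_assoc]

theorem corner_onRegister (f : Q ↪ Q') (U : Op Q) : corner f (onRegister f U) = U := by
  rw [corner, Matrix.mul_assoc, onRegister_mul_initMat, ← Matrix.mul_assoc, initMat_isometry,
    Matrix.one_mul]

theorem Enc.of_embedding {q g : ℕ} {A : OracleData n p → Op S} {U : OracleData n p → Op Q}
    (e : S ↪ Q) (hU : CImpl q g U) (hc : Fintype.card Q ≤ Fintype.card S + g)
    (h : ∀ O, corner e (U O) = A O) : Enc q g A := by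
  obtain ⟨Z, i1, i2, f, hf⟩ := exists_equiv_sum e
  have hcard := Fintype.card_congr f
  rw [Fintype.card_sum] at hcard
  refine ⟨Z, i1, i2, _, by omega, hU.map f.toEmbedding, fun O => ?_⟩
  rw [← hf, corner_trans, corner_onRegister, h]

theorem Enc.of_cimpl {q g : ℕ} {U : OracleData n p → Op S} (hU : CImpl q g U) : Enc q g U :=
  Enc.of_embedding (Function.Embedding.refl S) hU (by omega) fun O => by
    rw [corner, initMat_refl, Matrix.mul_one, Matrix.conjTranspose_one, Matrix.one_mul]

/-- Restricting a block encoding to fixed initial and final states `|0…0⟩` of some qubits. -/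
theorem enc_corner {q g k : ℕ} {A : OracleData n p → Op Q} (hA : Enc q g A) (e : S ↪ Q)
    (hk : Fintype.card Q ≤ Fintype.card S + k) : Enc q (g + k) fun O => corner e (A O) := by
  obtain ⟨B, i1, i2, U, h1, h2, h3⟩ := hA
  refine Enc.of_embedding (e.trans Function.Embedding.inl) (h2.mono le_rfl (Nat.le_add_right g k))
    (by rw [Fintype.card_sum]; omega) fun O => ?_
  rw [corner_trans, h3]

/-- Appending `B` and then removing `B'` is the same as first removing `B'` and then appending
`B`. -/
theorem initMat_exchange :
    (initMat ((Function.Embedding.refl S).sumMap (Function.Embedding.inl : B ↪ B ⊕ B')))ᴴ *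
      initMat ((Function.Embedding.refl S).sumMap (Function.Embedding.inr : B' ↪ B ⊕ B')) =
    initMat (Function.Embedding.inl : S ↪ S ⊕ B) *
      (initMat (Function.Embedding.inl : S ↪ S ⊕ B'))ᴴ := by
  have h1 : ∀ x : S ⊕ B → Bool,
      Function.extend ((Function.Embedding.refl S).sumMap (Function.Embedding.inl : B ↪ B ⊕ B')) x
        (fun _ => false) = Sum.elim (x ∘ Sum.inl) (Sum.elim (x ∘ Sum.inr) fun _ => false) := by
    intro x
    have h0 := ((Function.Embedding.refl S).sumMap
      (Function.Embedding.inl : B ↪ B ⊕ B')).injective.extend_apply x (fun _ => false)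
    funext i
    rcases i with i | i | i
    · exact h0 (Sum.inl i)
    · exact h0 (Sum.inr i)
    · refine extend_apply_off _ _ _ _ fun j => ?_
      rcases j with j | j <;> simp
  have h2 : ∀ x : S ⊕ B' → Bool,
      Function.extend ((Function.Embedding.refl S).sumMap (Function.Embedding.inr : B' ↪ B ⊕ B')) x
        (fun _ => false) = Sum.elim (x ∘ Sum.inl) (Sum.elim (fun _ => false) (x ∘ Sum.inr)) := by
    intro x
    have h0 := ((Function.Embedding.refl S).sumMap
      (Function.Embedding.inr : B' ↪ B ⊕ B')).injective.extend_apply x (fun _ => false)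
    funext i
    rcases i with i | i | i
    · exact h0 (Sum.inl i)
    · refine extend_apply_off _ _ _ _ fun j => ?_
      rcases j with j | j <;> simp
    · exact h0 (Sum.inr i)
  ext x y
  rw [initMat_conjTranspose_mul_apply, initMat_mul_apply, h1, initMat, Matrix.of_apply, h2]
  simp only [Matrix.conjTranspose_apply, initMat, Matrix.of_apply, apply_ite star, star_one,
    star_zero, ← ite_and]
  refine if_congr ?_ rfl rfl
  rw [extend_inl _ (fun _ => false) _ rfl]
  constructor
  · intro h
    refine ⟨fun q hq => ?_, ?_⟩
    · rcases q with q | q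
      · exact absurd rfl (hq q)
      · exact congrFun h (Sum.inr (Sum.inl q))
    · funext q
      rcases q with q | q
      · exact (congrFun h (Sum.inl q)).symm
      · exact (congrFun h (Sum.inr (Sum.inr q))).symm
  · rintro ⟨ha, rfl⟩
    funext q
    rcases q with q | q | q
    · rfl
    · exact ha (Sum.inr q) fun i => by simp
    · rfl

theorem Enc.mul {q g q' g' : ℕ} {A A' : OracleData n p → Op S} (hA : Enc q g A)
    (hA' : Enc q' g' A') : Enc (q + q') (g + g') fun O => A O * A' O := by
  obtain ⟨B, i1, i2, U, h1, h2, h3⟩ := hA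
  obtain ⟨B', i1', i2', U', h1', h2', h3'⟩ := hA'
  let e : S ⊕ B ↪ S ⊕ (B ⊕ B') := (Function.Embedding.refl S).sumMap Function.Embedding.inl
  let e' : S ⊕ B' ↪ S ⊕ (B ⊕ B') := (Function.Embedding.refl S).sumMap Function.Embedding.inr
  have he : Function.Embedding.inl.trans e = Function.Embedding.inl := rfl
  have he' : Function.Embedding.inl.trans e' = Function.Embedding.inl := rfl
  refine ⟨B ⊕ B', inferInstance, inferInstance, _, ?_, (h2.map e).mul (h2'.map e'), fun O => ?_⟩
  · rw [Fintype.card_sum]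
    omega
  · have ha : (initMat (Function.Embedding.inl : S ↪ S ⊕ (B ⊕ B')))ᴴ * onRegister e (U O) =
        (initMat (Function.Embedding.inl : S ↪ S ⊕ B))ᴴ * U O * (initMat e)ᴴ := by
      have := congrArg Matrix.conjTranspose (onRegister_mul_initMat e (U O)ᴴ)
      rw [Matrix.conjTranspose_mul, Matrix.conjTranspose_mul, onRegister_conjTranspose,
        Matrix.conjTranspose_conjTranspose, Matrix.conjTranspose_conjTranspose] at this
      rw [← he, ← initMat_trans, Matrix.conjTranspose_mul, Matrix.mul_assoc, this,
        Matrix.mul_assoc]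
    have hb : onRegister e' (U' O) * initMat (Function.Embedding.inl : S ↪ S ⊕ (B ⊕ B')) =
        initMat e' * (U' O * initMat (Function.Embedding.inl : S ↪ S ⊕ B')) := by
      rw [← he', ← initMat_trans, ← Matrix.mul_assoc, onRegister_mul_initMat, Matrix.mul_assoc]
    beta_reduce
    rw [corner, ← Matrix.mul_assoc, ha, Matrix.mul_assoc _ (onRegister e' _), hb,
      Matrix.mul_assoc _ (initMat e)ᴴ, ← Matrix.mul_assoc (initMat e)ᴴ, initMat_exchange, ← h3,
      ← h3']
    simp only [corner, Matrix.mul_assoc]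

theorem corner_ctrl (e : S ↪ Q) (U : Op Q) : corner e.optionMap (ctrl U) = ctrl (corner e U) := by
  have h1 : ∀ x : Option S → Bool, (Function.extend e.optionMap x fun _ => false) none = x none :=
    fun x => e.optionMap.injective.extend_apply x _ none
  have h2 : ∀ x : Option S → Bool, (Function.extend e.optionMap x fun _ => false) ∘ some =
      Function.extend e (x ∘ some) fun _ => false := by
    intro x
    funext q
    by_cases hq : ∃ s, e s = q
    · obtain ⟨s, rfl⟩ := hq
      rw [e.injective.extend_apply]
      exact e.optionMap.injective.extend_apply x _ (some s)
    · rw [Function.extend_apply' _ _ _ hq]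
      refine extend_apply_off e.optionMap _ _ _ fun i hi => ?_
      cases i with
      | none => exact Option.some_ne_none q hi.symm
      | some s => exact hq ⟨s, Option.some_injective _ hi⟩
  ext x y
  rw [corner_apply, ctrl_apply, ctrl_apply, h1, h1, h2, h2, corner_apply]
  simp only [(Function.extend_injective e.injective fun _ => false).eq_iff]

theorem enc_ctrl {q g : ℕ} {A : OracleData n p → Op S} (hA : Enc q g A) :
    Enc q (g + 14) fun O => ctrl (A O) := by
  obtain ⟨B, i1, i2, U, h1, h2, h3⟩ := hA
  refine Enc.of_embedding (Function.Embedding.inl : S ↪ S ⊕ B).optionMap (cimpl_ctrl h2)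
    ?_ fun O => ?_
  · simp only [Fintype.card_option, Fintype.card_sum]
    omega
  · rw [corner_ctrl, h3]

theorem Enc.conj {q g q' g' : ℕ} {A V : OracleData n p → Op S} (hA : Enc q g A)
    (hV : Impl q' g' V) : Enc (q + 2 * q') (g + 2 * g') fun O => (V O)ᴴ * A O * V O := by
  obtain ⟨B, i1, i2, U, h1, h2, h3⟩ := hA
  refine ⟨B, i1, i2, _, by omega, h2.conj (hV.map Function.Embedding.inl), fun O => ?_⟩
  have := congrArg Matrix.conjTranspose
    (onRegister_mul_initMat (Function.Embedding.inl : S ↪ S ⊕ B) (V O))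
  rw [Matrix.conjTranspose_mul, Matrix.conjTranspose_mul] at this
  beta_reduce
  rw [corner, Matrix.mul_assoc, Matrix.mul_assoc _ (onRegister _ _),
    onRegister_mul_initMat, Matrix.mul_assoc, ← Matrix.mul_assoc _ (onRegister _ _)ᴴ, this, ← h3,
    corner]
  simp only [Matrix.mul_assoc]

theorem mul_onQubit_apply {T : Type*} [Fintype T] (q : Q) (u : Matrix Bool Bool ℂ)
    (N : Matrix T (Q → Bool) ℂ) (x : T) (y : Q → Bool) :
    (N * onQubit q u) x y = ∑ b, N x (Function.update y q b) * u b (y q) := by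
  have h : onQubit q uᴴ = (onQubit q u)ᴴ := by
    rw [onQubit, onQubit, qubitOp_conjTranspose, onRegister_conjTranspose]
  have := onQubit_mul_apply q uᴴ Nᴴ y x
  rw [h, ← Matrix.conjTranspose_mul, Matrix.conjTranspose_apply] at this
  rw [← star_star ((N * onQubit q u) x y), this, star_sum]
  refine Finset.sum_congr rfl fun b _ => ?_
  simp [mul_comm]

/-- The rotation of a qubit that takes `|0⟩` to `√(1-x) |0⟩ + √x |1⟩`. -/
def rotGate (x : ℝ) : Matrix Bool Bool ℂ :=
  Matrix.of fun a b => if a = b then (√(1 - x) : ℝ) else if a then (√x : ℝ) else -(√x : ℝ)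

theorem rotGate_unitary {x : ℝ} (h0 : 0 ≤ x) (h1 : x ≤ 1) : (rotGate x)ᴴ * rotGate x = 1 := by
  have ha : ((√(1 - x) : ℝ) : ℂ) * (√(1 - x) : ℝ) = 1 - x := by
    rw [← Complex.ofReal_mul, Real.mul_self_sqrt (by linarith)]
    push_cast
    rfl
  have hb : ((√x : ℝ) : ℂ) * (√x : ℝ) = x := by
    rw [← Complex.ofReal_mul, Real.mul_self_sqrt h0]
  ext a b
  cases a <;> cases b <;>
    simp [Matrix.mul_apply, rotGate, Complex.conj_ofReal, ha, hb, mul_comm]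

/-- The operator that applies `B` or `A`, depending on whether the qubit `none` is set. -/
theorem mux_eq (A B : Op S) : (onQubit none notGate)ᴴ * ctrl A * onQubit none notGate * ctrl B =
    (Matrix.blockDiagonal fun b : Bool => if b then B else A).submatrix (optionEquiv S)
      (optionEquiv S) := by
  have : (onQubit none notGate)ᴴ * ctrl A * onQubit none notGate =
      (Matrix.blockDiagonal fun b : Bool => if b then 1 else A).submatrix (optionEquiv S)
        (optionEquiv S) := by
    ext x y
    rw [onQubit_notGate, mapMat_conj_apply, ctrl, Matrix.submatrix_apply, Matrix.submatrix_apply,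
      Matrix.blockDiagonal_apply, Matrix.blockDiagonal_apply]
    have h : ∀ x : Option S → Bool,
        optionEquiv S (Function.update x none (!x none)) = (x ∘ some, !x none) := by
      intro x
      simp [optionEquiv, Function.comp_def]
    have h' : ∀ x : Option S → Bool, optionEquiv S x = (x ∘ some, x none) := fun _ => rfl
    rw [h, h, h', h']
    cases x none <;> cases y none <;> simp
  rw [this, ctrl, Matrix.submatrix_mul_equiv, ← Matrix.blockDiagonal_mul]
  congr 2
  funext b
  cases b <;> simp

/-- Linear combination of unitaries: a rotated ancilla selects between two block encodings. -/
theorem Enc.convex {q g q' g' : ℕ} {A A' : OracleData n p → Op S} (hA : Enc q g A)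
    (hA' : Enc q' g' A') {x : ℝ} (h0 : 0 ≤ x) (h1 : x ≤ 1) :
    Enc (q + q') (g + g' + 33) fun O => ((1 - x : ℝ) : ℂ) • A O + (x : ℂ) • A' O := by
  have hX : Impl (n := n) (p := p) 0 1 fun _ => onQubit (none : Option S) notGate :=
    (Impl.one_qubit (R := Unit) (by simp) (qubitOp_unitary notGate_unitary)).map (point none)
  have hR : Impl (n := n) (p := p) 0 1 fun _ => onQubit (none : Option S) (rotGate x) :=
    (Impl.one_qubit (R := Unit) (by simp) (qubitOp_unitary (rotGate_unitary h0 h1))).map (point none)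
  have h := enc_corner (S := S) (k := 1) ((((enc_ctrl hA).conj hX).mul (enc_ctrl hA')).conj hR)
    Function.Embedding.some (by simp)
  refine cast (congrArg _ (funext fun O => ?_)) (h.mono (q' := q + q') (g' := g + g' + 33)
    (by omega) (by omega))
  rw [mux_eq]
  have ha : ((√(1 - x) : ℝ) : ℂ) * (√(1 - x) : ℝ) = 1 - x := by
    rw [← Complex.ofReal_mul, Real.mul_self_sqrt (by linarith)]
    push_cast
    rfl
  have hb : ((√x : ℝ) : ℂ) * (√x : ℝ) = x := by
    rw [← Complex.ofReal_mul, Real.mul_self_sqrt h0]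
  have h2 : (onQubit (none : Option S) (rotGate x))ᴴ = onQubit none (rotGate x)ᴴ := by
    rw [onQubit, onQubit, qubitOp_conjTranspose, onRegister_conjTranspose]
  have h3 : ∀ w : S → Bool,
      (Function.extend (Function.Embedding.some : S ↪ Option S) w fun _ => false) none = false :=
    fun w => extend_apply_off _ _ _ _ fun i => by simp
  have h4 : ∀ (w : S → Bool) (b : Bool), optionEquiv S (Function.update
      (Function.extend (Function.Embedding.some : S ↪ Option S) w fun _ => false) none b) =
        (w, b) := by
    intro w b
    have h5 : ∀ z : Option S → Bool, optionEquiv S z = (z ∘ some, z none) := fun _ => rfl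
    rw [h5, Function.update_self]
    congr 1
    funext i
    rw [Function.comp_apply, Function.update_of_ne (Option.some_ne_none i)]
    exact Function.Embedding.some.injective.extend_apply w _ i
  ext v w
  rw [corner_apply, mul_onQubit_apply]
  simp only [h2, onQubit_mul_apply, h3, Matrix.submatrix_apply, h4, Matrix.blockDiagonal_apply]
  simp [rotGate, Complex.conj_ofReal]
  linear_combination (A O v w) * ha + (A' O v w) * hb

theorem Enc.one : Enc (n := n) (p := p) 0 0 fun _ => (1 : Op S) := Enc.of_cimpl CImpl.one

/-- A phase factor, applied to an ancilla. -/
theorem Enc.phase {γ : ℂ} (h : star γ * γ = 1) :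
    Enc (n := n) (p := p) 0 1 fun _ => γ • (1 : Op S) := by
  have hu : (γ • (1 : Matrix Bool Bool ℂ))ᴴ * (γ • (1 : Matrix Bool Bool ℂ)) = 1 := by
    rw [Matrix.conjTranspose_smul, Matrix.conjTranspose_one, smul_mul_smul, h, one_mul, one_smul]
  refine Enc.of_embedding Function.Embedding.inl (cimpl_onQubit (Sum.inr () : S ⊕ Unit) hu)
    (by simp) fun O => ?_
  have : onQubit (Sum.inr () : S ⊕ Unit) (γ • (1 : Matrix Bool Bool ℂ)) = γ • 1 := by
    rw [onQubit, ← onRegister_one (point _), ← onRegister_smul]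
    congr 1
    change γ • (1 : Matrix Bool Bool ℂ).submatrix _ _ = _
    rw [Matrix.submatrix_one_equiv]
  rw [this, corner, Matrix.mul_smul, Matrix.smul_mul, Matrix.mul_one, initMat_isometry]

theorem Enc.zero : Enc (n := n) (p := p) 0 34 fun _ => (0 : Op S) := by
  have h := (Enc.one (n := n) (p := p) (S := S)).convex
    (Enc.phase (S := S) (γ := -1) (by simp)) (x := 1 / 2) (by norm_num) (by norm_num)
  refine cast (congrArg _ (funext fun O => ?_)) (h.mono le_rfl (g' := 34) (by omega))
  rw [smul_smul, ← add_smul]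
  norm_num

/-- The projection onto the states in which the qubit `s` is set. -/
theorem Enc.proj (s : S) :
    Enc (n := n) (p := p) 0 34 fun _ => (Matrix.diagonal fun x => if x s then 1 else 0 : Op S) := by
  have hu : ∀ b : Bool, star (if b then (1 : ℂ) else -1) * (if b then 1 else -1) = 1 := by
    intro b
    cases b <;> simp
  have h := (Enc.one (n := n) (p := p) (S := S)).convex
    (Enc.of_cimpl (cimpl_onQubit s (diagonal_unitary hu))) (x := 1 / 2) (by norm_num) (by norm_num)
  refine cast (congrArg _ (funext fun O => ?_)) (h.mono le_rfl (g' := 34) (by omega))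
  rw [onQubit_diagonal, ← Matrix.diagonal_one, ← Matrix.diagonal_smul, ← Matrix.diagonal_smul,
    Matrix.diagonal_add]
  congr 1
  funext x
  cases h : x s <;> simp [h]
  norm_num

end Enc

/-! ### Reflections, register swaps, copies and uniform superpositions -/

section Gadgets

variable {n p : ℕ} {Q R S : Type} [Fintype Q] [DecidableEq Q] [Fintype R] [DecidableEq R]
  [Fintype S] [DecidableEq S]

/-- The reflection `1 - 2 |0…0⟩⟨0…0|`. -/
def zeroReflection (B : Type) [Fintype B] [DecidableEq B] : Op B :=
  Matrix.diagonal fun x => if ∀ i, x i = false then -1 else 1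

theorem onRegister_diagonal (r : R ↪ Q) (f : (R → Bool) → ℂ) :
    onRegister r (Matrix.diagonal f) = Matrix.diagonal fun x => f (x ∘ r) := by
  ext x y
  simp only [onRegister, Matrix.of_apply, Matrix.diagonal_apply, ← ite_and]
  refine if_congr ⟨fun ⟨h1, h2⟩ => ?_, fun h => by simp [h]⟩ rfl rfl
  rw [← extend_comp_of_eq_off r x y h1, ← h2]
  symm
  exact extend_comp_of_eq_off r x x fun _ _ => rfl

theorem mapMat_mul_mapMat {A : Type*} [Fintype A] [DecidableEq A] (σ τ : A → A) :
    mapMat σ * mapMat τ = mapMat fun x => σ (τ x) := by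
  ext x y
  rw [mul_mapMat_apply]
  rfl

theorem mapMat_id {A : Type*} [DecidableEq A] : mapMat (fun x : A => x) = 1 := by
  ext x y
  rw [mapMat, Matrix.of_apply, Matrix.one_apply]

theorem mapMat_conjTranspose {A : Type*} [Fintype A] [DecidableEq A] {σ : A → A}
    (h : Function.Involutive σ) : (mapMat σ)ᴴ = mapMat σ := by
  ext x y
  have h1 := mapMat_mul_apply h (1 : Matrix A A ℂ) x y
  have h2 := mapMat_mul_apply h (1 : Matrix A A ℂ) y x
  rw [Matrix.mul_one] at h1 h2
  rw [Matrix.conjTranspose_apply, h1, h2, Matrix.one_apply, Matrix.one_apply]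
  have : σ y = x ↔ σ x = y := ⟨fun e => by rw [← e, h], fun e => by rw [← e, h]⟩
  simp [this, apply_ite]

/-- One control qubit is added at a time. -/
theorem cimpl_zeroReflection (B : Type) [Fintype B] [DecidableEq B] :
    CImpl (n := n) (p := p) 0 (16 * Fintype.card B + 1) fun _ => zeroReflection B := by
  suffices h : ∀ (i : Fintype B) (d : DecidableEq B),
      CImpl (n := n) (p := p) 0 (16 * Fintype.card B + 1) fun _ => zeroReflection B from h _ _
  refine Finite.induction_empty_option
    (P := fun B => ∀ (i : Fintype B) (d : DecidableEq B),
      CImpl (n := n) (p := p) 0 (16 * Fintype.card B + 1) fun _ => zeroReflection B) ?_ ?_ ?_ B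
  · intro α β f h i d
    let i' : Fintype α := Fintype.ofEquiv β f.symm
    let d' : DecidableEq α := Classical.decEq α
    have h1 := (h i' d').map f.toEmbedding
    rw [← Fintype.card_congr f]
    refine cast (congrArg _ (funext fun O => ?_)) h1
    rw [zeroReflection, onRegister_diagonal, zeroReflection]
    congr 1
    funext x
    refine if_congr ⟨fun h i => ?_, fun h i => h _⟩ rfl rfl
    have := h (f.symm i)
    rwa [Function.comp_apply, Equiv.coe_toEmbedding, f.apply_symm_apply] at this
  · intro i d
    refine (Impl.one_qubit (by simp) (ctrl_unitary (diagonal_unitary fun x => ?_))).mono le_rfl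
      (by omega)
    split_ifs <;> simp
  · intro α _ h i d
    let d' : DecidableEq α := Classical.decEq α
    obtain rfl : i = instFintypeOption := Subsingleton.elim _ _
    obtain rfl : d = fun a b => Option.instDecidableEq a b := Subsingleton.elim _ _
    have hX : Impl (n := n) (p := p) 0 1 fun _ => onQubit (none : Option α) notGate :=
      (Impl.one_qubit (R := Unit) (by simp) (qubitOp_unitary notGate_unitary)).map (point none)
    have h1 := (cimpl_ctrl (h _ d')).conj hX
    rw [Fintype.card_option]
    refine cast ?_ (h1.mono (q' := 0) (g' := 16 * (Fintype.card α + 1) + 1) le_rfl (by omega))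
    refine congrArg _ (funext fun O => ?_)
    have hinj : Function.Injective fun y : Option α → Bool => Function.update y none (!y none) := by
      refine Function.Involutive.injective fun y => ?_
      simp
    rw [zeroReflection, ctrl_diagonal, onQubit_notGate, mapMat_conj_diagonal hinj, zeroReflection]
    congr 1
    funext x
    simp only [Option.forall, Function.update_self, Function.comp_apply]
    cases x none <;> simp

/-- The exchange of two registers of the same kind. -/
def swapOp (I : Type) [Fintype I] [DecidableEq I] : Op (I ⊕ I) := mapMat fun y => y ∘ Sum.swap

/-- The exchange of two qubits. -/
theorem cimpl_swap {a b : Q} (hab : a ≠ b) :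
    CImpl (n := n) (p := p) 0 9 fun _ => mapMat fun y : Q → Bool => y ∘ Equiv.swap a b := by
  obtain ⟨r, hr0, hr1⟩ : ∃ r : Option Unit ↪ Q, r none = a ∧ r (some ()) = b :=
    ⟨⟨fun o => o.elim a fun _ => b, by
      intro x y
      rcases x with _ | _ <;> rcases y with _ | _ <;> simp [hab, hab.symm]⟩, rfl, rfl⟩
  let e : Option Unit ≃ Option Unit := Equiv.swap none (some ())
  have h := ((cimpl_cnot (n := n) (p := p)).conj (impl_cnot.map e.toEmbedding)).map r
  refine cast (congrArg _ (funext fun O => ?_)) h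
  have h1 : onRegister e.toEmbedding cnot = mapMat fun (y : Option Unit → Bool) o =>
      o.elim (xor (y none) (y (some ()))) fun _ => y (some ()) := by
    rw [cnot_eq, onRegister_equiv]
    ext x y
    simp only [mapMat, Matrix.of_apply]
    refine if_congr ⟨fun h => ?_, fun h => ?_⟩ rfl rfl
    · funext o
      have h2 := congrFun h (e o)
      rcases o with _ | _ <;> simpa [e, Bool.xor_comm] using h2
    · subst h
      funext o
      rcases o with _ | _ <;> simp [e, Bool.xor_comm]
  have h2 : Function.Involutive fun (y : Option Unit → Bool) (o : Option Unit) =>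
      o.elim (xor (y none) (y (some ()))) fun _ => y (some ()) := by
    intro y
    funext o
    rcases o with _ | _ <;> simp
  rw [h1, mapMat_conjTranspose h2, cnot_eq, mapMat_mul_mapMat, mapMat_mul_mapMat,
    onRegister_mapMat]
  congr 1
  funext y q
  by_cases hq : ∃ i, r i = q
  · obtain ⟨i, rfl⟩ := hq
    rw [r.injective.extend_apply]
    rcases i with _ | _
    · simp [hr0, hr1, Bool.xor_comm]
    · simp [hr0, hr1]
  · rw [Function.extend_apply' _ _ _ hq, Function.comp_apply, Equiv.swap_apply_of_ne_of_ne]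
    · rintro rfl
      exact hq ⟨_, hr0⟩
    · rintro rfl
      exact hq ⟨_, hr1⟩

theorem cimpl_swapOp (I : Type) [Fintype I] [DecidableEq I] :
    CImpl (n := n) (p := p) 0 (9 * Fintype.card I) fun _ => swapOp I := by
  have key : ∀ T : Finset I, CImpl (n := n) (p := p) 0 (9 * T.card) fun _ =>
      mapMat fun (y : I ⊕ I → Bool) q => if Sum.elim id id q ∈ T then y q.swap else y q := by
    intro T
    induction T using Finset.induction_on with
    | empty =>
      refine cast (congrArg _ (funext fun O => ?_)) (CImpl.one (n := n) (p := p) (Q := I ⊕ I))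
      rw [← mapMat_id]
      simp
    | insert a T ha ih =>
      have hne : (Sum.inl a : I ⊕ I) ≠ Sum.inr a := by simp
      have h := ih.mul (cimpl_swap (n := n) (p := p) hne)
      rw [Finset.card_insert_of_notMem ha]
      refine cast (congrArg _ (funext fun O => ?_)) (h.mono (q' := 0) le_rfl
        (show 9 * T.card + 9 ≤ 9 * (T.card + 1) by omega))
      rw [mapMat_mul_mapMat]
      congr 1
      funext y q
      rcases q with q | q
      · by_cases hq : q = a
        · subst hq
          simp [ha]
        · simp [hq, Equiv.swap_apply_of_ne_of_ne]
      · by_cases hq : q = a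
        · subst hq
          simp [ha]
        · simp [hq, Equiv.swap_apply_of_ne_of_ne]
  refine cast (congrArg _ (funext fun O => ?_)) (key Finset.univ)
  simp only [Finset.mem_univ, if_true]
  rfl

/-- Bitwise addition of chosen qubits to a register. -/
theorem impl_copy (f : R → S) : Impl (n := n) (p := p) 0 (Fintype.card R) fun _ =>
    mapMat fun (y : R ⊕ S → Bool) =>
      Sum.elim (fun i => xor (y (Sum.inr (f i))) (y (Sum.inl i))) (y ∘ Sum.inr) := by
  have key : ∀ T : Finset R, Impl (n := n) (p := p) 0 T.card fun _ =>
      mapMat fun (y : R ⊕ S → Bool) => Sum.elim (fun i => if i ∈ T then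
        xor (y (Sum.inr (f i))) (y (Sum.inl i)) else y (Sum.inl i)) (y ∘ Sum.inr) := by
    intro T
    induction T using Finset.induction_on with
    | empty =>
      refine cast (congrArg _ (funext fun O => ?_)) (Impl.one (n := n) (p := p) (Q := R ⊕ S))
      rw [← mapMat_id]
      congr 1
      funext y q
      rcases q with q | q <;> simp
    | insert a T ha ih =>
      obtain ⟨r, hr0, hr1⟩ : ∃ r : Option Unit ↪ R ⊕ S,
          r none = Sum.inr (f a) ∧ r (some ()) = Sum.inl a :=
        ⟨⟨fun o => o.elim (Sum.inr (f a)) fun _ => Sum.inl a, by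
          intro x y
          rcases x with _ | _ <;> rcases y with _ | _ <;> simp⟩, rfl, rfl⟩
      have h := ih.mul (impl_cnot.map r)
      rw [Finset.card_insert_of_notMem ha]
      refine cast (congrArg _ (funext fun O => ?_)) h
      have hC : onRegister r cnot = mapMat fun y : R ⊕ S → Bool => Sum.elim (fun i => if i = a then
          xor (y (Sum.inr (f a))) (y (Sum.inl a)) else y (Sum.inl i)) (y ∘ Sum.inr) := by
        rw [cnot_eq, onRegister_mapMat]
        congr 1
        funext y q
        have h0 := r.injective.extend_apply (e' := y)
        rcases q with q | q
        · by_cases hq : q = a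
          · subst hq
            refine (congrArg _ hr1.symm).trans ((h0 _ (some ())).trans ?_)
            simp [hr0, hr1]
          · refine (extend_apply_off _ _ _ _ fun i => ?_).trans (by simp [hq])
            rcases i with _ | _
            · simp [hr0]
            · simp [hr1, Ne.symm hq]
        · by_cases hq : q = f a
          · subst hq
            refine (congrArg _ hr0.symm).trans ((h0 _ none).trans ?_)
            simp [hr0]
          · refine extend_apply_off _ _ _ _ fun i => ?_
            rcases i with _ | _
            · simp [hr0, Ne.symm hq]
            · simp [hr1]
      rw [hC, mapMat_mul_mapMat]
      congr 1
      funext y q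
      rcases q with q | q
      · by_cases hq : q = a
        · subst hq
          simp [ha]
        · simp [hq]
      · simp
  refine cast (congrArg _ (funext fun O => ?_)) (key Finset.univ)
  simp only [Finset.mem_univ, if_true]

/-- Hadamard gates on the qubits of `T` prepare the uniform superposition of the basis states
supported on `T`. -/
theorem exists_uniform (T : Finset S) : ∃ G : Op S, Impl (n := n) (p := p) 0 T.card (fun _ => G) ∧
    ∀ x, G x (fun _ => false) =
      if ∀ i ∉ T, x i = false then (((√2 : ℝ) : ℂ)⁻¹) ^ T.card else 0 := by
  induction T using Finset.induction_on with
  | empty =>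
    refine ⟨1, Impl.one, fun x => ?_⟩
    rw [Matrix.one_apply]
    simp [funext_iff]
  | insert a T ha ih =>
    obtain ⟨G, h1, h2⟩ := ih
    have h := ((Impl.one_qubit (n := n) (p := p) (R := Unit) (by simp)
      (qubitOp_unitary hadamard_unitary)).map (point a)).mul h1
    rw [Finset.card_insert_of_notMem ha]
    refine ⟨onQubit a hadamard * G, h.mono le_rfl (by omega), fun x => ?_⟩
    rw [onQubit_mul_apply]
    simp only [h2]
    have h3 : ∀ b, (∀ i ∉ T, Function.update x a b i = false) ↔
        b = false ∧ ∀ i ∉ insert a T, x i = false := by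
      intro b
      constructor
      · intro hb
        refine ⟨by simpa using hb a ha, fun i hi => ?_⟩
        rw [Finset.mem_insert, not_or] at hi
        simpa [hi.1] using hb i hi.2
      · rintro ⟨rfl, hb⟩ i hi
        by_cases hia : i = a
        · subst hia
          simp
        · simpa [hia] using hb i (by simp [hia, hi])
    simp only [h3]
    rw [Fintype.sum_bool]
    simp only [hadamard, Matrix.of_apply, Bool.and_false]
    split_ifs with h4 h5 <;> simp_all [pow_succ, mul_comm]

end Gadgets

/-! ### Block encodings of fixed-point numbers -/

section Value

variable {n p : ℕ} {Q S : Type} [Fintype Q] [DecidableEq Q] [Fintype S] [DecidableEq S]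

/-- Horner's scheme in base 2: halving is a balanced linear combination. -/
theorem enc_unsigned {m : ℕ} (b : Fin m → S) : Enc (n := n) (p := p) 0 (67 * m + 34) fun _ =>
    (Matrix.diagonal fun x : S → Bool => (∑ i, if x (b i) then (2 : ℂ) ^ (i : ℕ) else 0) / 2 ^ m) := by
  induction m with
  | zero => simpa using Enc.zero
  | succ m ih =>
    have h := (ih fun i => b i.castSucc).convex (Enc.proj (n := n) (p := p) (b (Fin.last m)))
      (x := 1 / 2) (by norm_num) (by norm_num)
    refine cast (congrArg _ (funext fun O => ?_)) (h.mono (q' := 0) (g' := 67 * (m + 1) + 34)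
      le_rfl (by omega))
    rw [← Matrix.diagonal_smul, ← Matrix.diagonal_smul, Matrix.diagonal_add]
    congr 1
    funext x
    rw [Fin.sum_univ_castSucc]
    simp only [Pi.smul_apply, smul_eq_mul, Fin.val_castSucc, Fin.val_last]
    by_cases hb : x (b (Fin.last m)) = true <;> simp [hb] <;> field_simp <;> ring

theorem signedVal_cast {m : ℕ} (x : Fin (m + 1) → Bool) : (signedVal x : ℂ) =
    (∑ i : Fin m, if x i.castSucc then (2 : ℂ) ^ (i : ℕ) else 0) -
      if x (Fin.last m) then 2 ^ m else 0 := by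
  rw [signedVal, Int.cast_sub, Int.cast_sum]
  congr 1
  · refine Finset.sum_congr rfl fun i _ => ?_
    split_ifs <;> simp
  · split_ifs <;> simp

theorem enc_signed {m : ℕ} (b : Fin (m + 1) → S) :
    Enc (n := n) (p := p) 0 (67 * m + 102) fun _ =>
      (Matrix.diagonal fun x : S → Bool => (signedVal (x ∘ b) : ℂ) / 2 ^ (m + 1)) := by
  have h := (enc_unsigned (n := n) (p := p) fun i => b i.castSucc).convex
    ((Enc.phase (S := S) (γ := -1) (by simp)).mul (Enc.proj (b (Fin.last m))))
    (x := 1 / 2) (by norm_num) (by norm_num)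
  refine cast (congrArg _ (funext fun O => ?_)) (h.mono (q' := 0) (g' := 67 * m + 102)
      le_rfl (by omega))
  rw [Matrix.smul_mul, Matrix.one_mul, ← Matrix.diagonal_smul, ← Matrix.diagonal_smul,
    ← Matrix.diagonal_smul, Matrix.diagonal_add]
  congr 1
  funext x
  rw [signedVal_cast]
  simp only [Pi.smul_apply, smul_eq_mul, Function.comp_apply]
  by_cases hb : x (b (Fin.last m)) = true <;> simp [hb] <;> field_simp <;> ring

theorem enc_entryVal {m : ℕ} (b : EntryBits m → S) :
    Enc (n := n) (p := p) 0 (134 * m + 238) fun _ =>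
      (Matrix.diagonal fun x : S → Bool => entryVal 0 (x ∘ b) / 2 ^ (m + 2)) := by
  have h := (enc_signed (n := n) (p := p) (b ∘ Sum.inl)).convex
    ((Enc.phase (S := S) (γ := Complex.I) (by simp)).mul (enc_signed (b ∘ Sum.inr)))
    (x := 1 / 2) (by norm_num) (by norm_num)
  refine cast (congrArg _ (funext fun O => ?_)) (h.mono (q' := 0) (g' := 134 * m + 238)
      le_rfl (by omega))
  rw [Matrix.smul_mul, Matrix.one_mul, ← Matrix.diagonal_smul, ← Matrix.diagonal_smul,
    ← Matrix.diagonal_smul, Matrix.diagonal_add]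
  congr 1
  funext x
  simp only [Pi.smul_apply, smul_eq_mul, entryVal, Function.comp_assoc]
  push_cast
  field_simp
  ring

theorem mapMat_mul_initMat (e : S ↪ Q) {σ : (Q → Bool) → (Q → Bool)}
    {τ : (S → Bool) → (S → Bool)}
    (h : ∀ y, σ (Function.extend e y fun _ => false) = Function.extend e (τ y) fun _ => false) :
    mapMat σ * initMat e = initMat e * mapMat τ := by
  ext x y
  rw [mul_initMat_apply, mul_mapMat_apply]
  simp only [mapMat, initMat, Matrix.of_apply, h]

end Value

/-! ### The block encoding of a sparse matrix -/

section Sparse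

variable {n p : ℕ}

/-- The `m + 1` consecutive bits of each part of a matrix entry that start at position `lo`. -/
def window {p : ℕ} (lo m : ℕ) (h : lo + m ≤ p) : EntryBits m → EntryBits p :=
  Sum.map (fun i => ⟨lo + i, by omega⟩) fun i => ⟨lo + i, by omega⟩

/-- Two queries copy a window of the bits of a matrix entry: the entry is computed into clean
ancillas, of which there are `2 * (p + 1)`, and uncomputed after the copy. The row index is the
second register. -/
theorem impl_entryWindow {m : ℕ} (f : EntryBits m → EntryBits p) :
    Impl (n := n) (p := p) 2 (2 * (m + 1)) fun O =>
      mapMat fun y : (Fin n ⊕ Fin n) ⊕ EntryBits m → Bool => Sum.elim (y ∘ Sum.inl) fun i =>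
        xor (O.entry (fun i => y (Sum.inl (Sum.inr i))) (fun i => y (Sum.inl (Sum.inl i))) (f i))
          (y (Sum.inr i)) := by
  obtain ⟨r, hr1, hr2, hr3⟩ : ∃ r : EntryReg n p ↪ ((Fin n ⊕ Fin n) ⊕ EntryBits m) ⊕ EntryBits p,
      (∀ i, r (Sum.inl i) = Sum.inl (Sum.inl (Sum.inr i))) ∧
      (∀ i, r (Sum.inr (Sum.inl i)) = Sum.inl (Sum.inl (Sum.inl i))) ∧
      ∀ i, r (Sum.inr (Sum.inr i)) = Sum.inr i :=
    ⟨⟨Sum.elim (fun i => Sum.inl (Sum.inl (Sum.inr i)))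
      (Sum.elim (fun i => Sum.inl (Sum.inl (Sum.inl i))) Sum.inr), by
        intro a b
        rcases a with a | a | a <;> rcases b with b | b | b <;> simp⟩,
      fun _ => rfl, fun _ => rfl, fun _ => rfl⟩
  obtain ⟨r', hr1', hr2'⟩ : ∃ r : EntryBits m ⊕ EntryBits p ↪
      ((Fin n ⊕ Fin n) ⊕ EntryBits m) ⊕ EntryBits p,
      (∀ i, r (Sum.inl i) = Sum.inl (Sum.inr i)) ∧ ∀ i, r (Sum.inr i) = Sum.inr i :=
    ⟨⟨Sum.elim (fun i => Sum.inl (Sum.inr i)) Sum.inr, by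
        intro a b
        rcases a with a | a <;> rcases b with b | b <;> simp⟩,
      fun _ => rfl, fun _ => rfl⟩
  have hq : Impl (n := n) (p := p) 1 0 fun O => onRegister r O.opH :=
    Impl.of_circuit [.queryH r] (by simp [Circuit.queryCount, Gate.isQuery])
      (by simp [Circuit.gateCount, Gate.isQuery]) fun O => by
        simp [Circuit.op, Gate.op]
  have h := (hq.mul ((impl_copy (n := n) (p := p) f).map r')).mul hq
  have hc : Fintype.card (EntryBits m) = 2 * (m + 1) := by
    simp
    omega
  refine (h.clean Function.Embedding.inl fun O => ?_).mono le_rfl (by omega)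
  have hH : onRegister r O.opH = mapMat fun y => Sum.elim (y ∘ Sum.inl) fun i =>
      xor (y (Sum.inr i)) (O.entry (fun i => y (Sum.inl (Sum.inl (Sum.inr i))))
        (fun i => y (Sum.inl (Sum.inl (Sum.inl i)))) i) := by
    refine (onRegister_mapMat r O.entryStep).trans ?_
    congr 1
    funext y q
    have h0 := r.injective.extend_apply (e' := y) (O.entryStep (y ∘ r))
    rcases q with ((q | q) | q) | q
    · refine (congrArg _ (hr2 q).symm).trans ((h0 _).trans ?_)
      simp [OracleData.entryStep, hr2]
    · refine (congrArg _ (hr1 q).symm).trans ((h0 _).trans ?_)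
      simp [OracleData.entryStep, hr1]
    · refine extend_apply_off _ _ _ _ fun i => ?_
      rcases i with i | i | i
      · simp [hr1]
      · simp [hr2]
      · simp [hr3]
    · refine (congrArg _ (hr3 q).symm).trans ((h0 _).trans ?_)
      simp [OracleData.entryStep, hr1, hr2, hr3]
  have hC : onRegister r' (mapMat fun (y : EntryBits m ⊕ EntryBits p → Bool) =>
      Sum.elim (fun i => xor (y (Sum.inr (f i))) (y (Sum.inl i))) (y ∘ Sum.inr)) =
      mapMat fun y => Sum.elim (Sum.elim (y ∘ Sum.inl ∘ Sum.inl) fun i =>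
        xor (y (Sum.inr (f i))) (y (Sum.inl (Sum.inr i)))) (y ∘ Sum.inr) := by
    rw [onRegister_mapMat]
    congr 1
    funext y q
    have h0 := r'.injective.extend_apply (e' := y)
      (Sum.elim (fun i => xor ((y ∘ r') (Sum.inr (f i))) ((y ∘ r') (Sum.inl i)))
        ((y ∘ r') ∘ Sum.inr))
    rcases q with (q | q) | q
    · refine extend_apply_off _ _ _ _ fun i => ?_
      rcases i with i | i
      · simp [hr1']
      · simp [hr2']
    · refine (congrArg _ (hr1' q).symm).trans ((h0 _).trans ?_)
      simp [hr1', hr2']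
    · refine (congrArg _ (hr2' q).symm).trans ((h0 _).trans ?_)
      simp [hr2']
  rw [hH, hC, mapMat_mul_mapMat, mapMat_mul_mapMat]
  refine mapMat_mul_initMat _ fun y => ?_
  rw [extend_inl _ (fun _ => false) _ rfl, extend_inl _ (fun _ => false) _ rfl]
  funext q
  rcases q with (q | q) | q <;> simp

/-- The diagonal operator of the (windowed) matrix entries, with row index in the second
register. -/
theorem enc_entries {m : ℕ} (f : EntryBits m → EntryBits p) :
    Enc (n := n) (p := p) 4 (140 * m + 250) fun O =>
      (Matrix.diagonal fun x : Fin n ⊕ Fin n → Bool =>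
        entryVal 0 (O.entry (x ∘ Sum.inr) (x ∘ Sum.inl) ∘ f) / 2 ^ (m + 2)) := by
  have hc : Fintype.card (EntryBits m) = 2 * (m + 1) := by
    simp
    omega
  have h := enc_corner (k := 2 * (m + 1)) ((enc_entryVal (n := n) (p := p)
    (Sum.inr : EntryBits m → (Fin n ⊕ Fin n) ⊕ EntryBits m)).conj (impl_entryWindow f))
      Function.Embedding.inl (by rw [Fintype.card_sum, hc])
  refine cast (congrArg _ (funext fun O => ?_)) (h.mono (q' := 4) (g' := 140 * m + 250)
    le_rfl (by omega))
  have hinj : Function.Injective fun y : (Fin n ⊕ Fin n) ⊕ EntryBits m → Bool =>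
      (Sum.elim (y ∘ Sum.inl) fun i =>
        xor (O.entry (fun i => y (Sum.inl (Sum.inr i))) (fun i => y (Sum.inl (Sum.inl i))) (f i))
          (y (Sum.inr i)) : (Fin n ⊕ Fin n) ⊕ EntryBits m → Bool) := by
    refine Function.Involutive.injective fun y => ?_
    funext q
    rcases q with q | q <;> simp
  rw [mapMat_conj_diagonal hinj]
  ext x y
  rw [corner_apply, Matrix.diagonal_apply, Matrix.diagonal_apply]
  simp only [(Function.extend_injective Function.Embedding.inl.injective fun _ => false).eq_iff]
  refine if_congr Iff.rfl ?_ rfl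
  rw [extend_inl _ (fun _ => false) _ rfl]
  congr 2
  funext i
  simp [Function.comp_def]

/-- The matrix with entries `h` at the positions that are listed, by indices supported on `T`, both
in the row and in the column, and zero elsewhere. -/
def listed (O : OracleData n p) (T : Finset (Fin n))
    (h : (Fin n → Bool) → (Fin n → Bool) → ℂ) : Op (Fin n) :=
  Matrix.of fun j k => if (∀ i ∉ T, (O.col k).symm j i = false) ∧
    ∀ i ∉ T, (O.col j).symm k i = false then h j k else 0

/-- `|k⟩` is mapped to the superposition of the `|k, j⟩` for the listed positions `j` of row `k`;
after multiplication with the matrix entries the two registers are exchanged, and the inverse of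
the first step leaves the amplitude of `|j⟩`. -/
theorem listed_eq (O : OracleData n p) (T : Finset (Fin n)) {G : Op (Fin n)}
    (hG : ∀ x, G x (fun _ => false) =
      if ∀ i ∉ T, x i = false then (((√2 : ℝ) : ℂ)⁻¹) ^ T.card else 0)
    (h : (Fin n → Bool) → (Fin n → Bool) → ℂ) :
    corner (Function.Embedding.inl : Fin n ↪ Fin n ⊕ Fin n)
      ((onRegister Function.Embedding.inr G)ᴴ * (O.opFᴴ * (swapOp (Fin n) *
        Matrix.diagonal fun x => h (x ∘ Sum.inr) (x ∘ Sum.inl)) * O.opF) *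
          onRegister Function.Embedding.inr G) =
    ((2 : ℂ) ^ T.card)⁻¹ • listed O T h := by
  have hsq : (((√2 : ℝ) : ℂ)⁻¹) ^ T.card * (((√2 : ℝ) : ℂ)⁻¹) ^ T.card = ((2 : ℂ) ^ T.card)⁻¹ := by
    rw [← mul_pow, sqrt_two_inv_sq, ← inv_pow, one_div]
  have hΓ : ∀ (x : Fin n ⊕ Fin n → Bool) (k : Fin n → Bool),
      (onRegister (Function.Embedding.inr : Fin n ↪ Fin n ⊕ Fin n) G *
        initMat (Function.Embedding.inl : Fin n ↪ Fin n ⊕ Fin n)) x k =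
        if x ∘ Sum.inl = k then G (x ∘ Sum.inr) (fun _ => false) else 0 := by
    intro x k
    rw [mul_initMat_apply, extend_inl _ (fun _ => false) _ rfl, onRegister, Matrix.of_apply]
    by_cases hx : x ∘ Sum.inl = k
    · rw [if_pos hx]
      refine if_pos fun q hq => ?_
      rcases q with q | q
      · exact congrFun hx q
      · exact absurd rfl (hq q)
    · rw [if_neg hx]
      exact if_neg fun h => hx (funext fun i => h (Sum.inl i) fun j => by simp)
  have hW : ∀ u v, (O.opFᴴ * (swapOp (Fin n) *
      Matrix.diagonal fun x => h (x ∘ Sum.inr) (x ∘ Sum.inl)) * O.opF) u v =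
      if O.colStep u = O.colStep v ∘ Sum.swap then
        h (O.colStep v ∘ Sum.inr) (O.colStep v ∘ Sum.inl) else 0 := by
    intro u v
    refine (mapMat_conj_apply O.colStep _ u v).trans ?_
    rw [Matrix.mul_diagonal, swapOp, mapMat, Matrix.of_apply, ite_mul, one_mul, zero_mul]
  ext j k
  have hcorner : corner (Function.Embedding.inl : Fin n ↪ Fin n ⊕ Fin n)
      ((onRegister Function.Embedding.inr G)ᴴ * (O.opFᴴ * (swapOp (Fin n) *
        Matrix.diagonal fun x => h (x ∘ Sum.inr) (x ∘ Sum.inl)) * O.opF) *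
          onRegister Function.Embedding.inr G) =
      (onRegister (Function.Embedding.inr : Fin n ↪ Fin n ⊕ Fin n) G *
        initMat (Function.Embedding.inl : Fin n ↪ Fin n ⊕ Fin n))ᴴ *
        (O.opFᴴ * (swapOp (Fin n) *
          Matrix.diagonal fun x => h (x ∘ Sum.inr) (x ∘ Sum.inl)) * O.opF) *
        (onRegister (Function.Embedding.inr : Fin n ↪ Fin n ⊕ Fin n) G *
          initMat (Function.Embedding.inl : Fin n ↪ Fin n ⊕ Fin n)) := by
    simp only [corner, Matrix.conjTranspose_mul, Matrix.mul_assoc]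
  let u₀ : Fin n ⊕ Fin n → Bool := Sum.elim j ((O.col j).symm k)
  let v₀ : Fin n ⊕ Fin n → Bool := Sum.elim k ((O.col k).symm j)
  have hstep : ∀ u : Fin n ⊕ Fin n → Bool,
      O.colStep u = Sum.elim (u ∘ Sum.inl) (O.col (u ∘ Sum.inl) (u ∘ Sum.inr)) := fun _ => rfl
  have hkey : ∀ u v : Fin n ⊕ Fin n → Bool, u ∘ Sum.inl = j → v ∘ Sum.inl = k →
      O.colStep u = O.colStep v ∘ Sum.swap → u = u₀ ∧ v = v₀ := by
    intro u v hu hv huv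
    rw [hstep, hstep, hu, hv] at huv
    have h1 : j = O.col k (v ∘ Sum.inr) := funext fun i => congrFun huv (Sum.inl i)
    have h2 : O.col j (u ∘ Sum.inr) = k := funext fun i => congrFun huv (Sum.inr i)
    have h3 : v ∘ Sum.inr = (O.col k).symm j := by rw [Equiv.eq_symm_apply, ← h1]
    have h4 : u ∘ Sum.inr = (O.col j).symm k := by rw [Equiv.eq_symm_apply, h2]
    exact ⟨by rw [← Sum.elim_comp_inl_inr u, hu, h4], by rw [← Sum.elim_comp_inl_inr v, hv, h3]⟩
  have hsum : ∀ (Γ : Matrix (Fin n ⊕ Fin n → Bool) (Fin n → Bool) ℂ) (W : Op (Fin n ⊕ Fin n)),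
      (Γᴴ * W * Γ) j k = ∑ v, ∑ u, star (Γ u j) * W u v * Γ v k := by
    intro Γ W
    simp only [Matrix.mul_apply, Matrix.conjTranspose_apply, Finset.sum_mul]
  rw [hcorner, hsum]
  simp only [hΓ, hW, hG]
  have hzero : ∀ u v : Fin n ⊕ Fin n → Bool, ¬ (u = u₀ ∧ v = v₀) →
      (star (if u ∘ Sum.inl = j then
        if ∀ i ∉ T, (u ∘ Sum.inr) i = false then (((√2 : ℝ) : ℂ)⁻¹) ^ T.card else 0 else 0) *
        if O.colStep u = O.colStep v ∘ Sum.swap then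
          h (O.colStep v ∘ Sum.inr) (O.colStep v ∘ Sum.inl) else 0) *
      (if v ∘ Sum.inl = k then
        if ∀ i ∉ T, (v ∘ Sum.inr) i = false then (((√2 : ℝ) : ℂ)⁻¹) ^ T.card else 0 else 0) = 0 := by
    intro u v huv
    by_cases hu : u ∘ Sum.inl = j
    · by_cases hv : v ∘ Sum.inl = k
      · rw [if_neg fun h => huv (hkey u v hu hv h), mul_zero, zero_mul]
      · rw [if_neg hv, mul_zero]
    · rw [if_neg hu, star_zero, zero_mul, zero_mul]
  rw [Finset.sum_eq_single v₀, Finset.sum_eq_single u₀]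
  · have h1 : O.colStep v₀ = Sum.elim k j := by
      rw [hstep]
      simp [v₀]
    have h2 : O.colStep u₀ = Sum.elim j k := by
      rw [hstep]
      simp [u₀]
    have h3 : (Sum.elim j k : Fin n ⊕ Fin n → Bool) = Sum.elim k j ∘ Sum.swap := by
      funext q
      rcases q with q | q <;> rfl
    rw [h1, h2, if_pos h3, Matrix.smul_apply, listed, Matrix.of_apply, smul_eq_mul, ← hsq]
    simp only [u₀, v₀, Sum.elim_comp_inl, Sum.elim_comp_inr, if_true]
    by_cases h4 : ∀ i ∉ T, (O.col k).symm j i = false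
    · by_cases h5 : ∀ i ∉ T, (O.col j).symm k i = false
      · simp [eq_true h4, eq_true h5, Complex.conj_ofReal]
        ring
      · simp only [eq_false h5, if_false, and_false, star_zero, zero_mul, mul_zero]
    · simp only [eq_false h4, if_false, false_and, mul_zero]
  · intro u _ hu
    exact hzero u v₀ fun h => hu h.1
  · simp
  · intro v _ hv
    exact Finset.sum_eq_zero fun u _ => hzero u v fun h => hv h.2
  · simp

theorem impl_opF : Impl (n := n) (p := p) 1 0 fun O => O.opF := by
  refine Impl.of_circuit [.queryF (Function.Embedding.refl _)]
    (by simp [Circuit.queryCount, Gate.isQuery])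
    (by simp [Circuit.gateCount, Gate.isQuery]) fun O => ?_
  simp [Circuit.op, Gate.op, onRegister_refl]

/-- The block encoding of a sparse matrix, from six queries. -/
theorem enc_listed {m : ℕ} (f : EntryBits m → EntryBits p) (T : Finset (Fin n)) :
    Enc (n := n) (p := p) 6 (140 * m + 250 + 12 * n) fun O =>
      ((2 : ℂ) ^ T.card)⁻¹ • listed O T fun j k => entryVal 0 (O.entry j k ∘ f) / 2 ^ (m + 2) := by
  obtain ⟨G, hG, hG'⟩ := exists_uniform (n := n) (p := p) T
  have h := enc_corner (k := n) ((((Enc.of_cimpl (cimpl_swapOp (n := n) (p := p) (Fin n))).mul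
    (enc_entries f)).conj impl_opF).conj (hG.map Function.Embedding.inr))
    Function.Embedding.inl (by simp)
  have hT : T.card ≤ n := by simpa using T.card_le_univ
  have h' := h.mono (q' := 6) (g' := 140 * m + 250 + 12 * n) (by omega)
    (by rw [Fintype.card_fin]; omega)
  have hG'' : ∀ x, G x (fun _ => false) =
      if ∀ i ∉ T, x i = false then (((√2 : ℝ) : ℂ)⁻¹) ^ T.card else 0 := by
    intro x
    rw [hG' x]
    congr
  have key := fun O : OracleData n p =>
    listed_eq O T hG'' fun j k => entryVal 0 (O.entry j k ∘ f) / 2 ^ (m + 2)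
  simp only [key] at h'
  exact h'

end Sparse

/-! ### Truncated exponential series -/

section Taylor

/-- The truncated exponential series `∑_{k ≤ m} (j! / (j + k)!) a ^ k` in Horner form; for `j = 0`
this is the Taylor polynomial of `exp` of degree `m`. -/
def hornerExp {R : Type*} [Ring R] [Algebra ℂ R] (a : R) : ℕ → ℕ → R
  | _, 0 => 1
  | j, m + 1 => 1 + ((j : ℂ) + 1)⁻¹ • (a * hornerExp a (j + 1) m)

theorem pow_mul_hornerExp {R : Type*} [Ring R] [Algebra ℂ R] (a : R) (j m : ℕ) :
    ((j.factorial : ℂ)⁻¹) • (a ^ j * hornerExp a j m) =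
      ∑ k ∈ Finset.range (m + 1), (((j + k).factorial : ℂ)⁻¹) • a ^ (j + k) := by
  induction m generalizing j with
  | zero => simp [hornerExp]
  | succ m ih =>
    rw [Finset.sum_range_succ', hornerExp, mul_add, smul_add, mul_one, add_comm]
    have h := ih (j + 1)
    congr 1
    rw [mul_smul_comm, smul_smul, ← mul_assoc, ← pow_succ]
    rw [show (j.factorial : ℂ)⁻¹ * ((j : ℂ) + 1)⁻¹ = ((j + 1).factorial : ℂ)⁻¹ by
      rw [Nat.factorial_succ]; push_cast; rw [mul_inv, mul_comm]]
    rw [h]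
    refine Finset.sum_congr rfl fun k _ => ?_
    rw [show j + 1 + k = j + (k + 1) by ring]

theorem hornerExp_eq_sum {R : Type*} [Ring R] [Algebra ℂ R] (a : R) (m : ℕ) :
    hornerExp a 0 m = ∑ k ∈ Finset.range (m + 1), ((k.factorial : ℂ)⁻¹) • a ^ k := by
  simpa using pow_mul_hornerExp a 0 m

variable {R : Type*} [NormedRing R] [NormedAlgebra ℂ R] [NormOneClass R]

theorem norm_inv_natCast_succ_le (j : ℕ) : ‖((j : ℂ) + 1)⁻¹‖ ≤ 1 := by
  rw [norm_inv, show ((j : ℂ) + 1) = ((j + 1 : ℕ) : ℂ) by push_cast; rfl, Complex.norm_natCast]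
  exact inv_le_one_of_one_le₀ (by exact_mod_cast Nat.succ_pos j)

theorem norm_hornerExp_le {a : R} (ha : ‖a‖ ≤ 1 / 2) (j m : ℕ) : ‖hornerExp a j m‖ ≤ 2 := by
  induction m generalizing j with
  | zero => simp [hornerExp]
  | succ m ih =>
    calc ‖hornerExp a j (m + 1)‖ ≤ ‖(1 : R)‖ + ‖((j : ℂ) + 1)⁻¹ • (a * hornerExp a (j + 1) m)‖ :=
          norm_add_le _ _
      _ ≤ 1 + 1 * (1 / 2 * 2) := by
          rw [norm_one, norm_smul]
          gcongr
          · exact norm_inv_natCast_succ_le j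
          · exact (norm_mul_le _ _).trans
              (mul_le_mul ha (ih _) (norm_nonneg _) (by norm_num))
      _ = 2 := by norm_num

theorem norm_hornerExp_sub_le {a b : R} (ha : ‖a‖ ≤ 1 / 2) (hb : ‖b‖ ≤ 1 / 2) (j m : ℕ) :
    ‖hornerExp a j m - hornerExp b j m‖ ≤ 4 * ‖a - b‖ := by
  induction m generalizing j with
  | zero => simp [hornerExp]
  | succ m ih =>
    have key : hornerExp a j (m + 1) - hornerExp b j (m + 1) = ((j : ℂ) + 1)⁻¹ •
        (a * (hornerExp a (j + 1) m - hornerExp b (j + 1) m) + (a - b) * hornerExp b (j + 1) m) := by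
      simp only [hornerExp]
      rw [add_sub_add_left_eq_sub, ← smul_sub]
      congr 1
      noncomm_ring
    have h1 : ‖a * (hornerExp a (j + 1) m - hornerExp b (j + 1) m)‖ ≤ 1 / 2 * (4 * ‖a - b‖) :=
      (norm_mul_le _ _).trans (mul_le_mul ha (ih _) (norm_nonneg _) (by norm_num))
    have h2 : ‖(a - b) * hornerExp b (j + 1) m‖ ≤ ‖a - b‖ * 2 :=
      (norm_mul_le _ _).trans
        (mul_le_mul_of_nonneg_left (norm_hornerExp_le hb _ _) (norm_nonneg _))
    rw [key, norm_smul]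
    have h3 := norm_add_le (a * (hornerExp a (j + 1) m - hornerExp b (j + 1) m))
      ((a - b) * hornerExp b (j + 1) m)
    calc _ ≤ 1 * ‖_‖ := mul_le_mul_of_nonneg_right (norm_inv_natCast_succ_le j) (norm_nonneg _)
      _ ≤ _ := by rw [one_mul]; linarith

theorem norm_hornerExp_sub_exp_le [CompleteSpace R] {a : R} (ha : ‖a‖ ≤ 1 / 2) (m : ℕ) :
    ‖hornerExp a 0 m - NormedSpace.exp a‖ ≤ ((m + 1).factorial : ℝ)⁻¹ := by
  have h1 : HasSum (fun k => ((k.factorial : ℂ)⁻¹) • a ^ k) (NormedSpace.exp a) :=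
    NormedSpace.exp_series_hasSum_exp' a
  have h2 := (hasSum_nat_add_iff' (m + 1)).mpr h1
  rw [← hornerExp_eq_sum] at h2
  have h3 : HasSum (fun k : ℕ => ((m + 1).factorial : ℝ)⁻¹ * (1 / 2 * (1 / 2) ^ k))
      ((m + 1).factorial : ℝ)⁻¹ := by
    have h := (hasSum_geometric_two.mul_left (1 / 2)).mul_left ((m + 1).factorial : ℝ)⁻¹
    rwa [one_div_mul_cancel two_ne_zero, mul_one] at h
  rw [norm_sub_rev, ← h2.tsum_eq]
  refine tsum_of_norm_bounded h3 fun k => ?_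
  rw [norm_smul, norm_inv, Complex.norm_natCast]
  have h4 : ‖a ^ (k + (m + 1))‖ ≤ 1 / 2 * (1 / 2) ^ k := by
    calc ‖a ^ (k + (m + 1))‖ ≤ ‖a‖ ^ (k + (m + 1)) := norm_pow_le _ _
      _ ≤ (1 / 2) ^ (k + (m + 1)) := pow_le_pow_left₀ (norm_nonneg _) ha _
      _ ≤ (1 / 2) ^ (k + 1) := pow_le_pow_of_le_one (by norm_num) (by norm_num) (by omega)
      _ = _ := by ring
  refine mul_le_mul (inv_anti₀ (by positivity) ?_) h4 (norm_nonneg _) (by positivity)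
  exact_mod_cast Nat.factorial_le (by omega)

end Taylor

section TaylorEncoding

variable {n p : ℕ} {S : Type} [Fintype S] [DecidableEq S]

/-- A block encoding may be scaled down by any factor in `[0, 1]`. -/
theorem Enc.shrink {q g : ℕ} {A : OracleData n p → Op S} (hA : Enc q g A) {x : ℝ} (h0 : 0 ≤ x)
    (h1 : x ≤ 1) : Enc q (g + 67) fun O => (x : ℂ) • A O := by
  have h := Enc.zero.convex hA h0 h1
  simp only [smul_zero, zero_add] at h
  exact h.mono (by omega) (by omega)

/-- For `‖a‖ ≤ 1 / 2` the weights in Horner's scheme are those of a convex combination of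
`1`, `2 a T` and `0`, where `T` is half the preceding polynomial. -/
theorem enc_hornerExp {q g : ℕ} {A : OracleData n p → Op S} (hA : Enc q g A) {x : ℝ}
    (h0 : 0 ≤ x) (h1 : x ≤ 1 / 2) (j m : ℕ) :
    Enc (m * q) (m * (g + 100) + 67) fun O =>
      (1 / 2 : ℂ) • hornerExp ((x : ℂ) • A O) j m := by
  induction m generalizing j with
  | zero =>
    have h := (Enc.one (n := n) (p := p) (S := S)).shrink (x := 1 / 2) (by norm_num) (by norm_num)
    refine cast (congrArg _ (funext fun O => ?_)) (h.mono (by omega) (by omega))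
    simp [hornerExp]
  | succ m ih =>
    have hj : (0 : ℝ) < (j : ℝ) + 1 := by positivity
    have hle : 2 * x / ((j : ℝ) + 1) ≤ 1 := by
      rw [div_le_one hj]
      have : (0 : ℝ) ≤ j := by positivity
      linarith
    have h := Enc.one.convex ((hA.mul (ih (j + 1))).shrink (x := 2 * x / ((j : ℝ) + 1))
      (by positivity) hle) (x := 1 / 2) (by norm_num) (by norm_num)
    refine cast (congrArg _ (funext fun O => ?_)) (h.mono (q' := (m + 1) * q)
      (g' := (m + 1) * (g + 100) + 67) (by rw [add_mul]; omega) (by rw [add_mul]; omega))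
    simp only [hornerExp, smul_add, smul_smul, mul_smul_comm, smul_mul_assoc]
    congr 1
    · norm_num
    · congr 1
      push_cast
      field_simp

end TaylorEncoding

/-! ### Oblivious amplitude amplification -/

section Amplification

open scoped Matrix.Norms.L2Operator

variable {n p : ℕ} {S B Q : Type} [Fintype S] [DecidableEq S] [Fintype B] [DecidableEq B]
  [Fintype Q] [DecidableEq Q]

theorem impl_of_cimpl {q g : ℕ} {U : OracleData n p → Op Q} (h : CImpl q g U) :
    Impl q (g + 2) U := by
  have hX : Impl (n := n) (p := p) 0 1 fun _ => onQubit (none : Option Q) notGate :=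
    (Impl.one_qubit (R := Unit) (by simp) (qubitOp_unitary notGate_unitary)).map (point none)
  have h1 : Impl q (g + 2) fun O =>
      (onQubit (none : Option Q) notGate)ᴴ * ctrl (U O) * onQubit none notGate :=
    ((hX.inv.mul h).mul hX).mono (by omega) (by omega)
  refine h1.clean Function.Embedding.some fun O => ?_
  have h2 := mux_eq (U O) 1
  rw [ctrl_one, Matrix.mul_one] at h2
  rw [h2]
  ext x y
  have h5 : ∀ z : Option Q → Bool, optionEquiv Q z = (z ∘ some, z none) := fun _ => rfl
  have h3 : (Function.extend (Function.Embedding.some : Q ↪ Option Q) y fun _ => false) none =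
      false := extend_apply_off _ _ _ _ fun i => by simp
  have h4 : (Function.extend (Function.Embedding.some : Q ↪ Option Q) y fun _ => false) ∘ some =
      y := Function.extend_comp Function.Embedding.some.injective _ _
  rw [mul_initMat_apply, initMat_mul_apply, Matrix.submatrix_apply, h5, h5,
    Matrix.blockDiagonal_apply, h3, h4]
  cases hx : x none
  · have h6 : ∀ q, (∀ i, (Function.Embedding.some : Q ↪ Option Q) i ≠ q) → x q = false := by
      rintro (_ | q) hq
      · exact hx
      · exact absurd rfl (hq q)
    rw [if_pos h6, if_pos rfl]
    rfl
  · have h6 : ¬∀ q, (∀ i, (Function.Embedding.some : Q ↪ Option Q) i ≠ q) → x q = false := by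
      intro h
      have := h none (by simp)
      simp [hx] at this
    rw [if_neg h6, if_neg (by simp)]

theorem reflection_eq : onRegister (Function.Embedding.inr : B ↪ S ⊕ B) (zeroReflection B) =
    1 - (2 : ℂ) • (initMat (Function.Embedding.inl : S ↪ S ⊕ B) *
      (initMat (Function.Embedding.inl : S ↪ S ⊕ B))ᴴ) := by
  ext x y
  rw [zeroReflection, onRegister_diagonal, Matrix.sub_apply, Matrix.smul_apply, initMat_mul_apply,
    Matrix.conjTranspose_apply, initMat, Matrix.of_apply, Matrix.diagonal_apply, Matrix.one_apply,
    extend_inl _ (fun _ => false) _ rfl]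
  have h1 : (∀ q : S ⊕ B, (∀ i, (Function.Embedding.inl : S ↪ S ⊕ B) i ≠ q) → x q = false) ↔
      ∀ i, (x ∘ (Function.Embedding.inr : B ↪ S ⊕ B)) i = false := by
    constructor
    · exact fun h i => h (Sum.inr i) fun j => Sum.inl_ne_inr
    · rintro h (q | q) hq
      · exact absurd rfl (hq q)
      · exact h q
  simp only [h1]
  by_cases h0 : ∀ i, (x ∘ (Function.Embedding.inr : B ↪ S ⊕ B)) i = false
  · have hx : Sum.elim (x ∘ (Function.Embedding.inl : S ↪ S ⊕ B)) (fun _ => false) = x := by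
      funext q
      rcases q with q | q
      · rfl
      · exact (h0 q).symm
    rw [hx, if_pos h0, if_pos h0]
    by_cases hxy : x = y
    · subst hxy
      simp
      norm_num
    · rw [if_neg hxy, if_neg hxy, if_neg (Ne.symm hxy)]
      simp
  · rw [if_neg h0, if_neg h0]
    simp

/-- A matrix with orthonormal columns has norm at most `1`. -/
theorem norm_le_one_of_isometry {A A' : Type*} [Fintype A] [DecidableEq A] [Fintype A']
    [DecidableEq A'] {V : Matrix A A' ℂ} (h : Vᴴ * V = 1) : ‖V‖ ≤ 1 := by
  have h1 : ‖V‖ * ‖V‖ ≤ 1 := by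
    rw [← Matrix.l2_opNorm_conjTranspose_mul_self, h, ← Matrix.diagonal_one,
      Matrix.l2_opNorm_diagonal]
    exact (pi_norm_le_iff_of_nonneg zero_le_one).mpr fun _ => by simp
  nlinarith [norm_nonneg V]

theorem norm_corner_le {e : S ↪ Q} {U : Op Q} (hU : Uᴴ * U = 1) : ‖corner e U‖ ≤ 1 := by
  have h1 := norm_le_one_of_isometry (initMat_isometry e)
  have h2 := Matrix.l2_opNorm_mul ((initMat e)ᴴ * U) (initMat e)
  have h3 := Matrix.l2_opNorm_mul (initMat e)ᴴ U
  rw [Matrix.l2_opNorm_conjTranspose] at h3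
  have h4 := norm_le_one_of_isometry hU
  calc ‖corner e U‖ ≤ ‖(initMat e)ᴴ * U‖ * ‖initMat e‖ := h2
    _ ≤ (‖initMat e‖ * ‖U‖) * ‖initMat e‖ := by gcongr
    _ ≤ (1 * 1) * 1 := by gcongr
    _ = 1 := by norm_num

theorem Enc.norm_le {q g : ℕ} {A : OracleData n p → Op S} (h : Enc q g A) (O : OracleData n p) :
    ‖A O‖ ≤ 1 := by
  obtain ⟨B, _, _, U, -, hU, hA⟩ := h
  rw [← hA O]
  exact norm_corner_le (hU.unitary O)

/-- If the corner of the unitary `W` is `-T / 2`, then one round of amplitude amplification maps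
`|0…0⟩|ψ⟩` to `|0…0⟩T|ψ⟩`, up to the defect of unitarity of `T`. -/
theorem amplify_eq {W : Op (S ⊕ B)} (hW : Wᴴ * W = 1) {T : Op S}
    (h : corner (Function.Embedding.inl : S ↪ S ⊕ B) W = (-(1 / 2) : ℂ) • T) :
    W * onRegister (Function.Embedding.inr : B ↪ S ⊕ B) (zeroReflection B) * Wᴴ *
        onRegister (Function.Embedding.inr : B ↪ S ⊕ B) (zeroReflection B) * W *
        initMat (Function.Embedding.inl : S ↪ S ⊕ B) =
      initMat (Function.Embedding.inl : S ↪ S ⊕ B) * T -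
        W * initMat (Function.Embedding.inl : S ↪ S ⊕ B) * (1 - Tᴴ * T) := by
  have hJ := initMat_isometry (Function.Embedding.inl : S ↪ S ⊕ B)
  rw [reflection_eq]
  rw [corner] at h
  have hW' := unitary_mul_conjTranspose hW
  set J := initMat (Function.Embedding.inl : S ↪ S ⊕ B)
  have h' : Jᴴ * Wᴴ * J = (-(1 / 2) : ℂ) • Tᴴ := by
    have := congrArg Matrix.conjTranspose h
    simpa [Matrix.conjTranspose_mul, Matrix.mul_assoc] using this
  have e1 : (1 - (2 : ℂ) • (J * Jᴴ)) * W * J = W * J + J * T := by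
    have : (1 - (2 : ℂ) • (J * Jᴴ)) * W * J = W * J - (2 : ℂ) • (J * (Jᴴ * W * J)) := by
      simp only [Matrix.sub_mul, Matrix.one_mul, Matrix.smul_mul, Matrix.mul_assoc]
    rw [this, h, Matrix.mul_smul, smul_smul, sub_eq_add_neg, ← neg_smul]
    norm_num
  have e2 : (1 - (2 : ℂ) • (J * Jᴴ)) * Wᴴ * (W * J + J * T) =
      -J + Wᴴ * J * T + J * (Tᴴ * T) := by
    have : (1 - (2 : ℂ) • (J * Jᴴ)) * Wᴴ * (W * J + J * T) =
        (Wᴴ * W) * J + Wᴴ * J * T - (2 : ℂ) • (J * Jᴴ * (Wᴴ * W) * J + J * (Jᴴ * Wᴴ * J) * T) := by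
      simp only [Matrix.sub_mul, Matrix.one_mul, Matrix.smul_mul, Matrix.mul_assoc, Matrix.mul_add,
        smul_add]
      abel
    rw [this, h', hW, Matrix.one_mul, Matrix.mul_one, Matrix.mul_assoc J, hJ, Matrix.mul_one]
    simp only [Matrix.mul_smul, Matrix.smul_mul, smul_add, smul_smul, Matrix.mul_assoc]
    norm_num
    rw [two_smul]
    abel
  calc _ = W * ((1 - (2 : ℂ) • (J * Jᴴ)) * Wᴴ * ((1 - (2 : ℂ) • (J * Jᴴ)) * W * J)) := by
        simp only [Matrix.mul_assoc]
    _ = -(W * J) + (W * Wᴴ) * J * T + W * J * (Tᴴ * T) := by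
        rw [e1, e2]
        simp only [Matrix.mul_assoc, Matrix.mul_add, Matrix.mul_neg]
    _ = _ := by
        rw [hW', Matrix.one_mul, Matrix.mul_sub, Matrix.mul_one]
        abel

/-- Oblivious amplitude amplification: a block encoding of `T / 2`, where `T` is close to a
unitary, yields an approximate implementation of that unitary. -/
theorem exists_amplified {q g : ℕ} {T : OracleData n p → Op S}
    (h : Enc q g fun O => (1 / 2 : ℂ) • T O) :
    ∃ (B : Type) (_ : Fintype B) (_ : DecidableEq B) (U : OracleData n p → Op (S ⊕ B)),
      Impl (3 * q) (35 * g + 39) U ∧ ∀ (O : OracleData n p) (E : Op S), Eᴴ * E = 1 →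
        ‖U O * initMat (Function.Embedding.inl : S ↪ S ⊕ B) -
          initMat (Function.Embedding.inl : S ↪ S ⊕ B) * E‖ ≤ 4 * ‖T O - E‖ := by
  have hT := fun O => h.norm_le O
  -- the sign cancels that of the amplification step
  obtain ⟨B, i1, i2, W, hB, hW, hA⟩ :=
    (Enc.phase (n := n) (p := p) (S := S) (γ := -1) (by simp)).mul h
  have hR : CImpl (n := n) (p := p) 0 (16 * (g + 1) + 1) fun _ =>
      onRegister (Function.Embedding.inr : B ↪ S ⊕ B) (zeroReflection B) :=
    ((cimpl_zeroReflection B).map _).mono le_rfl (by omega)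
  have hWi : CImpl (n := n) (p := p) (0 + q) (1 + g) fun O => (W O)ᴴ := by
    have := Impl.inv hW
    simp only [← ctrl_conjTranspose] at this
    exact this
  refine ⟨B, i1, i2, _, impl_of_cimpl ((((((hW.mul hR).mul hWi).mul hR).mul hW)).mono
    (q' := 3 * q) (g' := 35 * g + 37) (by omega) (by omega)), fun O E hE => ?_⟩
  have hA' : corner (Function.Embedding.inl : S ↪ S ⊕ B) (W O) = (-(1 / 2) : ℂ) • T O := by
    rw [hA O]
    beta_reduce
    rw [Matrix.smul_mul, Matrix.one_mul, smul_smul]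
    norm_num
  have hWO : (W O)ᴴ * W O = 1 := hW.unitary O
  rw [amplify_eq hWO hA']
  have hTn : ‖T O‖ ≤ 2 := by
    have := hT O
    rw [norm_smul] at this
    norm_num at this
    linarith
  have hEn := norm_le_one_of_isometry hE
  have hJn := norm_le_one_of_isometry (initMat_isometry (Function.Embedding.inl : S ↪ S ⊕ B))
  have hWn := norm_le_one_of_isometry hWO
  set J := initMat (Function.Embedding.inl : S ↪ S ⊕ B)
  have e1 : J * T O - W O * J * (1 - (T O)ᴴ * T O) - J * E =
      J * (T O - E) + W O * J * (Eᴴ * (T O - E) + (T O - E)ᴴ * T O) := by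
    rw [← hE]
    simp only [Matrix.mul_sub, Matrix.sub_mul, Matrix.mul_add, Matrix.conjTranspose_sub]
    abel
  rw [e1]
  set δ := ‖T O - E‖
  have hδ : 0 ≤ δ := norm_nonneg _
  have n1 : ‖J * (T O - E)‖ ≤ 1 * δ := (Matrix.l2_opNorm_mul _ _).trans (by gcongr)
  have n2 : ‖Eᴴ * (T O - E)‖ ≤ 1 * δ := by
    refine (Matrix.l2_opNorm_mul _ _).trans ?_
    rw [Matrix.l2_opNorm_conjTranspose]
    gcongr
  have n3 : ‖(T O - E)ᴴ * T O‖ ≤ δ * 2 := by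
    refine (Matrix.l2_opNorm_mul _ _).trans ?_
    rw [Matrix.l2_opNorm_conjTranspose]
    gcongr
  have n4 : ‖W O * J‖ ≤ 1 * 1 := (Matrix.l2_opNorm_mul _ _).trans (by gcongr)
  have n5 : ‖Eᴴ * (T O - E) + (T O - E)ᴴ * T O‖ ≤ 3 * δ :=
    (norm_add_le _ _).trans (by linarith)
  have n6 : ‖W O * J * (Eᴴ * (T O - E) + (T O - E)ᴴ * T O)‖ ≤ 1 * (3 * δ) :=
    (Matrix.l2_opNorm_mul _ _).trans
      (mul_le_mul (n4.trans (by norm_num)) n5 (norm_nonneg _) zero_le_one)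
  exact (norm_add_le _ _).trans (by linarith)

theorem Impl.pow {q g : ℕ} {U : OracleData n p → Op Q} (h : Impl q g U) (r : ℕ) :
    Impl (r * q) (r * g) fun O => U O ^ r := by
  induction r with
  | zero => simpa using Impl.one
  | succ r ih =>
    simp only [pow_succ]
    exact (ih.mul h).mono (by rw [add_mul]; omega) (by rw [add_mul]; omega)

/-- Errors add up over repetitions of a circuit that reuses its ancillas. -/
theorem norm_pow_mul_initMat_sub_le {e : S ↪ Q} {U : Op Q} (hU : Uᴴ * U = 1) {E : Op S}
    (hE : Eᴴ * E = 1) (r : ℕ) :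
    ‖U ^ r * initMat e - initMat e * E ^ r‖ ≤ r * ‖U * initMat e - initMat e * E‖ := by
  have hEn := norm_le_one_of_isometry hE
  have hpow : ∀ r : ℕ, (U ^ r)ᴴ * U ^ r = 1 := by
    intro r
    induction r with
    | zero => simp
    | succ r ih => rw [pow_succ]; exact mul_unitary ih hU
  induction r with
  | zero => simp
  | succ r ih =>
    have hn := norm_le_one_of_isometry (hpow r)
    have e1 : U ^ (r + 1) * initMat e - initMat e * E ^ (r + 1) =
        U ^ r * (U * initMat e - initMat e * E) + (U ^ r * initMat e - initMat e * E ^ r) * E := by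
      rw [pow_succ, pow_succ]
      simp only [Matrix.mul_sub, Matrix.sub_mul, Matrix.mul_assoc]
      abel
    rw [e1]
    have n1 : ‖U ^ r * (U * initMat e - initMat e * E)‖ ≤ 1 * ‖U * initMat e - initMat e * E‖ :=
      (Matrix.l2_opNorm_mul _ _).trans (by gcongr)
    have n2 : ‖(U ^ r * initMat e - initMat e * E ^ r) * E‖ ≤
        (r * ‖U * initMat e - initMat e * E‖) * 1 := by
      refine (Matrix.l2_opNorm_mul _ _).trans ?_
      gcongr
    refine (norm_add_le _ _).trans ?_
    push_cast
    linarith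

end Amplification

/-! ### The diamond distance of channels with close dilations -/

section Diamond

open scoped Matrix.Norms.L2Operator

variable {A R : Type*} [Fintype A] [DecidableEq A] [Fintype R] [DecidableEq R]

/-- A `⋆`-homomorphism between full matrix algebras is a contraction. -/
theorem norm_le_of_starHom {φ : Matrix A A ℂ → Matrix R R ℂ}
    (hs : ∀ (c : ℂ) M, φ (c • M) = c • φ M) (hadd : ∀ M N, φ (M + N) = φ M + φ N)
    (hmul : ∀ M N, φ (M * N) = φ M * φ N) (hstar : ∀ M, φ Mᴴ = (φ M)ᴴ) (M : Matrix A A ℂ) :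
    ‖φ M‖ ≤ ‖M‖ := by
  let ψ : Matrix A A ℂ →⋆ₙₐ[ℂ] Matrix R R ℂ :=
    { toFun := φ
      map_smul' := hs
      map_zero' := by simpa using hs 0 0
      map_add' := hadd
      map_mul' := hmul
      map_star' := hstar }
  exact NonUnitalStarAlgHom.norm_apply_le ψ M

/-- `‖M ⊗ 1‖ ≤ ‖M‖`. -/
theorem norm_blockDiagonal_le {A' : Type*} [Fintype A'] [DecidableEq A'] (M : Matrix A' A ℂ) :
    ‖Matrix.blockDiagonal fun _ : R => M‖ ≤ ‖M‖ := by
  have h1 : ∀ N : Matrix A A ℂ, ‖Matrix.blockDiagonal fun _ : R => N‖ ≤ ‖N‖ := by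
    refine norm_le_of_starHom (fun c N => ?_) (fun N N' => ?_) (fun N N' => ?_) fun N => ?_
    · rw [← Matrix.blockDiagonal_smul]; rfl
    · rw [← Matrix.blockDiagonal_add]; rfl
    · rw [← Matrix.blockDiagonal_mul]
    · rw [Matrix.blockDiagonal_conjTranspose]
  have h2 := h1 (Mᴴ * M)
  rw [Matrix.blockDiagonal_mul (fun _ : R => Mᴴ) fun _ => M, ← Matrix.blockDiagonal_conjTranspose,
    Matrix.l2_opNorm_conjTranspose_mul_self, Matrix.l2_opNorm_conjTranspose_mul_self] at h2
  exact abs_le_of_sq_le_sq' (by nlinarith) (norm_nonneg _) |>.2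

theorem exists_spectral (X : Matrix A A ℂ) : ∃ V : Matrix A A ℂ, Vᴴ * V = 1 ∧ V * Vᴴ = 1 ∧
    Xᴴ * X = V * Matrix.diagonal (fun i =>
      (((Matrix.isHermitian_conjTranspose_mul_self X).eigenvalues i : ℝ) : ℂ)) * Vᴴ := by
  have h := (Matrix.isHermitian_conjTranspose_mul_self X).spectral_theorem
  rw [Unitary.conjStarAlgAut_apply] at h
  refine ⟨((Matrix.isHermitian_conjTranspose_mul_self X).eigenvectorUnitary : Matrix A A ℂ),
    ?_, ?_, h⟩
  · exact Unitary.coe_star_mul_self _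
  · exact Unitary.coe_mul_star_self _

open scoped ComplexOrder in
theorem eigenvalues_nonneg (X : Matrix A A ℂ) (i : A) :
    0 ≤ (Matrix.isHermitian_conjTranspose_mul_self X).eigenvalues i :=
  (Matrix.posSemidef_conjTranspose_mul_self X).eigenvalues_nonneg i

theorem norm_apply_le_norm {A' : Type*} [Fintype A'] [DecidableEq A'] (M : Matrix A' A ℂ) (i : A')
    (j : A) : ‖M i j‖ ≤ ‖M‖ := by
  have h := Matrix.l2_opNorm_mulVec M (EuclideanSpace.single j 1)
  have h1 := PiLp.norm_apply_le (WithLp.toLp 2 (M *ᵥ (EuclideanSpace.single j (1 : ℂ)).ofLp)) i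
  have h2 : (M *ᵥ (EuclideanSpace.single j (1 : ℂ)).ofLp) i = M i j := by
    simp
  rw [show ‖EuclideanSpace.single j (1 : ℂ)‖ = 1 by simp, mul_one] at h
  rw [← h2]
  exact h1.trans h

/-- The trace norm is dual to the operator norm. -/
theorem norm_trace_mul_le (C X : Matrix A A ℂ) : ‖(C * X).trace‖ ≤ ‖C‖ * traceNorm X := by
  obtain ⟨V, hV, hV', hX⟩ := exists_spectral X
  have h0 := eigenvalues_nonneg X
  have h1 : (C * X).trace = (Vᴴ * C * (X * V)).trace := by
    rw [Matrix.trace_mul_comm _ (X * V), Matrix.mul_assoc, ← Matrix.mul_assoc V, hV',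
      Matrix.one_mul, Matrix.trace_mul_comm]
  rw [h1, traceNorm, Finset.mul_sum, Matrix.trace]
  generalize (Matrix.isHermitian_conjTranspose_mul_self X).eigenvalues = μ at *
  refine (norm_sum_le _ _).trans (Finset.sum_le_sum fun i _ => ?_)
  rw [Matrix.diag_apply]
  -- the `i`-th column of `X * V`
  let y : Matrix A Unit ℂ := Matrix.of fun j _ => (X * V) j i
  have h2 : (Vᴴ * C * (X * V)) i i = (Vᴴ * C * y) i () := rfl
  have h3 : ‖y‖ * ‖y‖ = μ i := by
    rw [← Matrix.l2_opNorm_conjTranspose_mul_self]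
    have h4 : yᴴ * y = Matrix.diagonal fun _ => ((μ i : ℝ) : ℂ) := by
      ext a b
      have h5 : (yᴴ * y) a b = ((X * V)ᴴ * (X * V)) i i := rfl
      rw [h5, Matrix.conjTranspose_mul, Matrix.mul_assoc, ← Matrix.mul_assoc Xᴴ, hX,
        Matrix.mul_assoc, Matrix.mul_assoc, hV, Matrix.mul_one, ← Matrix.mul_assoc, hV,
        Matrix.one_mul, Matrix.diagonal_apply_eq, Matrix.diagonal_apply, if_pos rfl]
    rw [h4, Matrix.l2_opNorm_diagonal, pi_norm_const, Complex.norm_real, Real.norm_eq_abs,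
      abs_of_nonneg (h0 i)]
  have h4 : ‖y‖ = √(μ i) := by
    rw [← h3, Real.sqrt_mul_self (norm_nonneg _)]
  have h5 : ‖Vᴴ‖ ≤ 1 := norm_le_one_of_isometry (by rwa [Matrix.conjTranspose_conjTranspose])
  rw [h2, ← h4]
  calc _ ≤ ‖Vᴴ * C * y‖ := norm_apply_le_norm _ _ _
    _ ≤ ‖Vᴴ‖ * ‖C‖ * ‖y‖ := (Matrix.l2_opNorm_mul _ _).trans
        (mul_le_mul_of_nonneg_right (Matrix.l2_opNorm_mul _ _) (norm_nonneg _))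
    _ ≤ 1 * ‖C‖ * ‖y‖ := by gcongr
    _ = _ := by rw [one_mul]

theorem traceNorm_nonneg (X : Matrix A A ℂ) : 0 ≤ traceNorm X :=
  Finset.sum_nonneg fun _ _ => Real.sqrt_nonneg _

/-- The trace norm is attained: take `W = |X|⁻¹ Xᴴ` with the pseudoinverse of `|X|`. -/
theorem exists_trace_eq_traceNorm (X : Matrix A A ℂ) :
    ∃ W : Matrix A A ℂ, ‖W‖ ≤ 1 ∧ (W * X).trace = traceNorm X := by
  obtain ⟨V, hV, hV', hX⟩ := exists_spectral X
  set μ := (Matrix.isHermitian_conjTranspose_mul_self X).eigenvalues with hμ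
  have h0 : ∀ i, 0 ≤ μ i := eigenvalues_nonneg X
  let g : Matrix A A ℂ := Matrix.diagonal fun i => (((√(μ i))⁻¹ : ℝ) : ℂ)
  have hg : gᴴ = g := by
    rw [Matrix.diagonal_conjTranspose]
    congr 1
    funext i
    exact Complex.conj_ofReal _
  have h1 : V * g * Vᴴ * (Xᴴ * X) = V * (g * Matrix.diagonal fun i => ((μ i : ℝ) : ℂ)) * Vᴴ := by
    rw [hX]
    simp only [Matrix.mul_assoc]
    rw [← Matrix.mul_assoc Vᴴ V, hV, Matrix.one_mul]
  refine ⟨V * g * Vᴴ * Xᴴ, ?_, ?_⟩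
  · have h2 : ‖V * g * Vᴴ * Xᴴ‖ * ‖V * g * Vᴴ * Xᴴ‖ ≤ 1 := by
      rw [← Matrix.l2_opNorm_conjTranspose (V * g * Vᴴ * Xᴴ),
        ← Matrix.l2_opNorm_conjTranspose_mul_self, Matrix.conjTranspose_conjTranspose]
      have h3 : V * g * Vᴴ * Xᴴ * (V * g * Vᴴ * Xᴴ)ᴴ =
          V * (g * (Matrix.diagonal fun i => ((μ i : ℝ) : ℂ)) * g) * Vᴴ := by
        rw [Matrix.conjTranspose_mul, Matrix.conjTranspose_mul, Matrix.conjTranspose_mul, hg,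
          Matrix.conjTranspose_conjTranspose, Matrix.conjTranspose_conjTranspose,
          Matrix.mul_assoc _ Xᴴ, ← Matrix.mul_assoc Xᴴ X, ← Matrix.mul_assoc _ (Xᴴ * X), h1]
        simp only [Matrix.mul_assoc]
        rw [← Matrix.mul_assoc Vᴴ V, hV, Matrix.one_mul]
      rw [h3, Matrix.diagonal_mul_diagonal, Matrix.diagonal_mul_diagonal]
      have hVn := norm_le_one_of_isometry hV
      have hd : ‖Matrix.diagonal fun i =>
          (((√(μ i))⁻¹ : ℝ) : ℂ) * ((μ i : ℝ) : ℂ) * (((√(μ i))⁻¹ : ℝ) : ℂ)‖ ≤ 1 := by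
        rw [Matrix.l2_opNorm_diagonal]
        refine (pi_norm_le_iff_of_nonneg zero_le_one).mpr fun i => ?_
        rw [← Complex.ofReal_mul, ← Complex.ofReal_mul, Complex.norm_real, Real.norm_eq_abs]
        rcases eq_or_lt_of_le (h0 i) with h | h
        · rw [← h]; simp
        · have h4 : (√(μ i))⁻¹ * μ i * (√(μ i))⁻¹ = 1 := by
            have h5 : √(μ i) ≠ 0 := (Real.sqrt_pos.mpr h).ne'
            field_simp
            exact (Real.sq_sqrt h.le).symm
          rw [h4, abs_one]
      calc _ ≤ ‖V‖ * _ * ‖Vᴴ‖ := (Matrix.l2_opNorm_mul _ _).trans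
            (mul_le_mul_of_nonneg_right (Matrix.l2_opNorm_mul _ _) (norm_nonneg _))
        _ ≤ 1 * 1 * 1 := by
            rw [Matrix.l2_opNorm_conjTranspose]
            gcongr
        _ = 1 := by norm_num
    nlinarith [norm_nonneg (V * g * Vᴴ * Xᴴ)]
  · rw [Matrix.mul_assoc _ Xᴴ, h1, Matrix.trace_mul_comm, ← Matrix.mul_assoc, hV, Matrix.one_mul,
      Matrix.diagonal_mul_diagonal, Matrix.trace_diagonal, traceNorm, Complex.ofReal_sum]
    refine Finset.sum_congr rfl fun i _ => ?_
    rw [← Complex.ofReal_mul]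
    congr 1
    change (√(μ i))⁻¹ * μ i = √(μ i)
    rcases eq_or_lt_of_le (h0 i) with h | h
    · rw [← h]; simp
    · have h5 : √(μ i) ≠ 0 := (Real.sqrt_pos.mpr h).ne'
      field_simp
      exact (Real.sq_sqrt h.le).symm

theorem extendMap_conjMap {r : ℕ} (K : Matrix A A ℂ) (X : Matrix (A × Fin r) (A × Fin r) ℂ) :
    extendMap (conjMap K) X = (Matrix.blockDiagonal fun _ : Fin r => K) * X *
      (Matrix.blockDiagonal fun _ : Fin r => K)ᴴ := by
  ext x y
  simp only [extendMap, conjMap, LinearMap.coe_mk, AddHom.coe_mk, Matrix.of_apply,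
    Matrix.mul_apply, Matrix.blockDiagonal_conjTranspose, Matrix.blockDiagonal_apply,
    Fintype.sum_prod_type, Finset.sum_mul, ite_mul, mul_ite, zero_mul, mul_zero]
  simp [Finset.sum_ite_eq]

theorem extendMap_sum {r : ℕ} {ι : Type*} (s : Finset ι) (Φ : ι → Matrix A A ℂ →ₗ[ℂ] Matrix A A ℂ)
    (X : Matrix (A × Fin r) (A × Fin r) ℂ) :
    extendMap (∑ z ∈ s, Φ z) X = ∑ z ∈ s, extendMap (Φ z) X := by
  ext x y
  simp [extendMap, LinearMap.sum_apply, Matrix.sum_apply]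

theorem extendMap_sub {r : ℕ} (Φ Ψ : Matrix A A ℂ →ₗ[ℂ] Matrix A A ℂ)
    (X : Matrix (A × Fin r) (A × Fin r) ℂ) :
    extendMap (Φ - Ψ) X = extendMap Φ X - extendMap Ψ X := by
  ext x y
  simp [extendMap]

/-- If two channels have the dilations `G` and `F`, where the environment is read out by the
pairwise orthogonal coisometries `P z`, then their diamond distance is at most `2 ‖G - F‖`. -/
theorem diamondNorm_sub_le {A' Z : Type*} [Fintype A'] [DecidableEq A'] [Fintype Z]
    [DecidableEq Z] {P : Z → Matrix A A' ℂ} (hP : ∀ z z', P z * (P z')ᴴ = if z = z' then 1 else 0)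
    {G F : Matrix A' A ℂ} (hG : ‖G‖ ≤ 1) (hF : ‖F‖ ≤ 1) :
    diamondNorm ((∑ z, conjMap (P z * G)) - ∑ z, conjMap (P z * F)) ≤
      ENNReal.ofReal (2 * ‖G - F‖) := by
  refine iSup_le fun r => iSup_le fun X => iSup_le fun hX => ENNReal.ofReal_le_ofReal ?_
  set Y := extendMap ((∑ z, conjMap (P z * G)) - ∑ z, conjMap (P z * F)) X with hY
  obtain ⟨W, hW, hWY⟩ := exists_trace_eq_traceNorm Y
  let P' : Z → Matrix (A × Fin r) (A' × Fin r) ℂ := fun z =>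
    Matrix.blockDiagonal fun _ : Fin r => P z
  have hP' : ∀ z z', P' z * (P' z')ᴴ = if z = z' then 1 else 0 := by
    intro z z'
    rw [Matrix.blockDiagonal_conjTranspose, ← Matrix.blockDiagonal_mul]
    simp only [hP]
    split_ifs
    · exact Matrix.blockDiagonal_one
    · exact Matrix.blockDiagonal_zero
  let φ : Matrix (A × Fin r) (A × Fin r) ℂ → Matrix (A' × Fin r) (A' × Fin r) ℂ :=
    fun M => ∑ z, (P' z)ᴴ * M * P' z
  have hφ : ‖φ W‖ ≤ 1 := by
    refine (norm_le_of_starHom (φ := φ) (fun c M => ?_) (fun M N => ?_) (fun M N => ?_)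
      (fun M => ?_) W).trans hW
    · simp [φ, Finset.smul_sum]
    · simp [φ, Matrix.mul_add, Matrix.add_mul, Finset.sum_add_distrib]
    · simp only [φ, Finset.sum_mul, Finset.mul_sum]
      have hz : ∀ z z', (P' z)ᴴ * M * P' z * ((P' z')ᴴ * N * P' z') =
          (P' z)ᴴ * M * (P' z * (P' z')ᴴ) * (N * P' z') := fun z z' => by
        simp only [Matrix.mul_assoc]
      simp only [hz, hP']
      refine Finset.sum_congr rfl fun z _ => ?_
      rw [Finset.sum_eq_single z]
      · rw [if_pos rfl, Matrix.mul_one]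
        simp only [Matrix.mul_assoc]
      · intro z' _ hz
        simp [hz]
      · simp
    · simp [φ, Matrix.conjTranspose_sum, Matrix.mul_assoc]
  let E : Matrix A' A ℂ → Matrix (A' × Fin r) (A × Fin r) ℂ := fun M =>
    Matrix.blockDiagonal fun _ : Fin r => M
  have hE : ∀ M, ‖E M‖ ≤ ‖M‖ := fun M => norm_blockDiagonal_le M
  have hsub : E G - E F = E (G - F) := by
    rw [← Matrix.blockDiagonal_sub]; rfl
  have htr : ∀ K : Matrix A' A ℂ, (W * extendMap (∑ z, conjMap (P z * K)) X).trace =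
      ((E K)ᴴ * φ W * E K * X).trace := by
    intro K
    rw [extendMap_sum, Finset.mul_sum, Matrix.trace_sum]
    simp only [φ, Matrix.mul_sum, Matrix.sum_mul, Matrix.trace_sum]
    refine Finset.sum_congr rfl fun z _ => ?_
    have h1 : (Matrix.blockDiagonal fun _ : Fin r => P z * K) = P' z * E K :=
      Matrix.blockDiagonal_mul (fun _ : Fin r => P z) fun _ => K
    rw [extendMap_conjMap, h1, ← Matrix.mul_assoc, Matrix.trace_mul_comm,
      Matrix.conjTranspose_mul]
    simp only [Matrix.mul_assoc]
  have hdiff : ((traceNorm Y : ℝ) : ℂ) =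
      (((E G)ᴴ * φ W * (E G - E F) + (E G - E F)ᴴ * φ W * E F) * X).trace := by
    rw [← hWY, hY, extendMap_sub, Matrix.mul_sub, Matrix.trace_sub, htr, htr, ← Matrix.trace_sub,
      ← Matrix.sub_mul]
    congr 2
    simp only [Matrix.mul_sub, Matrix.sub_mul, Matrix.conjTranspose_sub]
    abel
  have h1 := norm_trace_mul_le
    ((E G)ᴴ * φ W * (E G - E F) + (E G - E F)ᴴ * φ W * E F) X
  rw [← hdiff, Complex.norm_real, Real.norm_eq_abs, abs_of_nonneg (traceNorm_nonneg Y)] at h1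
  have hEG : ‖(E G)ᴴ‖ ≤ 1 := by
    rw [Matrix.l2_opNorm_conjTranspose]
    exact (hE G).trans hG
  have hEF := (hE F).trans hF
  have hd : ‖E G - E F‖ ≤ ‖G - F‖ := hsub ▸ hE (G - F)
  have hd' : ‖(E G - E F)ᴴ‖ ≤ ‖G - F‖ := by rwa [Matrix.l2_opNorm_conjTranspose]
  have n1 : ‖(E G)ᴴ * φ W * (E G - E F)‖ ≤ 1 * 1 * ‖G - F‖ :=
    (Matrix.l2_opNorm_mul _ _).trans (mul_le_mul ((Matrix.l2_opNorm_mul _ _).trans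
      (mul_le_mul hEG hφ (norm_nonneg _) zero_le_one)) hd (norm_nonneg _) (by norm_num))
  have n2 : ‖(E G - E F)ᴴ * φ W * E F‖ ≤ ‖G - F‖ * 1 * 1 :=
    (Matrix.l2_opNorm_mul _ _).trans (mul_le_mul ((Matrix.l2_opNorm_mul _ _).trans
      (mul_le_mul hd' hφ (norm_nonneg _) (norm_nonneg _))) hEF (norm_nonneg _)
      (by have := norm_nonneg (G - F); linarith))
  have n3 := (norm_add_le ((E G)ᴴ * φ W * (E G - E F)) ((E G - E F)ᴴ * φ W * E F)).trans
    (add_le_add n1 n2)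
  calc traceNorm Y ≤ _ := h1
    _ ≤ (1 * 1 * ‖G - F‖ + ‖G - F‖ * 1 * 1) * 1 :=
      mul_le_mul n3 hX (traceNorm_nonneg X) (by have := norm_nonneg (G - F); linarith)
    _ = _ := by ring

variable {S B : Type} [Fintype S] [DecidableEq S] [Fintype B] [DecidableEq B]

/-- A circuit whose action on `|0…0⟩|ψ⟩` is close to that of `V` on `|ψ⟩` induces a channel close
to `ρ ↦ V ρ Vᴴ`. -/
theorem diamondNorm_inducedChannel_sub_le {U : Op (S ⊕ B)} (hU : Uᴴ * U = 1) {V : Op S}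
    (hV : Vᴴ * V = 1) :
    diamondNorm (inducedChannel U - conjMap V) ≤
      ENNReal.ofReal (2 * ‖U * initMat (Function.Embedding.inl : S ↪ S ⊕ B) -
        initMat (Function.Embedding.inl : S ↪ S ⊕ B) * V‖) := by
  let P : (B → Bool) → Matrix (S → Bool) (S ⊕ B → Bool) ℂ := fun z =>
    Matrix.of fun x y => if y = Sum.elim x z then 1 else 0
  have hPmul : ∀ z (M : Matrix (S ⊕ B → Bool) (S → Bool) ℂ) x y,
      (P z * M) x y = M (Sum.elim x z) y := by
    intro z M x y
    simp [P, Matrix.mul_apply]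
  have hP : ∀ z z', P z * (P z')ᴴ = if z = z' then 1 else 0 := by
    intro z z'
    ext x y
    rw [hPmul, Matrix.conjTranspose_apply]
    change star (if Sum.elim x z = Sum.elim y z' then (1 : ℂ) else 0) = _
    have h1 : (Sum.elim x z = Sum.elim y z') ↔ x = y ∧ z = z' := by
      constructor
      · intro h
        exact ⟨funext fun i => congrFun h (Sum.inl i), funext fun i => congrFun h (Sum.inr i)⟩
      · rintro ⟨rfl, rfl⟩
        rfl
    simp only [h1]
    by_cases hz : z = z'
    · by_cases hxy : x = y <;> simp [hz, hxy, Matrix.one_apply]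
    · simp [hz]
  have hJ := norm_le_one_of_isometry (initMat_isometry (Function.Embedding.inl : S ↪ S ⊕ B))
  have hG : ‖U * initMat (Function.Embedding.inl : S ↪ S ⊕ B)‖ ≤ 1 :=
    (Matrix.l2_opNorm_mul _ _).trans
      (mul_le_one₀ (norm_le_one_of_isometry hU) (norm_nonneg _) hJ)
  have hF : ‖initMat (Function.Embedding.inl : S ↪ S ⊕ B) * V‖ ≤ 1 :=
    (Matrix.l2_opNorm_mul _ _).trans
      (mul_le_one₀ hJ (norm_nonneg _) (norm_le_one_of_isometry hV))
  have h := diamondNorm_sub_le hP hG hF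
  have h1 : ∑ z, conjMap (P z * (U * initMat (Function.Embedding.inl : S ↪ S ⊕ B))) =
      inducedChannel U := by
    refine Finset.sum_congr rfl fun z _ => ?_
    congr 1
    ext x y
    rw [hPmul, mul_initMat_apply, extend_inl _ (fun _ => false) _ rfl, Matrix.of_apply]
  have h2 : ∑ z, conjMap (P z * (initMat (Function.Embedding.inl : S ↪ S ⊕ B) * V)) =
      conjMap V := by
    rw [Finset.sum_eq_single fun _ => false]
    · congr 1
      ext x y
      rw [hPmul, initMat_mul_apply, if_pos]
      · rfl
      · rintro (q | q) hq
        · exact absurd rfl (hq q)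
        · rfl
    · intro z _ hz
      have : P z * (initMat (Function.Embedding.inl : S ↪ S ⊕ B) * V) = 0 := by
        ext x y
        rw [hPmul, initMat_mul_apply, if_neg]
        · rfl
        · intro h
          exact hz (funext fun i => h (Sum.inr i) fun j => Sum.inl_ne_inr)
      rw [this]
      ext1 ρ
      simp [conjMap]
    · simp
  rwa [h1, h2] at h

end Diamond

/-! ### Truncation of fixed-point numbers -/

section Bits

/-- The number encoded in two's complement by the bits `0, …, k` of an infinite sequence. -/
def seqSigned (u : ℕ → Bool) (k : ℕ) : ℤ :=
  (∑ i ∈ Finset.range k, if u i then 2 ^ i else 0) - if u k then 2 ^ k else 0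

theorem seqSum_bounds (u : ℕ → Bool) (k : ℕ) :
    0 ≤ (∑ i ∈ Finset.range k, if u i then (2 : ℤ) ^ i else 0) ∧
      (∑ i ∈ Finset.range k, if u i then (2 : ℤ) ^ i else 0) < 2 ^ k := by
  induction k with
  | zero => simp
  | succ k ih =>
    rw [Finset.sum_range_succ, pow_succ]
    have : (0 : ℤ) < 2 ^ k := by positivity
    split_ifs <;> constructor <;> linarith [ih.1, ih.2]

theorem seqSigned_bounds (u : ℕ → Bool) (k : ℕ) :
    -2 ^ k ≤ seqSigned u k ∧ seqSigned u k < 2 ^ k := by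
  have h := seqSum_bounds u k
  have : (0 : ℤ) < 2 ^ k := by positivity
  rw [seqSigned]
  split_ifs <;> constructor <;> linarith [h.1, h.2]

theorem seqSigned_dvd (u : ℕ → Bool) (k l : ℕ) :
    (2 : ℤ) ^ (k + 1) ∣ seqSigned u (k + l) - seqSigned u k := by
  induction l with
  | zero => simp
  | succ l ih =>
    have h : seqSigned u (k + (l + 1)) - seqSigned u k = (seqSigned u (k + l) - seqSigned u k) +
        2 ^ (k + 1) * (2 ^ l * ((if u (k + l) then 1 else 0) - if u (k + l + 1) then 1 else 0)) := by
      have e1 : seqSigned u (k + l + 1) = seqSigned u (k + l) + 2 ^ (k + l + 1) *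
          ((if u (k + l) then 1 else 0) - if u (k + l + 1) then 1 else 0) := by
        rw [seqSigned, seqSigned, Finset.sum_range_succ]
        split_ifs <;> ring
      rw [← add_assoc, e1]
      split_ifs <;> ring
    rw [h]
    exact dvd_add ih (dvd_mul_right _ _)

/-- A number that fits into the bits `0, …, k` is unchanged when the bits above are dropped. -/
theorem seqSigned_eq_of_bounds (u : ℕ → Bool) {k l : ℕ} (h1 : -2 ^ k ≤ seqSigned u (k + l))
    (h2 : seqSigned u (k + l) < 2 ^ k) : seqSigned u (k + l) = seqSigned u k := by
  obtain ⟨c, hc⟩ := seqSigned_dvd u k l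
  have h3 := seqSigned_bounds u k
  have h4 : (0 : ℤ) < 2 ^ k := by positivity
  rw [pow_succ] at hc
  have h5 : c = 0 := by
    have h6 : c < 1 := by nlinarith
    have h7 : -1 < c := by nlinarith
    omega
  rw [h5, mul_zero] at hc
  linarith

theorem seqSigned_add (u : ℕ → Bool) (lo m : ℕ) : seqSigned u (lo + m) =
    (∑ i ∈ Finset.range lo, if u i then 2 ^ i else 0) +
      2 ^ lo * seqSigned (fun i => u (lo + i)) m := by
  rw [seqSigned, seqSigned, Finset.sum_range_add, mul_sub, Finset.mul_sum, add_sub_assoc]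
  simp only [pow_add, mul_ite, mul_zero]

theorem signedVal_eq_seqSigned {p : ℕ} (x : Fin (p + 1) → Bool) (u : ℕ → Bool)
    (h : ∀ i : Fin (p + 1), x i = u i) : signedVal x = seqSigned u p := by
  rw [signedVal, seqSigned, Finset.sum_range]
  simp [h]

theorem signedVal_bounds {p : ℕ} (x : Fin (p + 1) → Bool) :
    -2 ^ p ≤ signedVal x ∧ signedVal x < 2 ^ p := by
  rw [signedVal_eq_seqSigned x (fun i => if h : i < p + 1 then x ⟨i, h⟩ else false)
    fun i => by rw [dif_pos i.is_lt]]
  exact seqSigned_bounds _ _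

/-- The consecutive bits `lo, …, lo + m` of a number that fits into the bits up to `lo + m`
represent its quotient by `2 ^ lo`, rounded down. -/
theorem signedVal_window {p lo m : ℕ} (hp : lo + m ≤ p) (x : Fin (p + 1) → Bool)
    (h1 : -2 ^ (lo + m) ≤ signedVal x) (h2 : signedVal x < 2 ^ (lo + m)) :
    0 ≤ signedVal x - 2 ^ lo * signedVal (fun i : Fin (m + 1) => x ⟨lo + i, by omega⟩) ∧
      signedVal x - 2 ^ lo * signedVal (fun i : Fin (m + 1) => x ⟨lo + i, by omega⟩) ≤
        2 ^ lo - 1 := by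
  obtain ⟨l, rfl⟩ := Nat.exists_eq_add_of_le hp
  let u : ℕ → Bool := fun i => if h : i < lo + m + l + 1 then x ⟨i, h⟩ else false
  have hx : signedVal x = seqSigned u (lo + m + l) :=
    signedVal_eq_seqSigned x u fun i => by simp only [u]; rw [dif_pos i.is_lt]
  have hy : signedVal (fun i : Fin (m + 1) => x ⟨lo + i, by omega⟩) =
      seqSigned (fun i => u (lo + i)) m := by
    refine signedVal_eq_seqSigned _ _ fun i => ?_
    have : lo + (i : ℕ) < lo + m + l + 1 := by omega
    simp only [u]
    rw [dif_pos this]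
  rw [hx] at h1 h2
  rw [hx, hy, seqSigned_eq_of_bounds u h1 h2, seqSigned_add, add_sub_cancel_right]
  have h3 := seqSum_bounds u lo
  exact ⟨h3.1, by have := h3.2; omega⟩

theorem norm_entryVal_sub_window_le {p lo m : ℕ} (s : ℤ) (hp : lo + m ≤ p)
    (z : EntryBits p → Bool)
    (h : ∀ x ∈ ({z ∘ Sum.inl, z ∘ Sum.inr} : Set (Fin (p + 1) → Bool)),
      -2 ^ (lo + m) ≤ signedVal x ∧ signedVal x < 2 ^ (lo + m)) :
    ‖entryVal s z - (2 : ℂ) ^ (s + lo) * entryVal 0 (z ∘ window lo m hp)‖ ≤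
      2 * (2 : ℝ) ^ s * (2 ^ lo - 1) := by
  have h1 := h (z ∘ Sum.inl) (by simp)
  have h2 := h (z ∘ Sum.inr) (by simp)
  have h3 := signedVal_window hp _ h1.1 h1.2
  have h4 := signedVal_window hp _ h2.1 h2.2
  have e1 : (z ∘ window lo m hp) ∘ Sum.inl =
    fun i : Fin (m + 1) => (z ∘ Sum.inl) ⟨lo + i, by omega⟩ := rfl
  have e2 : (z ∘ window lo m hp) ∘ Sum.inr =
    fun i : Fin (m + 1) => (z ∘ Sum.inr) ⟨lo + i, by omega⟩ := rfl
  rw [entryVal, entryVal, e1, e2]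
  generalize signedVal (fun i : Fin (m + 1) => (z ∘ Sum.inl) ⟨lo + i, by omega⟩) = a' at *
  generalize signedVal (fun i : Fin (m + 1) => (z ∘ Sum.inr) ⟨lo + i, by omega⟩) = b' at *
  generalize signedVal (z ∘ Sum.inl) = a at *
  generalize signedVal (z ∘ Sum.inr) = b at *
  have e3 : (2 : ℂ) ^ s * ((a : ℂ) + b * Complex.I) -
      2 ^ (s + lo) * (2 ^ (0 : ℤ) * ((a' : ℂ) + b' * Complex.I)) =
      2 ^ s * (((a - 2 ^ lo * a' : ℤ) : ℂ) + ((b - 2 ^ lo * b' : ℤ) : ℂ) * Complex.I) := by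
    rw [zpow_add₀ two_ne_zero, zpow_natCast, zpow_zero]
    push_cast
    ring
  have hnorm : ∀ c : ℤ, 0 ≤ c ∧ c ≤ 2 ^ lo - 1 → ‖(c : ℂ)‖ ≤ 2 ^ lo - 1 := by
    intro c hc
    rw [Complex.norm_intCast, abs_of_nonneg (by exact_mod_cast hc.1)]
    exact_mod_cast hc.2
  rw [e3, norm_mul, norm_zpow, Complex.norm_ofNat]
  calc _ ≤ (2 : ℝ) ^ s * ((2 ^ lo - 1) + (2 ^ lo - 1)) := by
        refine mul_le_mul_of_nonneg_left ((norm_add_le _ _).trans ?_) (by positivity)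
        rw [norm_mul, Complex.norm_I, mul_one]
        exact add_le_add (hnorm _ h3) (hnorm _ h4)
    _ = _ := by ring

/-- The components of a number are bounded by its absolute value. -/
theorem signedVal_le_norm_entryVal {p : ℕ} (s : ℤ) (z : EntryBits p → Bool) :
    ∀ x ∈ ({z ∘ Sum.inl, z ∘ Sum.inr} : Set (Fin (p + 1) → Bool)),
      (2 : ℝ) ^ s * |(signedVal x : ℝ)| ≤ ‖entryVal s z‖ := by
  have h : ∀ a b : ℤ, |(a : ℝ)| ≤ ‖(a : ℂ) + b * Complex.I‖ ∧
      |(b : ℝ)| ≤ ‖(a : ℂ) + b * Complex.I‖ := by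
    intro a b
    have h1 := Complex.abs_re_le_norm ((a : ℂ) + b * Complex.I)
    have h2 := Complex.abs_im_le_norm ((a : ℂ) + b * Complex.I)
    simp at h1 h2
    exact ⟨h1, h2⟩
  rw [entryVal, norm_mul, norm_zpow, Complex.norm_ofNat]
  rintro x (rfl | rfl)
  · exact mul_le_mul_of_nonneg_left (h _ _).1 (by positivity)
  · exact mul_le_mul_of_nonneg_left (h _ _).2 (by positivity)

/-- The position of the leading bit of the numbers of absolute value at most `2 * M`. -/
theorem exists_leading_bit {p : ℕ} {s : ℤ} {M : ℝ} (hs : (2 : ℝ) ^ s ≤ 2 * M) :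
    ∃ h ≤ p, (2 : ℝ) ^ (s + h) ≤ 4 * M ∧ (h = p ∨ 2 * M < (2 : ℝ) ^ (s + h)) := by
  induction p with
  | zero =>
    have h0 := zpow_pos (two_pos (α := ℝ)) s
    exact ⟨0, le_rfl, by simpa using hs.trans (by linarith), Or.inl rfl⟩
  | succ p ih =>
    obtain ⟨h, hp, h1, h2⟩ := ih
    rcases h2 with rfl | h2
    · by_cases h3 : 2 * M < (2 : ℝ) ^ (s + h)
      · exact ⟨h, hp.trans (Nat.le_succ _), h1, Or.inr h3⟩
      · refine ⟨h + 1, le_rfl, ?_, Or.inl rfl⟩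
        push_cast
        rw [← add_assoc, zpow_add_one₀ two_ne_zero]
        linarith
    · exact ⟨h, hp.trans (Nat.le_succ _), h1, Or.inr h2⟩

end Bits

/-! ### The block encoding of a sparse Hamiltonian -/

section Hamiltonian

open scoped Matrix.Norms.L2Operator

variable {n p : ℕ}

theorem norm_listed_le (O : OracleData n p) (T : Finset (Fin n))
    {h : (Fin n → Bool) → (Fin n → Bool) → ℂ} {c : ℝ} (hc : 0 ≤ c) (hh : ∀ j k, ‖h j k‖ ≤ c) :
    ‖listed O T h‖ ≤ 2 ^ T.card * c := by
  obtain ⟨G, hG, hG'⟩ := exists_uniform (n := n) (p := p) T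
  have hG'' : ∀ x, G x (fun _ => false) =
      if ∀ i ∉ T, x i = false then (((√2 : ℝ) : ℂ)⁻¹) ^ T.card else 0 := by
    intro x
    rw [hG' x]
    congr
  have hJ := norm_le_one_of_isometry
    (initMat_isometry (Function.Embedding.inl : Fin n ↪ Fin n ⊕ Fin n))
  have hGn := norm_le_one_of_isometry
    (onRegister_unitary (Function.Embedding.inr : Fin n ↪ Fin n ⊕ Fin n) (hG.unitary O))
  have hF := norm_le_one_of_isometry (impl_opF.unitary O)
  have hS := norm_le_one_of_isometry ((cimpl_swapOp (n := n) (p := p) (Fin n)).unitary O)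
  have hd : ‖Matrix.diagonal fun x : Fin n ⊕ Fin n → Bool => h (x ∘ Sum.inr) (x ∘ Sum.inl)‖ ≤ c := by
    rw [Matrix.l2_opNorm_diagonal]
    exact (pi_norm_le_iff_of_nonneg hc).mpr fun x => hh _ _
  have hmul : ∀ {α β γ : Type} [Fintype α] [Fintype β] [Fintype γ] [DecidableEq α] [DecidableEq β]
      [DecidableEq γ] {X : Matrix α β ℂ} {Y : Matrix β γ ℂ} {a b : ℝ}, 0 ≤ a → ‖X‖ ≤ a → ‖Y‖ ≤ b →
      ‖X * Y‖ ≤ a * b := fun ha hX hY =>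
    (Matrix.l2_opNorm_mul _ _).trans (mul_le_mul hX hY (norm_nonneg _) ha)
  have hadj : ∀ {α β : Type} [Fintype α] [Fintype β] [DecidableEq α] [DecidableEq β]
      {X : Matrix α β ℂ}, ‖X‖ ≤ 1 → ‖Xᴴ‖ ≤ 1 := fun hX => by
    rwa [Matrix.l2_opNorm_conjTranspose]
  have key : ‖((2 : ℂ) ^ T.card)⁻¹ • listed O T h‖ ≤ 1 * (1 * (1 * (1 * c) * 1) * 1) * 1 := by
    rw [← listed_eq O T hG'' h, corner]
    exact hmul (by linarith) (hmul zero_le_one (hadj hJ) (hmul (by linarith) (hmul zero_le_one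
      (hadj hGn) (hmul (by linarith) (hmul zero_le_one (hadj hF) (hmul zero_le_one hS hd)) hF))
      hGn)) hJ
  rw [norm_smul, norm_inv, norm_pow, Complex.norm_ofNat] at key
  have h2 : (0 : ℝ) < 2 ^ T.card := by positivity
  rw [inv_mul_le_iff₀ h2] at key
  linarith

theorem listed_sub (O : OracleData n p) (T : Finset (Fin n))
    (h h' : (Fin n → Bool) → (Fin n → Bool) → ℂ) :
    listed O T h - listed O T h' = listed O T fun j k => h j k - h' j k := by
  ext j k
  simp only [listed, Matrix.sub_apply, Matrix.of_apply]
  split_ifs <;> simp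

theorem smul_listed (O : OracleData n p) (T : Finset (Fin n)) (c : ℂ)
    (h : (Fin n → Bool) → (Fin n → Bool) → ℂ) :
    c • listed O T h = listed O T fun j k => c * h j k := by
  ext j k
  simp only [listed, Matrix.smul_apply, Matrix.of_apply]
  split_ifs <;> simp

theorem le_bitsVal {l : Fin n → Bool} {i : Fin n} (h : l i = true) : 2 ^ (i : ℕ) ≤ bitsVal l := by
  rw [bitsVal]
  exact (by simp [h] : 2 ^ (i : ℕ) ≤ if l i then 2 ^ (i : ℕ) else 0).trans
    (Finset.single_le_sum (f := fun i : Fin n => if l i then 2 ^ (i : ℕ) else 0)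
      (fun _ _ => Nat.zero_le _) (Finset.mem_univ i))

/-- The bits in which the indices below `d` may differ from zero. -/
def lowBits (n d : ℕ) : Finset (Fin n) := Finset.univ.filter fun i => (i : ℕ) < Nat.clog 2 d

theorem two_pow_card_lowBits_le (n : ℕ) {d : ℕ} (hd : 0 < d) : 2 ^ (lowBits n d).card ≤ 2 * d := by
  have h1 : (lowBits n d).card ≤ Nat.clog 2 d := by
    have h := Finset.card_le_card_of_injOn (s := lowBits n d) (t := Finset.range (Nat.clog 2 d))
      (fun i => (i : ℕ)) (fun i hi => by simpa [lowBits] using hi)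
      (fun i _ j _ hij => Fin.ext hij)
    simpa using h
  refine (Nat.pow_le_pow_right two_pos h1).trans ?_
  rcases Nat.lt_or_ge 1 d with h | h
  · have h2 := Nat.pow_pred_clog_lt_self Nat.one_lt_two h
    have h3 : Nat.clog 2 d = (Nat.clog 2 d).pred + 1 :=
      (Nat.succ_pred_eq_of_pos (Nat.clog_pos Nat.one_lt_two h)).symm
    rw [h3, pow_succ]
    omega
  · have : d = 1 := by omega
    subst this
    simp

/-- All nonzero entries of the Hamiltonian are listed, in their row and in their column. -/
theorem listed_eq_self {O : OracleData n p} {d : ℕ} {s : ℤ} {η : ℝ}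
    {H : Matrix (Fin n → Bool) (Fin n → Bool) ℂ} (hH : H.IsHermitian) (hO : O.Describes d s η H) :
    listed O (lowBits n d) (fun j k => H j k) = H := by
  have h1 : ∀ j k, H j k ≠ 0 → ∀ i ∉ lowBits n d, (O.col j).symm k i = false := by
    intro j k hjk i hi
    obtain ⟨l, hl, rfl⟩ := hO.1 j k hjk
    rw [Equiv.symm_apply_apply]
    by_contra h
    have h2 := le_bitsVal (by simpa using h : l i = true)
    have h3 : Nat.clog 2 d ≤ i := by simpa [lowBits] using hi
    have h4 := (Nat.le_pow_clog Nat.one_lt_two d).trans (Nat.pow_le_pow_right two_pos h3)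
    omega
  ext j k
  rw [listed, Matrix.of_apply]
  by_cases h : H j k = 0
  · simp [h]
  · refine if_pos ⟨h1 k j ?_, h1 j k h⟩
    rw [← hH.apply]
    simpa using h

theorem norm_entry_le_maxNorm (H : Matrix (Fin n → Bool) (Fin n → Bool) ℂ) (j k) :
    ‖H j k‖ ≤ maxNorm H :=
  le_ciSup (f := fun x : (Fin n → Bool) × (Fin n → Bool) => ‖H x.1 x.2‖)
    (Set.finite_range _).bddAbove (j, k)

/-- A block encoding of `H / (32 * d * M)`, up to the rounding of the entries to `b` significant
bits and the error of the oracle. The circuit does not depend on `H`. -/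
theorem exists_enc_hamiltonian (n p d b : ℕ) (s : ℤ) {M : ℝ} (hM : 0 < M) (hd : 0 < d) :
    ∃ A : OracleData n p → Op (Fin n), Enc 6 (140 * b + 317 + 12 * n) A ∧
      ∀ (H : Matrix (Fin n → Bool) (Fin n → Bool) ℂ) (O : OracleData n p) (η : ℝ),
        H.IsHermitian → maxNorm H = M → O.Describes d s η H → η ≤ M →
        ‖((32 * d * M : ℝ) : ℂ) • A O - H‖ ≤ 2 * d * (η + 8 * M / 2 ^ b) := by
  have hdR : (0 : ℝ) < d := by exact_mod_cast hd
  have hcard : (2 : ℝ) ^ (lowBits n d).card ≤ 2 * d := by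
    exact_mod_cast two_pow_card_lowBits_le n hd
  -- replacing the entries by approximations `a` changes the matrix by a sparse matrix
  have main : ∀ (a : (EntryBits p → Bool) → ℂ) (c : ℝ), 0 ≤ c →
      (∀ z, ‖entryVal s z‖ ≤ 2 * M → ‖entryVal s z - a z‖ ≤ c) →
      ∀ (H : Matrix (Fin n → Bool) (Fin n → Bool) ℂ) (O : OracleData n p) (η : ℝ),
        H.IsHermitian → maxNorm H = M → O.Describes d s η H → η ≤ M →
        ‖listed O (lowBits n d) (fun j k => a (O.entry j k)) - H‖ ≤ 2 * d * (η + c) := by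
    intro a c hc ha H O η hH hHM hO hη
    have hη0 : 0 ≤ η := (norm_nonneg _).trans (hO.2 (fun _ => false) fun _ => false)
    have h1 : ‖listed O (lowBits n d) (fun j k => a (O.entry j k)) - H‖ ≤
        2 ^ (lowBits n d).card * (η + c) := by
      conv_lhs => rw [← listed_eq_self hH hO]
      rw [listed_sub]
      refine norm_listed_le O _ (by positivity) fun j k => ?_
      have h2 := hO.2 j k
      have h3 : ‖entryVal s (O.entry j k)‖ ≤ 2 * M := by
        have h4 := norm_entry_le_maxNorm H j k
        have h5 := norm_le_norm_add_norm_sub' (entryVal s (O.entry j k)) (H j k)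
        linarith
      have h4 := norm_sub_le_norm_sub_add_norm_sub (a (O.entry j k)) (entryVal s (O.entry j k))
        (H j k)
      have h5 := ha _ h3
      rw [norm_sub_rev] at h5
      linarith
    exact h1.trans (mul_le_mul_of_nonneg_right hcard (by positivity))
  by_cases hs : (2 : ℝ) ^ s ≤ 2 * M
  · obtain ⟨h, hp, h1, h2⟩ := exists_leading_bit (p := p) hs
    set m := min h b with hm
    set lo := h - m with hlo
    have hlom : lo + m = h := by omega
    have hlop : lo + m ≤ p := by omega
    set x : ℝ := 2 ^ (lowBits n d).card * (2 : ℝ) ^ (s + h + 2) / (32 * d * M) with hx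
    have hx0 : 0 ≤ x := by positivity
    have hx1 : x ≤ 1 := by
      rw [hx, div_le_one (by positivity), zpow_add₀ two_ne_zero]
      have : (2 : ℝ) ^ (s + h) * 2 ^ (2 : ℤ) ≤ 16 * M := by norm_num; linarith
      calc _ ≤ 2 * (d : ℝ) * (16 * M) := by gcongr
        _ = _ := by ring
    refine ⟨_, ((enc_listed (window lo m hlop) (lowBits n d)).shrink hx0 hx1).mono le_rfl
      (by omega), fun H O η hH hHM hO hη => ?_⟩
    have ha : ∀ z, ‖entryVal s z‖ ≤ 2 * M →
        ‖entryVal s z - (2 : ℂ) ^ (s + lo) * entryVal 0 (z ∘ window lo m hlop)‖ ≤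
          8 * M / 2 ^ b := by
      intro z hz
      refine (norm_entryVal_sub_window_le s hlop z fun y hy => ?_).trans ?_
      · rw [hlom]
        rcases h2 with rfl | h2
        · exact signedVal_bounds y
        · have h3 := (signedVal_le_norm_entryVal s z y hy).trans_lt (hz.trans_lt h2)
          rw [zpow_add₀ two_ne_zero, zpow_natCast,
            mul_lt_mul_iff_right₀ (by positivity), abs_lt] at h3
          exact ⟨le_of_lt (by exact_mod_cast h3.1), by exact_mod_cast h3.2⟩
      · rcases le_total h b with hb | hb
        · have : lo = 0 := by omega
          rw [this, pow_zero, sub_self, mul_zero]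
          positivity
        · have hh : h = lo + b := by omega
          rw [le_div_iff₀ (by positivity)]
          rw [hh] at h1
          push_cast at h1
          rw [zpow_add₀ two_ne_zero, zpow_add₀ two_ne_zero, zpow_natCast, zpow_natCast] at h1
          have h3 : (0 : ℝ) < 2 ^ s * 2 ^ b := by positivity
          nlinarith
    have h4 := main _ _ (by positivity) ha H O η hH hHM hO hη
    refine le_trans (le_of_eq ?_) h4
    congr 2
    rw [smul_smul, smul_smul, smul_listed]
    congr 1
    funext j k
    have h5 : ((32 * d * M : ℝ) : ℂ) * (x : ℂ) * ((2 : ℂ) ^ (lowBits n d).card)⁻¹ =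
        2 ^ (s + lo) * 2 ^ (m + 2) := by
      have h6 : (32 * d * M) * x * ((2 : ℝ) ^ (lowBits n d).card)⁻¹ =
          2 ^ (s + lo) * 2 ^ (m + 2) := by
        rw [hx, ← hlom]
        push_cast
        rw [show s + ((lo : ℤ) + m) + 2 = (s + lo) + ((m + 2 : ℕ) : ℤ) by push_cast; ring,
          zpow_add₀ two_ne_zero (s + lo), zpow_natCast]
        field_simp
      have h7 := congrArg (fun r : ℝ => (r : ℂ)) h6
      clear_value x
      push_cast at h7 ⊢
      exact h7
    rw [h5]
    field_simp
  · -- all representable numbers of absolute value at most `2 * M` are zero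
    push Not at hs
    refine ⟨_, Enc.zero.mono (by omega) (by omega), fun H O η hH hHM hO hη => ?_⟩
    have h4 := main (fun _ => 0) (8 * M / 2 ^ b) (by positivity) (fun z hz => ?_) H O η hH hHM hO hη
    · refine le_trans (le_of_eq ?_) h4
      congr 2
      rw [smul_zero]
      ext j k
      simp [listed]
    · have h0 : ∀ y ∈ ({z ∘ Sum.inl, z ∘ Sum.inr} : Set (Fin (p + 1) → Bool)),
          signedVal y = 0 := by
        intro y hy
        have h3 := (signedVal_le_norm_entryVal s z y hy).trans_lt (hz.trans_lt hs)
        have h4 : |(signedVal y : ℝ)| < 1 := by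
          have : (0 : ℝ) < 2 ^ s := by positivity
          nlinarith
        rw [← Int.abs_lt_one_iff]
        exact_mod_cast h4
      rw [sub_zero, entryVal, h0 (z ∘ Sum.inl) (by simp), h0 (z ∘ Sum.inr) (by simp)]
      simp
      positivity

end Hamiltonian

/-! ### Simulation by repeated short segments -/

section Simulation

open scoped Matrix.Norms.L2Operator

variable {n p : ℕ} {S B : Type} [Fintype S] [DecidableEq S] [Fintype B] [DecidableEq B]

/-- The clean ancillas of an implementation become part of the discarded qubits. -/
theorem exists_circuit_of_impl {q g : ℕ} {U : OracleData n p → Op (S ⊕ B)} (h : Impl q g U) :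
    ∃ (a : ℕ) (c : Circuit n p (S ⊕ Fin a)), Circuit.queryCount c ≤ q ∧ Circuit.gateCount c ≤ g ∧
      ∀ (O : OracleData n p) (V : Op S),
        ‖Circuit.op O c * initMat (Function.Embedding.inl : S ↪ S ⊕ Fin a) -
          initMat (Function.Embedding.inl : S ↪ S ⊕ Fin a) * V‖ ≤
        ‖U O * initMat (Function.Embedding.inl : S ↪ S ⊕ B) -
          initMat (Function.Embedding.inl : S ↪ S ⊕ B) * V‖ := by
  obtain ⟨Z, i1, i2, c, hq, hg, hc⟩ := h
  let e : S ↪ (S ⊕ B) ⊕ Z := Function.Embedding.inl.trans Function.Embedding.inl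
  obtain ⟨Z', i3, i4, f, hf⟩ := exists_equiv_sum e
  let f' : (S ⊕ B) ⊕ Z ≃ S ⊕ Fin (Fintype.card Z') :=
    f.trans (Equiv.sumCongr (Equiv.refl S) (Fintype.equivFin Z'))
  have hf' : e.trans f'.toEmbedding = Function.Embedding.inl := by
    ext x
    have h1 := DFunLike.congr_fun hf x
    have h2 : f (e x) = Sum.inl x := h1
    change Sum.map id (Fintype.equivFin Z') (f (e x)) = Sum.inl x
    rw [h2]
    rfl
  refine ⟨_, Circuit.relabel f'.toEmbedding c, by rwa [Circuit.relabel_queryCount],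
    by rwa [Circuit.relabel_gateCount], fun O V => ?_⟩
  have h1 : Circuit.op O (Circuit.relabel f'.toEmbedding c) *
      initMat (Function.Embedding.inl : S ↪ S ⊕ Fin (Fintype.card Z')) -
      initMat (Function.Embedding.inl : S ↪ S ⊕ Fin (Fintype.card Z')) * V =
      initMat f'.toEmbedding * initMat (Function.Embedding.inl : S ⊕ B ↪ (S ⊕ B) ⊕ Z) *
        (U O * initMat (Function.Embedding.inl : S ↪ S ⊕ B) -
          initMat (Function.Embedding.inl : S ↪ S ⊕ B) * V) := by
    rw [← hf', ← initMat_trans, ← initMat_trans, Circuit.relabel_op, ← Matrix.mul_assoc,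
      onRegister_mul_initMat, Matrix.mul_sub]
    congr 1
    · rw [← Matrix.mul_assoc, Matrix.mul_assoc _ (Circuit.op O c), hc O]
      simp only [Matrix.mul_assoc]
    · simp only [Matrix.mul_assoc]
  rw [h1]
  have n1 := norm_le_one_of_isometry (initMat_isometry f'.toEmbedding)
  have n2 := norm_le_one_of_isometry
    (initMat_isometry (Function.Embedding.inl : S ⊕ B ↪ (S ⊕ B) ⊕ Z))
  refine (Matrix.l2_opNorm_mul _ _).trans (mul_le_of_le_one_left (norm_nonneg _) ?_)
  exact (Matrix.l2_opNorm_mul _ _).trans (mul_le_one₀ n1 (norm_nonneg _) n2)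

theorem exp_unitary {H : Op S} (hH : H.IsHermitian) (x : ℝ) :
    (NormedSpace.exp ((-(Complex.I * x)) • H))ᴴ * NormedSpace.exp ((-(Complex.I * x)) • H) = 1 := by
  rw [← Matrix.exp_conjTranspose, Matrix.conjTranspose_smul, hH.eq]
  have h1 : star (-(Complex.I * (x : ℂ))) • H = -((-(Complex.I * (x : ℂ))) • H) := by
    rw [← neg_smul]
    simp
  rw [h1]
  generalize (-(Complex.I * (x : ℂ))) • H = X
  have h2 : Commute (-X) X := (Commute.refl X).neg_left
  rw [← Matrix.exp_add_of_commute _ _ h2, neg_add_cancel, NormedSpace.exp_zero]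

theorem norm_hamiltonian_le {O : OracleData n p} {d : ℕ} (hd : 0 < d) {s : ℤ} {η : ℝ}
    {H : Op (Fin n)} (hH : H.IsHermitian) (hO : O.Describes d s η H) :
    ‖H‖ ≤ 2 * d * maxNorm H := by
  have h0 : 0 ≤ maxNorm H :=
    (norm_nonneg _).trans (norm_entry_le_maxNorm H (fun _ => false) fun _ => false)
  have h1 := norm_listed_le O (lowBits n d) h0 (norm_entry_le_maxNorm H)
  rw [listed_eq_self hH hO] at h1
  have hcard : (2 : ℝ) ^ (lowBits n d).card ≤ 2 * d := by
    exact_mod_cast two_pow_card_lowBits_le n hd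
  exact h1.trans (mul_le_mul_of_nonneg_right hcard h0)

/-- The evolution is divided into `r` segments, each of which is approximated by the Taylor
polynomial of degree `K` of the exponential. -/
theorem exists_simulation (n p d b K : ℕ) (s : ℤ) {M t : ℝ} (hM : 0 < M) (hd : 0 < d) (ht : 0 < t)
    {r : ℕ} (hr : 64 * (d * M * t) ≤ r) :
    ∃ (a : ℕ) (c : Circuit n p (Fin n ⊕ Fin a)), Circuit.queryCount c ≤ r * (18 * K) ∧
      Circuit.gateCount c ≤ r * (35 * (K * (140 * b + 418 + 12 * n) + 67) + 39) ∧
      ∀ (H : Matrix (Fin n → Bool) (Fin n → Bool) ℂ) (O : OracleData n p) (η : ℝ),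
        H.IsHermitian → maxNorm H = M → O.Describes d s η H → η ≤ M →
        diamondNorm (inducedChannel (Circuit.op O c) - evolution H t) ≤
          ENNReal.ofReal (64 * (d * t * (η + 8 * M / 2 ^ b)) + 8 * r / (K + 1).factorial) := by
  have hdR : (0 : ℝ) < d := by exact_mod_cast hd
  have hτ : 0 < d * M * t := by positivity
  have hr0 : (0 : ℝ) < r := by linarith
  -- the Hamiltonian is encoded with the factor `1 / (32 * d * M)`; `64` makes `x ≤ 1 / 2`
  set x : ℝ := 32 * d * M * t / r with hx
  have hx0 : 0 ≤ x := by positivity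
  have hx1 : x ≤ 1 / 2 := by
    rw [hx, div_le_iff₀ hr0]
    linarith
  obtain ⟨A, hA, hAH⟩ := exists_enc_hamiltonian n p d b s hM hd
  have hA' := (Enc.phase (n := n) (p := p) (S := Fin n) (γ := -Complex.I) (by simp)).mul hA
  obtain ⟨B, i1, i2, U, hU, hUE⟩ := exists_amplified
    ((enc_hornerExp hA' hx0 hx1 0 K).mono (q' := 6 * K)
      (g' := K * (140 * b + 418 + 12 * n) + 67) (le_of_eq (by ring)) (le_of_eq (by ring)))
  obtain ⟨a, c, hq, hg, hc⟩ := exists_circuit_of_impl (hU.pow r)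
  refine ⟨a, c, hq.trans (le_of_eq (by ring)), hg, fun H O η hH hHM hO hη => ?_⟩
  set Y : Op (Fin n) := (-(Complex.I * ((t / r : ℝ) : ℂ))) • H with hY
  set X : Op (Fin n) := (x : ℂ) • ((-Complex.I) • 1 * A O) with hX
  set E := NormedSpace.exp Y with hE
  have hEu : Eᴴ * E = 1 := exp_unitary hH _
  have hEr : NormedSpace.exp ((-(Complex.I * (t : ℂ))) • H) = E ^ r := by
    rw [hE, ← Matrix.exp_nsmul, hY, ← Nat.cast_smul_eq_nsmul ℂ, smul_smul]
    congr 2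
    have hrC : (r : ℂ) ≠ 0 := by exact_mod_cast hr0.ne'
    push_cast
    field_simp
  have hXn : ‖X‖ ≤ 1 / 2 := by
    rw [hX, norm_smul, Complex.norm_real, Real.norm_eq_abs, abs_of_nonneg hx0]
    exact (mul_le_of_le_one_right hx0 (hA'.norm_le O)).trans hx1
  have hcoef : ‖(-(Complex.I * ((t / r : ℝ) : ℂ)))‖ = t / r := by
    rw [norm_neg, norm_mul, Complex.norm_I, one_mul, Complex.norm_real, Real.norm_eq_abs,
      abs_of_nonneg (by positivity)]
  have hYn : ‖Y‖ ≤ 1 / 2 := by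
    have h1 := norm_hamiltonian_le hd hH hO
    rw [hHM] at h1
    rw [hY, norm_smul, hcoef]
    calc t / r * ‖H‖ ≤ t / r * (2 * d * M) := by gcongr
      _ = 2 * (d * M * t) / r := by ring
      _ ≤ 1 / 2 := by
        rw [div_le_iff₀ hr0]
        linarith
  have hXY : ‖X - Y‖ ≤ t / r * (2 * d * (η + 8 * M / 2 ^ b)) := by
    have h1 : X - Y = (-(Complex.I * ((t / r : ℝ) : ℂ))) • (((32 * d * M : ℝ) : ℂ) • A O - H) := by
      rw [hX, hY, smul_sub, smul_smul, Matrix.smul_mul, Matrix.one_mul, smul_smul]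
      congr 2
      rw [hx]
      push_cast
      ring
    rw [h1, norm_smul, hcoef]
    exact mul_le_mul_of_nonneg_left (hAH H O η hH hHM hO hη) (by positivity)
  have hTE : ‖hornerExp X 0 K - E‖ ≤
      4 * (t / r * (2 * d * (η + 8 * M / 2 ^ b))) + ((K + 1).factorial : ℝ)⁻¹ := by
    have h1 := norm_hornerExp_sub_le hXn hYn 0 K
    have h2 := norm_hornerExp_sub_exp_le hYn K
    have h3 := norm_sub_le_norm_sub_add_norm_sub (hornerExp X 0 K) (hornerExp Y 0 K) E
    linarith
  have hstep := hUE O E hEu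
  have hpow := norm_pow_mul_initMat_sub_le (e := (Function.Embedding.inl : Fin n ↪ Fin n ⊕ B))
    (hU.unitary O) hEu r
  have hcirc := hc O (E ^ r)
  have hEru : (E ^ r)ᴴ * E ^ r = 1 := by
    rw [← hEr]
    exact exp_unitary hH t
  rw [evolution, hEr]
  refine (diamondNorm_inducedChannel_sub_le (Circuit.op_unitary O c) hEru).trans
    (ENNReal.ofReal_le_ofReal ?_)
  calc _ ≤ 2 * (r * (4 * (4 * (t / r * (2 * d * (η + 8 * M / 2 ^ b))) +
        ((K + 1).factorial : ℝ)⁻¹))) := by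
        refine mul_le_mul_of_nonneg_left (hcirc.trans (hpow.trans ?_)) two_pos.le
        exact mul_le_mul_of_nonneg_left (hstep.trans
          (mul_le_mul_of_nonneg_left hTE (by norm_num))) hr0.le
    _ = _ := by
        field_simp
        ring

end Simulation

/-! ### The choice of the parameters -/

section Parameters

theorem log_le_sqrt {y : ℝ} (hy : 0 < y) : Real.log y ≤ √y := by
  have h1 := Real.log_sqrt hy.le
  have h2 := Real.add_one_le_exp (Real.log √y - 1)
  have h3 := Real.exp_sub (Real.log √y) 1
  rw [Real.exp_log (Real.sqrt_pos.mpr hy)] at h3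
  have h4 : √y / Real.exp 1 ≤ √y / 2 := by
    have := Real.add_one_le_exp (1 : ℝ)
    gcongr
    linarith
  rw [h3] at h2
  linarith

/-- A factorial lower bound: the argument `κ L / log L` is at least `κ √L`, so that its logarithm
is at least `1 + log L / 2`. -/
theorem exp_mul_le_factorial {L κ : ℝ} (hL : 1 < L) (hκ : 3 ≤ κ) {k : ℕ}
    (hk : κ * (L / Real.log L) ≤ k) : Real.exp (κ / 2 * L) ≤ k.factorial := by
  have hlog : 0 < Real.log L := Real.log_pos hL
  have hL0 : 0 < L := by linarith
  have h1 : √L ≤ L / Real.log L := by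
    rw [le_div_iff₀ hlog]
    calc √L * Real.log L ≤ √L * √L := by
          gcongr
          exact log_le_sqrt hL0
      _ = L := Real.mul_self_sqrt hL0.le
  have hs : 0 < √L := Real.sqrt_pos.mpr hL0
  have hk1 : κ * √L ≤ k := (mul_le_mul_of_nonneg_left h1 (by linarith)).trans hk
  have hk0 : (0 : ℝ) < k := lt_of_lt_of_le (by positivity) hk1
  have h2 : 1 + Real.log L / 2 ≤ Real.log k := by
    have h3 := Real.log_le_log (by positivity) hk1
    rw [Real.log_mul (by linarith) hs.ne', Real.log_sqrt hL0.le] at h3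
    have h4 : 1 ≤ Real.log κ := by
      rw [Real.le_log_iff_exp_le (by linarith)]
      exact (Real.exp_one_lt_d9.le.trans (by norm_num)).trans hκ
    linarith
  have h3 : κ / 2 * L ≤ k * (Real.log k - 1) := by
    calc κ / 2 * L = κ * (L / Real.log L) * (Real.log L / 2) := by
          field_simp
      _ ≤ k * (Real.log k - 1) := by
          gcongr
          linarith
  have h4 := Real.pow_div_factorial_le_exp _ hk0.le k
  have hf : (0 : ℝ) < k.factorial := by positivity
  rw [div_le_iff₀ hf] at h4
  have h5 : Real.exp (k * (Real.log k - 1)) * Real.exp k = (k : ℝ) ^ k := by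
    rw [← Real.exp_add, mul_sub, mul_one, sub_add_cancel, mul_comm, Real.exp_mul,
      Real.exp_log hk0, Real.rpow_natCast]
  rw [← h5, mul_comm] at h4
  exact (Real.exp_le_exp.mpr h3).trans (le_of_mul_le_mul_left h4 (Real.exp_pos _))

theorem one_le_div_log {L : ℝ} (hL : 1 < L) : 1 ≤ L / Real.log L := by
  rw [one_le_div (Real.log_pos hL)]
  linarith [Real.log_le_sub_one_of_pos (by linarith : 0 < L)]

theorem exp_mul_le_two_pow {L : ℝ} {b : ℕ} (hL : 0 ≤ L) (hb : 2 * L + 11 ≤ b) :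
    2048 * Real.exp L ≤ 2 ^ b := by
  have h1 : Real.exp L ≤ (2 : ℝ) ^ (2 * L) := by
    rw [Real.rpow_mul two_pos.le, ← Real.exp_one_rpow]
    refine Real.rpow_le_rpow (Real.exp_pos 1).le ?_ hL
    have := Real.exp_one_lt_d9
    norm_num
    linarith
  calc 2048 * Real.exp L ≤ 2048 * (2 : ℝ) ^ (2 * L) := by gcongr
    _ = (2 : ℝ) ^ (2 * L + 11) := by
      rw [Real.rpow_add two_pos]
      norm_num
      ring
    _ ≤ (2 : ℝ) ^ (b : ℝ) := Real.rpow_le_rpow_of_exponent_le one_le_two hb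
    _ = 2 ^ b := Real.rpow_natCast _ _

end Parameters

end SparseSim

end

theorem theorem1 :
    ∀ τ₀ : ℝ, 0 < τ₀ → ∃ C : ℝ, 0 < C ∧
      ∀ (n d p : ℕ) (s : ℤ) (M t ε τ : ℝ),
        0 < t → 0 < ε → τ = d * M * t → τ₀ ≤ τ → Real.exp 1 < τ / ε →
        ∃ (a : ℕ) (c : SparseSim.Circuit n p (Fin n ⊕ Fin a)),
          (SparseSim.Circuit.queryCount c : ℝ) ≤
            C * (τ * (Real.log (τ / ε) / Real.log (Real.log (τ / ε)))) ∧
          (SparseSim.Circuit.gateCount c : ℝ) ≤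
            C * (τ * (n + Real.log (τ / ε) ^ (5 / 2 : ℝ)) *
              (Real.log (τ / ε) / Real.log (Real.log (τ / ε)))) ∧
          ∀ (H : Matrix (Fin n → Bool) (Fin n → Bool) ℂ) (O : SparseSim.OracleData n p),
            H.IsHermitian → SparseSim.IsSparse d H → SparseSim.maxNorm H = M →
            O.Describes d s (ε / (C * d * t)) H →
            SparseSim.diamondNorm
                (SparseSim.inducedChannel (SparseSim.Circuit.op O c) - SparseSim.evolution H t) ≤
              ENNReal.ofReal ε := by
  intro τ₀ hτ₀
  -- `r ≤ c₁ τ` segments, with Taylor polynomials of degree at most `(κ + 1) L / log L`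
  set c₁ : ℝ := 64 + 1 / τ₀ with hc₁
  have hc₁0 : 64 ≤ c₁ := by
    rw [hc₁]
    have : 0 < 1 / τ₀ := by positivity
    linarith
  set κ : ℝ := 3 + 2 * Real.log (16 * c₁) with hκ
  have hlogc : 0 ≤ Real.log (16 * c₁) := Real.log_nonneg (by linarith)
  have hκ3 : 3 ≤ κ := by linarith
  -- each of the `r K` terms costs at most `18` queries and `90000 (n + L)` gates
  set C : ℝ := 90000 * (κ + 1) * c₁ with hC
  have hC256 : 256 ≤ C := by
    rw [hC]
    nlinarith
  refine ⟨C, by linarith, fun n d p s M t ε τ ht hε hτ hττ₀ hexp => ?_⟩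
  have hτ0 : 0 < τ := by linarith
  have hdM : 0 < d * M := by
    rw [hτ] at hτ0
    exact pos_of_mul_pos_left hτ0 ht.le
  have hdR : (0 : ℝ) < d := by
    rcases Nat.eq_zero_or_pos d with h | h
    · simp [h] at hdM
    · exact_mod_cast h
  have hd : 0 < d := by exact_mod_cast hdR
  have hM : 0 < M := pos_of_mul_pos_right hdM hdR.le
  have hy : 0 < τ / ε := by positivity
  set L := Real.log (τ / ε) with hLdef
  have hL : 1 < L := by
    rw [hLdef, Real.lt_log_iff_exp_lt hy]
    exact hexp
  have heL : Real.exp L = τ / ε := Real.exp_log hy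
  set G := L / Real.log L with hG
  have hG1 : 1 ≤ G := SparseSim.one_le_div_log hL
  obtain ⟨r, hr1, hr2⟩ : ∃ r : ℕ, 64 * τ ≤ r ∧ (r : ℝ) ≤ c₁ * τ := by
    refine ⟨⌈64 * τ⌉₊, Nat.le_ceil _, (Nat.ceil_lt_add_one (by positivity)).le.trans ?_⟩
    have : 1 ≤ 1 / τ₀ * τ := by
      rw [one_div, inv_mul_eq_div, one_le_div hτ₀]
      exact hττ₀
    rw [hc₁, add_mul]
    linarith
  obtain ⟨K, hK1, hK2, hK3⟩ : ∃ K : ℕ, κ * G ≤ K ∧ (K : ℝ) ≤ (κ + 1) * G ∧ (1 : ℝ) ≤ K := by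
    refine ⟨⌈κ * G⌉₊, Nat.le_ceil _, (Nat.ceil_lt_add_one (by positivity)).le.trans ?_,
      le_trans ?_ (Nat.le_ceil _)⟩
    · linarith
    · nlinarith
  obtain ⟨b, hb1, hb2⟩ : ∃ b : ℕ, 2 * L + 11 ≤ b ∧ (b : ℝ) ≤ 14 * L := by
    refine ⟨⌈2 * L + 11⌉₊, Nat.le_ceil _, (Nat.ceil_lt_add_one (by positivity)).le.trans ?_⟩
    linarith
  obtain ⟨a, c, hq, hg, hc⟩ := SparseSim.exists_simulation n p d b K s hM hd ht (r := r)
    (by rw [← hτ]; exact hr1)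
  have hrK : (r : ℝ) * K ≤ c₁ * τ * ((κ + 1) * G) := by gcongr
  have hr0 : (0 : ℝ) ≤ r := Nat.cast_nonneg r
  have hrK0 : (0 : ℝ) ≤ r * K := by positivity
  refine ⟨a, c, ?_, ?_, fun H O hH _ hHM hO => ?_⟩
  · have h1 : (SparseSim.Circuit.queryCount c : ℝ) ≤ r * (18 * K) := by exact_mod_cast hq
    calc _ ≤ 18 * ((r : ℝ) * K) := h1.trans (le_of_eq (by ring))
      _ ≤ 90000 * (c₁ * τ * ((κ + 1) * G)) := by gcongr; norm_num
      _ = _ := by rw [hC]; ring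
  · have h1 : (SparseSim.Circuit.gateCount c : ℝ) ≤
        r * (35 * (K * (140 * b + 418 + 12 * n) + 67) + 39) := by exact_mod_cast hg
    have hL52 : L ≤ L ^ (5 / 2 : ℝ) := Real.self_le_rpow_of_one_le hL.le (by norm_num)
    have hn : (0 : ℝ) ≤ n := Nat.cast_nonneg n
    have h2 : 35 * ((K : ℝ) * (140 * b + 418 + 12 * n) + 67) + 39 ≤
        K * (90000 * (n + L ^ (5 / 2 : ℝ))) := by
      have h3 : 35 * (140 * (b : ℝ) + 418 + 12 * n) + 2384 ≤ 90000 * (n + L ^ (5 / 2 : ℝ)) := by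
        linarith
      have h4 := mul_le_mul_of_nonneg_left h3 (by linarith : (0 : ℝ) ≤ K)
      linarith
    calc _ ≤ (r : ℝ) * (K * (90000 * (n + L ^ (5 / 2 : ℝ)))) :=
          h1.trans (mul_le_mul_of_nonneg_left h2 hr0)
      _ = (r * K) * (90000 * (n + L ^ (5 / 2 : ℝ))) := by ring
      _ ≤ c₁ * τ * ((κ + 1) * G) * (90000 * (n + L ^ (5 / 2 : ℝ))) := by gcongr
      _ = _ := by rw [hC]; ring
  · have hετ : ε ≤ τ := by
      rw [← one_le_div hε, ← heL]
      exact Real.one_le_exp (by linarith)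
    have hη : ε / (C * d * t) ≤ M := by
      rw [div_le_iff₀ (by positivity)]
      calc ε ≤ 1 * τ := by linarith
        _ ≤ C * τ := by gcongr; linarith
        _ = M * (C * d * t) := by rw [hτ]; ring
    refine (hc H O _ hH hHM hO hη).trans (ENNReal.ofReal_le_ofReal ?_)
    -- the errors of the oracle, of the truncated entries and of the Taylor polynomials
    have e1 : 64 * (d * t * (ε / (C * d * t))) ≤ ε / 4 := by
      have : 64 * (d * t * (ε / (C * d * t))) = 64 * ε / C := by field_simp
      rw [this, div_le_iff₀ (by linarith)]
      nlinarith
    have e2 : 64 * (d * t * (8 * M / 2 ^ b)) ≤ ε / 4 := by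
      have h1 := SparseSim.exp_mul_le_two_pow (by linarith) hb1
      rw [heL, mul_div_assoc', div_le_iff₀ hε] at h1
      have : 64 * (d * t * (8 * M / 2 ^ b)) = 512 * τ / 2 ^ b := by rw [hτ]; ring
      rw [this, div_le_iff₀ (by positivity)]
      linarith
    have e3 : 8 * r / (K + 1).factorial ≤ ε / 2 := by
      have h1 := SparseSim.exp_mul_le_factorial hL hκ3 (k := K + 1)
        (hK1.trans (by push_cast; linarith))
      have h2 : 16 * c₁ * (τ / ε) ≤ Real.exp (κ / 2 * L) := by
        rw [← heL, ← Real.exp_log (by linarith : 0 < 16 * c₁), ← Real.exp_add,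
          Real.exp_le_exp, hκ]
        nlinarith
      have h3 := h2.trans h1
      rw [mul_div_assoc', div_le_iff₀ hε] at h3
      rw [div_le_iff₀ (by positivity)]
      linarith
    have : 64 * (d * t * (ε / (C * d * t) + 8 * M / 2 ^ b)) =
        64 * (d * t * (ε / (C * d * t))) + 64 * (d * t * (8 * M / 2 ^ b)) := by ring
    rw [this]
    linarith
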